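/- **Setting.** Let $N\ge 2$ and let $\mathcal S=\{S_1,\dots,S_N\}$ be an iterated function system (IFS) of contracting similitudes of $\mathbb R^d$ with invariant set $K$, i.e. the unique non-empty compact set with $K=\bigcup_{i=1}^N S_i(K)$; put $s=\dim_H K$ and let $\mathcal H^s$ be $s$-dimensional Hausdorff measure. Assume the open set condition (OSC): there is a non-empty open set $U$ such that the sets $S_i(U)$ are pairwise disjoint subsets of $U$. A set $A\subset K$ is a *skeleton* if $A\subset\bigcup_i S_i(A)$ and the graph on $\{1,\dots,N\}$ joining $i\ne j$ when $S_i(A)\cap S_j(A)\ne\emptyset$ is connected. Let $A=\{a_1,\dots,a_m\}$ be a finite skeleton with distinct points listed in a fixed order, and put $a_{m+1}=a_1$. **Paths.** Let $v_j$ be a formal edge from $a_j$ to $a_{j+1}$, and $v_j^{-1}$ a formal edge from $a_{j+1}$ to $a_j$ (these $2m$ edges are regarded as distinct); let $V=\{v_1,\dots,v_m,v_1^{-1},\dots,v_m^{-1}\}$ and $(v_j^{-1})^{-1}=v_j$. For $v\in V$ and a word $I=i_1\cdots i_n$ over $\{1,\dots,N\}$, $S_I(v)$ is the formal edge, labelled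 by $I$ and $v$, whose end points are the images under $S_I=S_{i_1}\circ\cdots\circ S_{i_n}$ of those of $v$. For an orientation vector $\beta\in\{1,-1\}^N$, let $G(\mathcal S,A,\beta)$ be the directed multigraph with edges $S_i(v_j^{\beta_i})$, $1\le i\le N$, $1\le j\le m$. A *unicursal path* of it is a path using every edge exactly once. A *partition* $P=P_1+\cdots+P_m$ of such a path $P$ writes it as the concatenation of pairwise edge-disjoint paths; it is *consistent* if $P_j$ goes from $a_j$ to $a_{j+1}$ for every $j$. **Induced substitution and GIFS.** Write $P_j=S_{j,1}(v_{j,1})\cdots S_{j,\ell_j}(v_{j,\ell_j})$ with $S_{j,k}\in\mathcal S$, $v_{j,k}\in V$, and $P_j^{-1}=S_{j,\ell_j}(v_{j,\ell_j}^{-1})\cdots S_{j,1}(v_{j,1}^{-1})$. The fine substitution is $\tau(v_j)=P_j$, $\tau(v_j^{-1})=P_j^{-1}$, iterated by $\tau(S_I(u))=S_I(\tau(u))$ and concatenation. The coarse substitution $\tau^*$ on $\{v_1,\dots,v_m\}$ maps $v_j$ to the word $|v_{j,1}|\cdots|v_{j,\ell_j}|$, where $|v_i|=|v_i^{-1}|=v_i$.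 The partition is *primitive* if for some $n\ge 1$ every $v_i$ occurs in $(\tau^*)^n(v_j)$ for every $j$. It *contains a pure cell* if there are $n$, a word $I$ of length $n$ and $u\in V$ such that all of $S_I(v_1),\dots,S_I(v_m)$, or all of $S_I(v_1^{-1}),\dots,S_I(v_m^{-1})$, are edges of $\tau^n(u)$. The *induced GIFS* (graph-directed IFS) has state set $V$; if $S_i(v)$ is the $k$-th edge of $\tau(u)$, it has a bridge (edge of its base graph) from $u$ to $v$ with map $S_i$, and the bridges from $u$ are ordered by $k$. **Terminology for an ordered GIFS.** Let it have states $u$ and bridges $e$ from $o(e)$ to $t(e)$ with similitudes $g_e$. Its invariant sets are the non-empty compact sets $E_u$ with $E_u=\bigcup_{o(e)=u}g_e(E_{t(e)})$. It is *linear* if for every state $u$, every $k\ge1$, and any two paths $\gamma=e_1\cdots e_k$, $\omega=f_1\cdots f_k$ of length $k$ from $u$ that are adjacent in the dictionary order, the sets $g_{e_1}\circ\cdots\circ g_{e_k}(E_{t(e_k)})$ and $g_{f_1}\circ\cdots\circ g_{f_k}(E_{t(f_k)})$ intersect. It satisfies the *OSC* if there are non-empty open sets $U_u$ such that $g_e(U_{t(e)})\subset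 U_{o(e)}$ for all $e$, and the sets $g_e(U_{t(e)})$ for distinct $e$ with the same origin are disjoint. **Theorem 1.3.** Suppose there are a finite skeleton $A$ (as above), an orientation vector $\beta$ and a unicursal path $P$ of $G(\mathcal S,A,\beta)$ with a partition $P=P_1+\cdots+P_m$ that is consistent, primitive and contains a pure cell. Then: (i) the induced GIFS is a linear GIFS satisfying the OSC; (ii) the induced GIFS has a unique family of invariant sets $\{E_v\}_{v\in V}$, and $K=\bigcup_{j=1}^m E_{v_j}$ with $\mathcal H^s(E_{v_i}\cap E_{v_j})=0$ for $i\neq j$; (iii) $K$ admits an optimal parameterization: $s>0$, $0<c:=\mathcal H^s(K)<\infty$, and there is a map $\varphi$ from $[0,1]$ onto $K$ such that, with $\mathcal L$ denoting Lebesgue measure, (a) $\varphi$ restricts to a bijection $I'\to K'$ for some $I'\subset[0,1]$ and $K'\subset K$ with $\mathcal L([0,1]\setminus I')=0=\mathcal H^s(K\setminus K')$; (b) $\mathcal H^s(\varphi(F))=c\,\mathcal L(F)$ and $\mathcal L(\varphi^{-1}(B))=c^{-1}\mathcal H^s(B)$ for all Borel sets $F\subset[0,1]$, $B\subset K$; (c)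 $|\varphi(x)-\varphi(y)|\le C|x-y|^{1/s}$ for all $x,y\in[0,1]$ and some constant $C$. -/

import Mathlib

open scoped NNReal ENNReal MeasureTheory

/-! ### Iterated function systems -/

/-- A contracting similitude: `dist (f x) (f y) = c * dist x y` for some ratio `0 < c < 1`. -/
def IsContractingSimilitude {X : Type} [MetricSpace X] (f : X → X) : Prop :=
  ∃ c : ℝ, 0 < c ∧ c < 1 ∧ ∀ x y, dist (f x) (f y) = c * dist x y

/-- `K` is the invariant set of the IFS `S`: non-empty, compact, and the union of its images. -/
def IsInvariantSet {X : Type} [MetricSpace X] {N : ℕ} (S : Fin N → X → X) (K : Set X) : Prop :=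
  K.Nonempty ∧ IsCompact K ∧ K = ⋃ i, S i '' K

/-- The open set condition for an IFS. (For contractions, intersecting `U` with a large ball shows
that asking `U` to be bounded as well would give the same notion.) -/
def IFSOpenSetCondition {X : Type} [MetricSpace X] {N : ℕ} (S : Fin N → X → X) : Prop :=
  ∃ U : Set X, IsOpen U ∧ U.Nonempty ∧ (∀ i, S i '' U ⊆ U) ∧
    ∀ i j, i ≠ j → Disjoint (S i '' U) (S j '' U)

/-- The Hata graph `H(F)`: vertices are the (indices of the) maps of the IFS, and `i`, `j` are
joined if and only if `S i (F)` meets `S j (F)`. -/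
def hataGraph {X : Type} {N : ℕ} (S : Fin N → X → X) (F : Set X) : SimpleGraph (Fin N) where
  Adj i j := i ≠ j ∧ (S i '' F ∩ S j '' F).Nonempty
  symm := ⟨fun _ _ h => ⟨h.1.symm, by rw [Set.inter_comm]; exact h.2⟩⟩
  loopless := ⟨fun _ h => h.1 rfl⟩

/-- A skeleton of the IFS `S` with invariant set `K`. -/
def IsSkeleton {X : Type} {N : ℕ} (S : Fin N → X → X) (K A : Set X) : Prop :=
  A ⊆ K ∧ (hataGraph S A).Connected ∧ A ⊆ ⋃ i, S i '' A

/-! ### Paths in directed multigraphs -/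

/-- `IsWalk src tgt x p y`: the list of edges `p` is a path from the vertex `x` to the vertex `y`
in the directed multigraph whose edges run from `src e` to `tgt e`. -/
def IsWalk {ε V : Type} (src tgt : ε → V) : V → List ε → V → Prop
  | x, [], y => x = y
  | x, e :: p, y => src e = x ∧ IsWalk src tgt (tgt e) p y

/-! ### Ordered and linear graph-directed iterated function systems -/

/-- An ordered graph-directed iterated function system on the space `X` with state set `V`:
a finite set of edges (`Bridge`) between states, a contracting similitude on each edge, and a
partial order on the edges which is linear on the edges emanating from one state and in which
edges emanating from different states are not comparable. -/
structure OrderedGIFS (X : Type) [MetricSpace X] (V : Type) where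
  Bridge : Type
  finite_bridge : Finite Bridge
  init : Bridge → V
  term : Bridge → V
  map : Bridge → X → X
  similitude : ∀ e, IsContractingSimilitude (map e)
  order : PartialOrder Bridge
  total : ∀ e f, init e = init f → e ≤ f ∨ f ≤ e
  init_eq_of_le : ∀ e f, e ≤ f → init e = init f

namespace OrderedGIFS

variable {X : Type} [MetricSpace X] {V : Type} (G : OrderedGIFS X V)

/-- `Γ_i^k`, the set of paths of length `k` emanating from the state `i`. -/
def paths (i : V) (k : ℕ) : Set (List G.Bridge) :=
  {p | p.length = k ∧ ∃ j, IsWalk G.init G.term i p j}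

/-- The dictionary order on paths (used only for paths of the same length). -/
def dictLT (p q : List G.Bridge) : Prop :=
  List.Lex G.order.lt p q

/-- `p` and `q` are adjacent elements of `Γ_i^k` in the dictionary order, with `p ≺ q`. -/
def Adjacent (i : V) (k : ℕ) (p q : List G.Bridge) : Prop :=
  p ∈ G.paths i k ∧ q ∈ G.paths i k ∧ G.dictLT p q ∧
    ∀ r ∈ G.paths i k, ¬ (G.dictLT p r ∧ G.dictLT r q)

/-- The non-empty compact sets `E i` are the invariant sets of the GIFS:
`E i` is the union of the sets `g_e (E (t e))` over the edges `e` emanating from `i`. -/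
def IsInvariantFamily (E : V → Set X) : Prop :=
  (∀ i, (E i).Nonempty ∧ IsCompact (E i)) ∧
    ∀ i, E i = ⋃ e : {e : G.Bridge // G.init e = i}, G.map e '' E (G.term e)

/-- For a path `p = e₁ … eₙ` from `i` to `j`, the set `g_{e₁} ∘ ⋯ ∘ g_{eₙ} (E j)`. -/
def cylinder (E : V → Set X) : V → List G.Bridge → Set X
  | i, [] => E i
  | _, e :: p => G.map e '' cylinder E (G.term e) p

/-- An ordered GIFS is linear if the cylinders of adjacent paths of the same length, emanating from
the same state, always meet. -/
def IsLinear : Prop :=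
  ∀ E, G.IsInvariantFamily E → ∀ i, ∀ k ≥ 1, ∀ p q, G.Adjacent i k p q →
    (G.cylinder E i p ∩ G.cylinder E i q).Nonempty

/-- The open set condition for a GIFS. (Again boundedness of the open sets would change nothing.) -/
def OpenSetCondition : Prop :=
  ∃ U : V → Set X, (∀ i, IsOpen (U i) ∧ (U i).Nonempty) ∧
    (∀ e, G.map e '' U (G.term e) ⊆ U (G.init e)) ∧
    ∀ e f, e ≠ f → G.init e = G.init f →
      Disjoint (G.map e '' U (G.term e)) (G.map f '' U (G.term f))

end OrderedGIFS

/-! ### The loop through the skeleton, unicursal paths and their partitions -/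

/-- The set `V = {v_1, …, v_m} ∪ {v_1⁻¹, …, v_m⁻¹}` of abstract oriented edges; the pair `(j, 1)` is
`v_j`, the edge from `a_j` to `a_{j+1}`, and `(j, -1)` is `v_j⁻¹`, the edge from `a_{j+1}` to `a_j`.
Indices are cyclic. -/
abbrev OEdge (m : ℕ) : Type := Fin m × ℤˣ

/-- The reverse edge. -/
def OEdge.rev {m : ℕ} (v : OEdge m) : OEdge m := (v.1, -v.2)

def OEdge.src {X : Type} {m : ℕ} [NeZero m] (a : Fin m → X) (v : OEdge m) : X :=
  if v.2 = 1 then a v.1 else a (v.1 + 1)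

def OEdge.tgt {X : Type} {m : ℕ} [NeZero m] (a : Fin m → X) (v : OEdge m) : X :=
  if v.2 = 1 then a (v.1 + 1) else a v.1

/-- Edges of the induced graph `G = ⋃ S_i(V)`: the pair `(i, v)` is the affine copy `S_i(v)`, where
copies with different labels count as different edges. -/
abbrev CopyEdge (N m : ℕ) : Type := Fin N × OEdge m

/-- `S_i(v)` starts at the image under `S_i` of the starting point of `v`. -/
def CopyEdge.src {X : Type} {N m : ℕ} [NeZero m] (S : Fin N → X → X) (a : Fin m → X)
    (e : CopyEdge N m) : X :=
  S e.1 (OEdge.src a e.2)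

def CopyEdge.tgt {X : Type} {N m : ℕ} [NeZero m] (S : Fin N → X → X) (a : Fin m → X)
    (e : CopyEdge N m) : X :=
  S e.1 (OEdge.tgt a e.2)

/-- The edge set of `G(S, A, β) = ⋃ S_i(Λ₀^{β_i})`, where `Λ₀ = v_1 + ⋯ + v_m`. -/
def orientedGraph {N : ℕ} (m : ℕ) (β : Fin N → ℤˣ) : Set (CopyEdge N m) :=
  {e | e.2.2 = β e.1}

/-- `P` is a unicursal path of `G(S, A, β)`: it uses every edge exactly once, and no other edge. -/
def IsUnicursal {X : Type} {N m : ℕ} [NeZero m] (S : Fin N → X → X) (a : Fin m → X)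
    (β : Fin N → ℤˣ) (P : List (CopyEdge N m)) : Prop :=
  (∃ x y, IsWalk (CopyEdge.src S a) (CopyEdge.tgt S a) x P y) ∧
    P.Nodup ∧ ∀ e, e ∈ P ↔ e ∈ orientedGraph m β

/-- `P = Q_1 + ⋯ + Q_m` is the concatenation of pairwise disjoint pieces. -/
def IsPathPartition {N m : ℕ} (P : List (CopyEdge N m)) (Q : Fin m → List (CopyEdge N m)) : Prop :=
  P = (List.ofFn Q).flatten ∧ ∀ i j, i ≠ j → List.Disjoint (Q i) (Q j)

/-- The partition is consistent: `Q_j` is a path from `a_j` to `a_{j+1}`. -/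
def IsConsistent {X : Type} {N m : ℕ} [NeZero m] (S : Fin N → X → X) (a : Fin m → X)
    (Q : Fin m → List (CopyEdge N m)) : Prop :=
  ∀ j, IsWalk (CopyEdge.src S a) (CopyEdge.tgt S a) (a j) (Q j) (a (j + 1))

/-! ### Substitution rules -/

/-- The fine substitution rule `v_j ↦ Q_j`, `v_j⁻¹ ↦ Q_j⁻¹`, where the reverse path lists the
reversed edges in the opposite order. -/
def fineRule {N m : ℕ} (Q : Fin m → List (CopyEdge N m)) (v : OEdge m) : List (CopyEdge N m) :=
  if v.2 = 1 then Q v.1 else (Q v.1).reverse.map fun e => (e.1, e.2.rev)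

/-- The iterates `τⁿ(u)` of the fine substitution rule; the pair `(I, v)` is the edge
`S_I(v) = S_{i_1} ∘ ⋯ ∘ S_{i_n} (v)`, and `τ(S_I(v)) = S_I(τ(v))`. -/
def fineIter {N m : ℕ} (Q : Fin m → List (CopyEdge N m)) (u : OEdge m) :
    ℕ → List (List (Fin N) × OEdge m)
  | 0 => [([], u)]
  | n + 1 => (fineIter Q u n).flatMap fun w =>
      (fineRule Q w.2).map fun e => (w.1 ++ [e.1], e.2)

/-- The coarse substitution `v_j ↦ |v_{j,1}| … |v_{j,ℓ_j}|` over the alphabet `{v_1, …, v_m}`. -/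
def coarseRule {N m : ℕ} (Q : Fin m → List (CopyEdge N m)) (j : Fin m) : List (Fin m) :=
  (Q j).map fun e => e.2.1

/-- The partition is primitive: for some `n ≥ 1` every letter appears in the image of every letter
under the `n`-th iterate of the coarse substitution. -/
def IsPrimitivePartition {N m : ℕ} (Q : Fin m → List (CopyEdge N m)) : Prop :=
  ∃ n ≥ 1, ∀ u v : Fin m, u ∈ (fun w : List (Fin m) => w.flatMap (coarseRule Q))^[n] [v]

/-- The partition contains a pure cell: for some word `I`, all the edges of the positive
`S_I`-cell `{S_I(v_j)}` or of the negative one `{S_I(v_j⁻¹)}` lie on one path `τⁿ(u)`, `n = |I|`. -/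
def HasPureCell {N m : ℕ} (Q : Fin m → List (CopyEdge N m)) : Prop :=
  ∃ (I : List (Fin N)) (ε : ℤˣ) (u : OEdge m), ∀ j : Fin m, (I, (j, ε)) ∈ fineIter Q u I.length

/-- The ordered GIFS induced by a partition: the states are the elements of `V`, the `k`-th bridge
from the state `u` carries the map `S_i` and ends at `v`, where `S_i(v)` is the `k`-th edge of the
path `τ(u)`, and the bridges from `u` are ordered by `k`. -/
def inducedGIFS {X : Type} [MetricSpace X] {N m : ℕ} (S : Fin N → X → X)
    (hS : ∀ i, IsContractingSimilitude (S i)) (Q : Fin m → List (CopyEdge N m)) :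
    OrderedGIFS X (OEdge m) where
  Bridge := Σ u : OEdge m, Fin (fineRule Q u).length
  finite_bridge := inferInstance
  init e := e.1
  term e := ((fineRule Q e.1).get e.2).2
  map e := S ((fineRule Q e.1).get e.2).1
  similitude _ := hS _
  order := inferInstance -- the disjoint sum of the usual orders on the index sets
  total := by
    rintro ⟨u, k⟩ ⟨v, l⟩ h
    obtain rfl : u = v := h
    exact (le_total k l).imp (Sigma.LE.fiber _ _ _) (Sigma.LE.fiber _ _ _)
  init_eq_of_le := by
    rintro _ _ ⟨u, k, l, h⟩
    rfl

/-! ### Optimal parameterizations -/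

/-- `φ : [0, 1] → K` is an optimal parameterization of the `s`-set `K`: it is onto, almost
one-to-one, measure-preserving (up to the normalizing factor `H^s(K)`), and `1/s`-Hölder. -/
structure IsOptimalParameterization {X : Type} [MetricSpace X] [MeasurableSpace X] [BorelSpace X]
    (s : ℝ≥0) (K : Set X) (φ : ℝ → X) : Prop where
  dim_pos : 0 < s
  measure_pos : 0 < μH[(s : ℝ)] K
  measure_lt_top : μH[(s : ℝ)] K < ∞
  image_eq : φ '' Set.Icc 0 1 = K
  almost_injective : ∃ I' ⊆ Set.Icc (0 : ℝ) 1, ∃ K' ⊆ K,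
    MeasureTheory.volume (Set.Icc (0 : ℝ) 1 \ I') = 0 ∧ μH[(s : ℝ)] (K \ K') = 0 ∧ Set.BijOn φ I' K'
  measure_image : ∀ F ⊆ Set.Icc (0 : ℝ) 1, MeasurableSet F →
    μH[(s : ℝ)] (φ '' F) = μH[(s : ℝ)] K * MeasureTheory.volume F
  measure_preimage : ∀ B ⊆ K, MeasurableSet B →
    MeasureTheory.volume (Set.Icc 0 1 ∩ φ ⁻¹' B) = (μH[(s : ℝ)] K)⁻¹ * μH[(s : ℝ)] B
  holder : ∃ C : ℝ≥0, HolderOnWith C (1 / s) φ (Set.Icc 0 1)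

/-!
The edges of `P` are the pieces of the sets `E_v` at the first level of the substitution. Each edge
`S_i(v_l^{β_i})` is used exactly once and `∑ r_i ^ s = 1` by Moran's theorem, so subadditivity of
`μH[s]` along the pieces is an equality: the pieces of a set `E_v`, at every level, overlap in null
sets. A pure cell contains copies of all the sets `E_{v_j}` among such pieces, so these sets have
null overlaps too, while primitivity makes all of them of positive measure. Hence each `E_{v_j}` has
a point outside the other ones, and small balls around these points, spread by the substitution
inside the open set of the IFS, give the open sets of the induced system.

Consistency makes consecutive pieces share an end point, which gives linearity. For the
parameterization, the interval `[0, μH[s] K]` is subdivided according to the substitution, with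
lengths proportional to the measures of the pieces. The limit curve maps subintervals onto pieces of
the same measure, and a piece `S_I(E_v)` of measure about `r_I ^ s` has diameter about `r_I`, whence
the Hölder exponent `1 / s`.
-/

open MeasureTheory Set Filter Topology

/-! ### Similitudes -/

/-- `f` is a similitude of ratio `c > 0`. -/
structure IsSimilitude {X : Type*} [MetricSpace X] (c : ℝ) (f : X → X) : Prop where
  ratio_pos : 0 < c
  dist_map : ∀ x y, dist (f x) (f y) = c * dist x y

namespace IsSimilitude

section MetricSpace

variable {X : Type*} [MetricSpace X] {c : ℝ} {f : X → X}

theorem lipschitzWith (hf : IsSimilitude c f) : LipschitzWith c.toNNReal f :=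
  LipschitzWith.of_dist_le_mul fun x y => by
    rw [hf.dist_map, Real.coe_toNNReal c hf.ratio_pos.le]

theorem antilipschitzWith (hf : IsSimilitude c f) : AntilipschitzWith c⁻¹.toNNReal f :=
  AntilipschitzWith.of_le_mul_dist fun x y => by
    rw [hf.dist_map, Real.coe_toNNReal _ (inv_nonneg.2 hf.ratio_pos.le),
      inv_mul_cancel_left₀ hf.ratio_pos.ne']

theorem continuous (hf : IsSimilitude c f) : Continuous f := hf.lipschitzWith.continuous

theorem injective (hf : IsSimilitude c f) : Function.Injective f := hf.antilipschitzWith.injective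

theorem hausdorffMeasure_image [MeasurableSpace X] [BorelSpace X] (hf : IsSimilitude c f) {s : ℝ}
    (hs : 0 ≤ s) (A : Set X) : μH[s] (f '' A) = ENNReal.ofReal (c ^ s) * μH[s] A := by
  have hcs : ENNReal.ofReal (c ^ s) = (c.toNNReal : ℝ≥0∞) ^ s :=
    (ENNReal.ofReal_rpow_of_pos hf.ratio_pos).symm
  have hinv : (c.toNNReal : ℝ≥0∞) ^ s * (c⁻¹.toNNReal : ℝ≥0∞) ^ s = 1 := by
    rw [← ENNReal.mul_rpow_of_nonneg _ _ hs, ← ENNReal.coe_mul,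
      ← Real.toNNReal_mul hf.ratio_pos.le, mul_inv_cancel₀ hf.ratio_pos.ne']
    simp
  rw [hcs]
  refine le_antisymm (hf.lipschitzWith.hausdorffMeasure_image_le hs A) ?_
  calc (c.toNNReal : ℝ≥0∞) ^ s * μH[s] A
      ≤ (c.toNNReal : ℝ≥0∞) ^ s * ((c⁻¹.toNNReal : ℝ≥0∞) ^ s * μH[s] (f '' A)) := by
        gcongr; exact hf.antilipschitzWith.le_hausdorffMeasure_image hs A
    _ = μH[s] (f '' A) := by rw [← mul_assoc, hinv, one_mul]

end MetricSpace

section FiniteDimensional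

variable {E : Type*} [NormedAddCommGroup E] [NormedSpace ℝ E] [FiniteDimensional ℝ E] {c : ℝ}
  {f : E → E}

/-- The image of a ball of radius `R` is a closed subset of a ball of radius `c R`, and it has full
Hausdorff measure there. -/
theorem ball_subset_image (hf : IsSimilitude c f) (x : E) {R : ℝ} (hR : 0 ≤ R) :
    Metric.ball (f x) (c * R) ⊆ f '' Metric.closedBall x R := by
  borelize E
  let μ : Measure E := μH[(Module.finrank ℝ E : ℝ)]
  have himage : IsCompact (f '' Metric.closedBall x R) :=
    (isCompact_closedBall x R).image hf.continuous
  have hmeas : μ (f '' Metric.closedBall x R) = μ (Metric.closedBall (f x) (c * R)) := by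
    rw [hf.hausdorffMeasure_image (Nat.cast_nonneg _)]
    change _ * μ (Metric.closedBall x R) = _
    rw [Measure.addHaar_closedBall μ _ hR,
      Measure.addHaar_closedBall μ _ (mul_nonneg hf.ratio_pos.le hR), Real.rpow_natCast,
      ← mul_assoc, ← ENNReal.ofReal_mul (pow_nonneg hf.ratio_pos.le _), mul_pow]
  have hsub : f '' Metric.closedBall x R ⊆ Metric.closedBall (f x) (c * R) := by
    rintro _ ⟨y, hy, rfl⟩
    rw [Metric.mem_closedBall, hf.dist_map]
    exact mul_le_mul_of_nonneg_left hy hf.ratio_pos.le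
  have hnull : μ (Metric.closedBall (f x) (c * R) \ f '' Metric.closedBall x R) = 0 := by
    rw [measure_sdiff hsub himage.measurableSet.nullMeasurableSet himage.measure_lt_top.ne, hmeas,
      tsub_self]
  rw [← sdiff_eq_empty]
  exact (Metric.isOpen_ball.sdiff himage.isClosed).eq_empty_of_measure_zero
    (measure_mono_null (sdiff_subset_sdiff_left Metric.ball_subset_closedBall) hnull)

theorem surjective (hf : IsSimilitude c f) : Function.Surjective f := fun y => by
  have hR : 0 ≤ (dist y (f 0) + 1) / c := div_nonneg (by positivity) hf.ratio_pos.le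
  obtain ⟨x, -, hx⟩ := hf.ball_subset_image 0 hR (show y ∈ _ by
    rw [mul_div_cancel₀ _ hf.ratio_pos.ne', Metric.mem_ball]
    exact lt_add_one _)
  exact ⟨x, hx⟩

theorem isOpenMap (hf : IsSimilitude c f) : IsOpenMap f :=
  (hf.antilipschitzWith.isInducing hf.continuous |>.isOpenMap) (by
    rw [hf.surjective.range_eq]; exact isOpen_univ)

theorem image_closedBall (hf : IsSimilitude c f) (x : E) (R : ℝ) :
    f '' Metric.closedBall x R = Metric.closedBall (f x) (c * R) := by
  rw [← image_preimage_eq (Metric.closedBall (f x) (c * R)) hf.surjective]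
  congr 1
  ext y
  simp [hf.dist_map, hf.ratio_pos]

end FiniteDimensional

end IsSimilitude

/-- The maps `S i` are similitudes of ratios `r i < 1`. -/
structure IsSimilitudeIFS {X ι : Type*} [MetricSpace X] (S : ι → X → X) (r : ι → ℝ) : Prop where
  isSimilitude : ∀ i, IsSimilitude (r i) (S i)
  ratio_lt_one : ∀ i, r i < 1

theorem exists_isSimilitudeIFS {X : Type} {ι : Type*} [MetricSpace X] {S : ι → X → X}
    (hS : ∀ i, IsContractingSimilitude (S i)) : ∃ r, IsSimilitudeIFS S r := by
  choose r hr0 hr1 hr using hS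
  exact ⟨r, fun i => ⟨hr0 i, hr i⟩, hr1⟩

theorem exists_pos_forall_le_of_finite {ι : Type*} [Finite ι] {f : ι → ℝ} (hf : ∀ i, 0 < f i) :
    ∃ δ : ℝ, 0 < δ ∧ ∀ i, δ ≤ f i := by
  cases isEmpty_or_nonempty ι
  · exact ⟨1, one_pos, fun i => isEmptyElim i⟩
  · obtain ⟨i, hi⟩ := Finite.exists_min f
    exact ⟨f i, hf i, hi⟩

namespace IsSimilitudeIFS

variable {X ι : Type*} [MetricSpace X] {S : ι → X → X} {r : ι → ℝ}

theorem ratio_pos (hS : IsSimilitudeIFS S r) (i : ι) : 0 < r i := (hS.isSimilitude i).ratio_pos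

theorem continuous (hS : IsSimilitudeIFS S r) (i : ι) : Continuous (S i) :=
  (hS.isSimilitude i).continuous

theorem injective (hS : IsSimilitudeIFS S r) (i : ι) : Function.Injective (S i) :=
  (hS.isSimilitude i).injective

theorem exists_uniform_ratio [Finite ι] (hS : IsSimilitudeIFS S r) :
    ∃ ρ : ℝ, 0 < ρ ∧ ρ < 1 ∧ ∀ i, r i ≤ ρ := by
  cases isEmpty_or_nonempty ι
  · exact ⟨1 / 2, by norm_num, by norm_num, fun i => isEmptyElim i⟩
  · obtain ⟨i, hi⟩ := Finite.exists_max r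
    exact ⟨r i, hS.ratio_pos i, hS.ratio_lt_one i, hi⟩

end IsSimilitudeIFS

/-! ### Families of sets invariant under a rule -/

/-- The non-empty compact sets `E u` satisfy `E u = ⋃ S i (E v)`, the union running over the pairs
`(i, v) ∈ rule u`: they are the invariant sets of the graph-directed system with an edge from `u` to
`v`, carrying the map `S i`, for every such pair. -/
structure IsRuleInvariant {X ι V : Type*} [TopologicalSpace X] (S : ι → X → X)
    (rule : V → Set (ι × V)) (E : V → Set X) : Prop where
  nonempty : ∀ u, (E u).Nonempty
  isCompact : ∀ u, IsCompact (E u)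
  eq_iUnion : ∀ u, E u = ⋃ e ∈ rule u, S e.1 '' E e.2

namespace IsSimilitudeIFS

variable {X ι V : Type*} [MetricSpace X] [Finite ι] {S : ι → X → X} {r : ι → ℝ}
  {rule : V → Set (ι × V)} {E F : V → Set X}

/-- Following the rule `n` times from a point of `E u` brings it within `ρ ^ n * D` of `F u`. -/
theorem subset_of_subinvariant_of_dist_le (hS : IsSimilitudeIFS S r)
    (hE : ∀ u, E u ⊆ ⋃ e ∈ rule u, S e.1 '' E e.2) (hF : ∀ u, ∀ e ∈ rule u, S e.1 '' F e.2 ⊆ F u)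
    (hFc : ∀ u, IsClosed (F u)) {D : ℝ} (hD : ∀ u, ∀ x ∈ E u, ∃ y ∈ F u, dist x y ≤ D) (u : V) :
    E u ⊆ F u := by
  obtain ⟨ρ, hρ0, hρ1, hρ⟩ := hS.exists_uniform_ratio
  have hdist : ∀ n : ℕ, ∀ u, ∀ x ∈ E u, ∃ y ∈ F u, dist x y ≤ ρ ^ n * D := by
    intro n
    induction n with
    | zero => simpa using hD
    | succ n ih =>
      intro u x hx
      obtain ⟨e, he, y, hy, rfl⟩ := mem_iUnion₂.1 (hE u hx)
      obtain ⟨z, hz, hyz⟩ := ih e.2 y hy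
      refine ⟨S e.1 z, hF u e he (mem_image_of_mem _ hz), ?_⟩
      calc dist (S e.1 y) (S e.1 z) = r e.1 * dist y z := (hS.isSimilitude _).dist_map y z
        _ ≤ ρ * (ρ ^ n * D) := mul_le_mul (hρ _) hyz dist_nonneg hρ0.le
        _ = ρ ^ (n + 1) * D := by ring
  intro x hx
  rw [← (hFc u).closure_eq, Metric.mem_closure_iff]
  intro ε hε
  have hlim : Tendsto (fun n : ℕ => ρ ^ n * D) atTop (𝓝 0) := by
    simpa using (tendsto_pow_atTop_nhds_zero_of_lt_one hρ0.le hρ1).mul_const D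
  obtain ⟨n, hn⟩ := (hlim.eventually (gt_mem_nhds hε)).exists
  obtain ⟨y, hy, hxy⟩ := hdist n u x hx
  exact ⟨y, hy, hxy.trans_lt hn⟩

theorem subset_of_subinvariant [Finite V] (hS : IsSimilitudeIFS S r)
    (hE : ∀ u, E u ⊆ ⋃ e ∈ rule u, S e.1 '' E e.2) (hEb : ∀ u, Bornology.IsBounded (E u))
    (hF : ∀ u, ∀ e ∈ rule u, S e.1 '' F e.2 ⊆ F u)
    (hFc : ∀ u, IsClosed (F u)) (hFn : ∀ u, (F u).Nonempty) (u : V) : E u ⊆ F u := by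
  choose y hy using hFn
  obtain ⟨D, hD⟩ := Metric.isBounded_iff.1
    (((Bornology.isBounded_iUnion).2 hEb).union (finite_range y).isBounded)
  exact hS.subset_of_subinvariant_of_dist_le hE hF hFc (fun u x hx =>
    ⟨y u, hy u, hD (Or.inl (mem_iUnion_of_mem u hx)) (Or.inr (mem_range_self u))⟩) u

end IsSimilitudeIFS

namespace IsRuleInvariant

section Topological

variable {X ι V : Type*} [TopologicalSpace X] {S : ι → X → X} {rule : V → Set (ι × V)}
  {E : V → Set X}

theorem mem_iff (hE : IsRuleInvariant S rule E) {u : V} {x : X} :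
    x ∈ E u ↔ ∃ e ∈ rule u, ∃ y ∈ E e.2, S e.1 y = x := by
  conv_lhs => rw [hE.eq_iUnion u]
  simp only [mem_iUnion₂, mem_image, exists_prop]

theorem subset_iUnion (hE : IsRuleInvariant S rule E) (u : V) :
    E u ⊆ ⋃ e ∈ rule u, S e.1 '' E e.2 :=
  (hE.eq_iUnion u).subset

theorem image_subset (hE : IsRuleInvariant S rule E) (u : V) {e : ι × V} (he : e ∈ rule u) :
    S e.1 '' E e.2 ⊆ E u := by
  rintro _ ⟨y, hy, rfl⟩
  exact hE.mem_iff.2 ⟨e, he, y, hy, rfl⟩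

end Topological

section Metric

variable {X ι V : Type*} [MetricSpace X] [Finite ι] [Finite V] {S : ι → X → X} {r : ι → ℝ}
  {rule : V → Set (ι × V)} {E F : V → Set X}

theorem subset_of_subinvariant (hF : IsRuleInvariant S rule F) (hS : IsSimilitudeIFS S r)
    (hE : ∀ u, E u ⊆ ⋃ e ∈ rule u, S e.1 '' E e.2) (hEb : ∀ u, Bornology.IsBounded (E u)) (u : V) :
    E u ⊆ F u :=
  hS.subset_of_subinvariant hE hEb (fun u _ => hF.image_subset u)
    (fun u => (hF.isCompact u).isClosed) hF.nonempty u

theorem unique (hE : IsRuleInvariant S rule E) (hF : IsRuleInvariant S rule F)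
    (hS : IsSimilitudeIFS S r) : E = F :=
  funext fun u => Subset.antisymm
    (hF.subset_of_subinvariant hS hE.subset_iUnion (fun u => (hE.isCompact u).isBounded) u)
    (hE.subset_of_subinvariant hS hF.subset_iUnion (fun u => (hF.isCompact u).isBounded) u)

end Metric

end IsRuleInvariant

/-- The invariant family is the decreasing limit of the iterates of the rule on the constant
family `K`. -/
theorem exists_isRuleInvariant {X ι V : Type*} [TopologicalSpace X] [T2Space X] [Finite ι]
    [Finite V] {S : ι → X → X} (hSc : ∀ i, Continuous (S i)) (hSi : ∀ i, Function.Injective (S i))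
    {K : Set X} (hK : IsCompact K) (hKn : K.Nonempty) (hSK : ∀ i, S i '' K ⊆ K)
    {rule : V → Set (ι × V)} (hrule : ∀ u, (rule u).Nonempty) : ∃ E, IsRuleInvariant S rule E := by
  let step : (V → Set X) → V → Set X := fun F u => ⋃ e ∈ rule u, S e.1 '' F e.2
  have hstep : Monotone step := fun F G h u => iUnion₂_mono fun e _ => image_mono (h e.2)
  let F : ℕ → V → Set X := fun n => step^[n] fun _ => K
  have hF : Antitone F :=
    hstep.antitone_iterate_of_map_le fun u => iUnion₂_subset fun e _ => hSK e.1
  have hFsucc : ∀ n u, F (n + 1) u = ⋃ e ∈ rule u, S e.1 '' F n e.2 := fun n u => by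
    simp only [F, Function.iterate_succ_apply']; rfl
  have hFcpt : ∀ n u, IsCompact (F n u) := by
    intro n
    induction n with
    | zero => exact fun _ => hK
    | succ n ih =>
      intro u
      rw [hFsucc]
      exact (toFinite _).isCompact_biUnion fun e _ => (ih e.2).image (hSc e.1)
  have hFne : ∀ n u, (F n u).Nonempty := by
    intro n
    induction n with
    | zero => exact fun _ => hKn
    | succ n ih =>
      intro u
      obtain ⟨e, he⟩ := hrule u
      rw [hFsucc]
      exact ((ih e.2).image _).mono (subset_biUnion_of_mem (u := fun e => S e.1 '' F n e.2) he)
  have hFu : ∀ u, Antitone fun n => F n u := fun u m n h => hF h u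
  refine ⟨fun u => ⋂ n, F n u, fun u => ?_, fun u => ?_, fun u => ?_⟩
  · exact IsCompact.nonempty_iInter_of_sequence_nonempty_isCompact_isClosed _
      (fun n => hF n.le_succ u) (fun n => hFne n u) (hFcpt 0 u) fun n => (hFcpt n u).isClosed
  · exact (hFcpt 0 u).of_isClosed_subset (isClosed_iInter fun n => (hFcpt n u).isClosed)
      (iInter_subset _ 0)
  · calc ⋂ n, F n u = ⋂ n, F (n + 1) u := ((hFu u).iInter_nat_add 1).symm
      _ = ⋂ n, ⋃ e : rule u, S e.1.1 '' F n e.1.2 := by simp only [hFsucc, biUnion_eq_iUnion]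
      _ = ⋃ e : rule u, ⋂ n, S e.1.1 '' F n e.1.2 :=
          iInter_iUnion_of_antitone fun e m n h => image_mono (hFu _ h)
      _ = ⋃ e ∈ rule u, S e.1 '' ⋂ n, F n e.2 := by
          simp only [biUnion_eq_iUnion, ← (hSi _).injOn.image_iInter_eq]

/-! ### Words -/

/-- The composition `S_{i_1} ∘ ⋯ ∘ S_{i_n}` along a word. -/
def wordMap {X ι : Type*} (S : ι → X → X) : List ι → X → X
  | [], x => x
  | i :: I, x => S i (wordMap S I x)

/-- The product `r_{i_1} ⋯ r_{i_n}`, which is the ratio of `wordMap S I`. -/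
def wordRatio {ι : Type*} (r : ι → ℝ) (I : List ι) : ℝ := (I.map r).prod

section Words

variable {X ι : Type*} (S : ι → X → X) (r : ι → ℝ)

@[simp] theorem wordMap_nil (x : X) : wordMap S [] x = x := rfl

@[simp] theorem wordMap_cons (i : ι) (I : List ι) (x : X) :
    wordMap S (i :: I) x = S i (wordMap S I x) := rfl

theorem wordMap_append (I J : List ι) (x : X) :
    wordMap S (I ++ J) x = wordMap S I (wordMap S J x) := by
  induction I with
  | nil => rfl
  | cons i I ih => simp only [List.cons_append, wordMap_cons, ih]

@[simp] theorem wordRatio_nil : wordRatio r [] = 1 := rfl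

@[simp] theorem wordRatio_cons (i : ι) (I : List ι) :
    wordRatio r (i :: I) = r i * wordRatio r I := by simp [wordRatio]

theorem wordRatio_concat (I : List ι) (i : ι) :
    wordRatio r (I.concat i) = wordRatio r I * r i := by simp [wordRatio]

theorem wordRatio_ofFn {n : ℕ} (w : Fin n → ι) : wordRatio r (List.ofFn w) = ∏ k, r (w k) := by
  simp [wordRatio, List.map_ofFn, List.prod_ofFn]

variable {S r}

theorem mapsTo_wordMap {U : Set X} (hU : ∀ i, MapsTo (S i) U U) (I : List ι) :
    MapsTo (wordMap S I) U U := by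
  induction I with
  | nil => exact mapsTo_id U
  | cons i I ih => exact (hU i).comp ih

theorem disjoint_wordMap_image (hinj : ∀ i, Function.Injective (S i)) {U : Set X}
    (hU : ∀ i, S i '' U ⊆ U) (hdisj : ∀ i j, i ≠ j → Disjoint (S i '' U) (S j '' U))
    {I J : List ι} (hIJ : ¬ I <+: J) (hJI : ¬ J <+: I) :
    Disjoint (wordMap S I '' U) (wordMap S J '' U) := by
  have hmaps := mapsTo_wordMap fun i => mapsTo_iff_image_subset.2 (hU i)
  induction I generalizing J with
  | nil => exact (hIJ ⟨_, rfl⟩).elim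
  | cons i I ih =>
    cases J with
    | nil => exact (hJI ⟨_, rfl⟩).elim
    | cons j J =>
      rw [Set.disjoint_left]
      rintro _ ⟨x, hx, rfl⟩ ⟨y, hy, h⟩
      by_cases hij : i = j
      · subst hij
        simp only [List.cons_prefix_cons, true_and] at hIJ hJI
        exact Set.disjoint_left.1 (ih hIJ hJI) ⟨x, hx, rfl⟩ ⟨y, hy, hinj i h⟩
      · exact Set.disjoint_left.1 (hdisj i j hij) (mem_image_of_mem _ (hmaps I hx))
          ⟨_, hmaps J hy, h⟩

end Words

namespace IsSimilitudeIFS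

variable {X ι : Type*} [MetricSpace X] {S : ι → X → X} {r : ι → ℝ}

theorem isSimilitude_wordMap (hS : IsSimilitudeIFS S r) (I : List ι) :
    IsSimilitude (wordRatio r I) (wordMap S I) := by
  induction I with
  | nil => exact ⟨one_pos, fun x y => by simp⟩
  | cons i I ih =>
    refine ⟨by rw [wordRatio_cons]; exact mul_pos (hS.ratio_pos i) ih.ratio_pos, fun x y => ?_⟩
    rw [wordMap_cons, wordMap_cons, (hS.isSimilitude i).dist_map, ih.dist_map, wordRatio_cons,
      mul_assoc]

theorem wordRatio_pos (hS : IsSimilitudeIFS S r) (I : List ι) : 0 < wordRatio r I :=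
  (hS.isSimilitude_wordMap I).ratio_pos

theorem wordRatio_le_pow (hS : IsSimilitudeIFS S r) {ρ : ℝ} (hρ : ∀ i, r i ≤ ρ) (I : List ι) :
    wordRatio r I ≤ ρ ^ I.length := by
  induction I with
  | nil => simp
  | cons i I ih =>
    rw [wordRatio_cons, List.length_cons, pow_succ']
    exact mul_le_mul (hρ i) ih (hS.wordRatio_pos I).le ((hS.ratio_pos i).le.trans (hρ i))

theorem ediam_wordMap_image_le (hS : IsSimilitudeIFS S r) {K : Set X} {M : ℝ}
    (hM : ∀ x ∈ K, ∀ y ∈ K, dist x y ≤ M) (I : List ι) :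
    Metric.ediam (wordMap S I '' K) ≤ ENNReal.ofReal (wordRatio r I * M) := by
  refine Metric.ediam_le ?_
  rintro _ ⟨x, hx, rfl⟩ _ ⟨y, hy, rfl⟩
  rw [edist_dist, (hS.isSimilitude_wordMap I).dist_map]
  exact ENNReal.ofReal_le_ofReal
    (mul_le_mul_of_nonneg_left (hM x hx y hy) (hS.wordRatio_pos I).le)

end IsSimilitudeIFS

/-! ### Coding maps -/

/-- `π ω` is the point with address `ω`: the coding map of an IFS conjugates the shift on infinite
words with the maps `S i`. -/
def IsCodingMap {X ι : Type*} (S : ι → X → X) (π : (ℕ → ι) → X) : Prop :=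
  ∀ ω, π ω = S (ω 0) (π fun n => ω (n + 1))

theorem IsCodingMap.eq_wordMap {X ι : Type*} {S : ι → X → X} {π : (ℕ → ι) → X}
    (hπ : IsCodingMap S π) (n : ℕ) (ω : ℕ → ι) :
    π ω = wordMap S ((List.range n).map ω) (π fun k => ω (n + k)) := by
  induction n generalizing ω with
  | zero => simp
  | succ n ih =>
    rw [hπ ω, ih, List.range_succ_eq_map]
    simp [Function.comp_def, add_right_comm]

section CodingMap

variable {X ι : Type*} [MetricSpace X] [Finite ι] [TopologicalSpace ι]
  {S : ι → X → X} {r : ι → ℝ}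

theorem IsSimilitudeIFS.exists_isCodingMap [DiscreteTopology ι] [CompleteSpace X] [Nonempty X]
    (hS : IsSimilitudeIFS S r) : ∃ π : (ℕ → ι) → X, Continuous π ∧ IsCodingMap S π := by
  obtain ⟨ρ, hρ0, hρ1, hρ⟩ := hS.exists_uniform_ratio
  have hSc : Continuous fun p : ι × X => S p.1 p.2 :=
    continuous_prod_of_discrete_left.2 hS.continuous
  let T : C(ℕ → ι, X) → C(ℕ → ι, X) := fun f =>
    ⟨fun ω => S (ω 0) (f fun n => ω (n + 1)),
      hSc.comp (g := fun p : ι × X => S p.1 p.2)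
        (f := fun ω : ℕ → ι => (ω 0, f fun n => ω (n + 1)))
        ((continuous_apply 0).prodMk (f.continuous.comp
          (continuous_pi fun n => continuous_apply (n + 1))))⟩
  have hT : ContractingWith ⟨ρ, hρ0.le⟩ T := by
    refine ⟨by exact_mod_cast hρ1, LipschitzWith.of_dist_le_mul fun f g => ?_⟩
    rw [ContinuousMap.dist_le (by positivity)]
    intro ω
    change dist (S (ω 0) _) (S (ω 0) _) ≤ _
    rw [(hS.isSimilitude _).dist_map]
    exact mul_le_mul (hρ _) (ContinuousMap.dist_apply_le_dist _) dist_nonneg hρ0.le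
  have : Nonempty C(ℕ → ι, X) := ⟨ContinuousMap.const _ (Classical.arbitrary X)⟩
  obtain ⟨f, hf⟩ : ∃ f, T f = f := ⟨_, hT.fixedPoint_isFixedPt⟩
  refine ⟨f, f.continuous, fun ω => ?_⟩
  conv_lhs => rw [← hf]
  rfl

theorem IsCodingMap.mem (hS : IsSimilitudeIFS S r) {π : (ℕ → ι) → X} (hπc : Continuous π)
    (hπ : IsCodingMap S π) {K : Set X} (hK : IsClosed K) (hKn : K.Nonempty)
    (hSK : ∀ i, S i '' K ⊆ K) (ω : ℕ → ι) : π ω ∈ K := by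
  obtain ⟨y, hy⟩ := hKn
  obtain ⟨D, hD⟩ := (isCompact_range hπc).isBounded.subset_closedBall y
  refine hS.subset_of_subinvariant_of_dist_le (V := ℕ → ι) (D := D)
    (rule := fun ω => {(ω 0, fun n => ω (n + 1))}) (E := fun ω => {π ω}) (F := fun _ => K)
    (fun ω => ?_) (fun _ e _ => hSK e.1) (fun _ => hK) (fun ω x hx => ⟨y, hy, ?_⟩) ω rfl
  · simpa using hπ ω
  · rw [hx]
    exact hD (mem_range_self ω)

end CodingMap

/-! ### Moran's theorem -/

namespace IsInvariantSet

variable {X : Type} [MetricSpace X] {N : ℕ} {S : Fin N → X → X} {K : Set X}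

theorem image_subset (hK : IsInvariantSet S K) (i : Fin N) : S i '' K ⊆ K := by
  conv_rhs => rw [hK.2.2]
  exact subset_iUnion (fun i => S i '' K) i

theorem subset_iUnion_wordMap (hK : IsInvariantSet S K) (n : ℕ) :
    K ⊆ ⋃ w : Fin n → Fin N, wordMap S (List.ofFn w) '' K := by
  induction n with
  | zero => exact fun x hx => mem_iUnion.2 ⟨Fin.elim0, x, hx, by simp⟩
  | succ n ih =>
    intro x hx
    rw [hK.2.2] at hx
    obtain ⟨i, y, hy, rfl⟩ := mem_iUnion.1 hx
    obtain ⟨w, z, hz, rfl⟩ := mem_iUnion.1 (ih hy)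
    exact mem_iUnion.2 ⟨Fin.cons i w, z, hz, by simp [List.ofFn_succ]⟩

end IsInvariantSet

theorem exists_sum_rpow_eq_one {ι : Type*} [Fintype ι] [Nontrivial ι] {r : ι → ℝ}
    (hr0 : ∀ i, 0 < r i) (hr1 : ∀ i, r i < 1) : ∃ D : ℝ, 0 < D ∧ ∑ i, r i ^ D = 1 := by
  have hc : Continuous fun t : ℝ => ∑ i, r i ^ t :=
    continuous_finsetSum _ fun i _ => Real.continuous_const_rpow (hr0 i).ne'
  have hlim : Tendsto (fun t : ℝ => ∑ i, r i ^ t) atTop (𝓝 0) := by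
    simpa using tendsto_finsetSum (Finset.univ : Finset ι) fun i _ =>
      tendsto_rpow_atTop_of_base_lt_one (r i) (by linarith [hr0 i]) (hr1 i)
  obtain ⟨T, hT1, hT0⟩ :=
    ((hlim.eventually (gt_mem_nhds one_pos)).and (eventually_ge_atTop 0)).exists
  have h0 : (1 : ℝ) < ∑ i, r i ^ (0 : ℝ) := by
    simpa using (Fintype.one_lt_card : 1 < Fintype.card ι)
  obtain ⟨D, hD, hD1⟩ := intermediate_value_Icc' hT0 hc.continuousOn ⟨hT1.le, h0.le⟩
  refine ⟨D, hD.1.lt_of_ne ?_, hD1⟩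
  rintro rfl
  exact h0.ne' hD1

theorem IsSimilitudeIFS.sum_wordRatio_ofFn_rpow {X ι : Type*} [MetricSpace X] [Fintype ι]
    {S : ι → X → X} {r : ι → ℝ} (hS : IsSimilitudeIFS S r) {D : ℝ} (hD : ∑ i, r i ^ D = 1) (n : ℕ) :
    ∑ w : Fin n → ι, wordRatio r (List.ofFn w) ^ D = 1 := by
  calc ∑ w : Fin n → ι, wordRatio r (List.ofFn w) ^ D = ∑ w : Fin n → ι, ∏ k, r (w k) ^ D :=
        Finset.sum_congr rfl fun w _ => by
          rw [wordRatio_ofFn, Real.finsetProd_rpow _ _ fun k _ => (hS.ratio_pos _).le]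
    _ = 1 := by rw [← Fintype.sum_pow (fun i => r i ^ D) n, hD, one_pow]

section Upper

variable {X : Type} [MetricSpace X] [MeasurableSpace X] [BorelSpace X] {N : ℕ}
  {S : Fin N → X → X} {r : Fin N → ℝ} {K : Set X}

theorem IsInvariantSet.hausdorffMeasure_lt_top (hS : IsSimilitudeIFS S r)
    (hK : IsInvariantSet S K) {D : ℝ} (hD0 : 0 < D) (hD : ∑ i, r i ^ D = 1) : μH[D] K < ∞ := by
  obtain ⟨ρ, hρ0, hρ1, hρ⟩ := hS.exists_uniform_ratio
  obtain ⟨M, hM⟩ := Metric.isBounded_iff.1 hK.2.1.isBounded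
  have hM0 : 0 ≤ M := by
    obtain ⟨x, hx⟩ := hK.1
    simpa using hM hx hx
  have hdiam := hS.ediam_wordMap_image_le fun x hx y hy => hM hx hy
  have hmesh : Tendsto (fun n : ℕ => ENNReal.ofReal (ρ ^ n * M)) atTop (𝓝 0) := by
    rw [← ENNReal.ofReal_zero]
    refine ENNReal.tendsto_ofReal ?_
    simpa using (tendsto_pow_atTop_nhds_zero_of_lt_one hρ0.le hρ1).mul_const M
  have hcover := Measure.hausdorffMeasure_le_liminf_sum D K _ hmesh
    (fun n (w : Fin n → Fin N) => wordMap S (List.ofFn w) '' K)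
    (Eventually.of_forall fun n w => (hdiam _).trans (ENNReal.ofReal_le_ofReal (by
      gcongr
      simpa using hS.wordRatio_le_pow hρ (List.ofFn w))))
    (Eventually.of_forall fun n => hK.subset_iUnion_wordMap n)
  have hsum (n : ℕ) : ∑ w : Fin n → Fin N, Metric.ediam (wordMap S (List.ofFn w) '' K) ^ D ≤
      ENNReal.ofReal (M ^ D) := by
    have hnn (w : Fin n → Fin N) : 0 ≤ wordRatio r (List.ofFn w) := (hS.wordRatio_pos _).le
    calc ∑ w : Fin n → Fin N, Metric.ediam (wordMap S (List.ofFn w) '' K) ^ D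
        ≤ ∑ w : Fin n → Fin N, ENNReal.ofReal (wordRatio r (List.ofFn w) ^ D * M ^ D) := by
          refine Finset.sum_le_sum fun w _ => (ENNReal.rpow_le_rpow (hdiam _) hD0.le).trans_eq ?_
          rw [ENNReal.ofReal_rpow_of_nonneg (mul_nonneg (hnn w) hM0) hD0.le,
            Real.mul_rpow (hnn w) hM0]
      _ = ENNReal.ofReal (M ^ D) := by
          rw [← ENNReal.ofReal_sum_of_nonneg fun w _ =>
              mul_nonneg (Real.rpow_nonneg (hnn w) D) (Real.rpow_nonneg hM0 D),
            ← Finset.sum_mul, hS.sum_wordRatio_ofFn_rpow hD, one_mul]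
  refine hcover.trans_lt (lt_of_le_of_lt ?_ (ENNReal.ofReal_lt_top (r := M ^ D)))
  exact (liminf_le_liminf (Eventually.of_forall hsum)).trans (liminf_const _).le

end Upper

section CutWords

variable {ι : Type*} {r : ι → ℝ} {ρ : ℝ}

/-- The words at which the contraction ratio drops to `ρ` for the first time: the pieces of size
about `ρ` of a self-similar set. -/
def cutWords (r : ι → ℝ) (ρ : ℝ) : Set (List ι) :=
  {I | wordRatio r I ≤ ρ ∧ ∀ J, J <+: I → J ≠ I → ρ < wordRatio r J}

theorem eq_of_isPrefix_of_mem_cutWords {I J : List ι} (hI : I ∈ cutWords r ρ)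
    (hJ : J ∈ cutWords r ρ) (h : I <+: J) : I = J := by
  by_contra hne
  exact (hJ.2 I h hne).not_ge hI.1

theorem pairwiseDisjoint_cutWords {X : Type*} {S : ι → X → X}
    (hinj : ∀ i, Function.Injective (S i)) {U : Set X} (hU : ∀ i, S i '' U ⊆ U)
    (hdisj : ∀ i j, i ≠ j → Disjoint (S i '' U) (S j '' U)) :
    (cutWords r ρ).PairwiseDisjoint fun I => wordMap S I '' U := fun _ hI _ hJ hIJ =>
  disjoint_wordMap_image hinj hU hdisj (fun h => hIJ (eq_of_isPrefix_of_mem_cutWords hI hJ h))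
    fun h => hIJ (eq_of_isPrefix_of_mem_cutWords hJ hI h).symm

theorem mul_le_wordRatio_of_mem_cutWords (hρ0 : 0 < ρ) (hρ1 : ρ ≤ 1) {δ : ℝ} (hδ0 : 0 < δ)
    (hδ1 : δ ≤ 1) (hδ : ∀ i, δ ≤ r i) {I : List ι} (hI : I ∈ cutWords r ρ) :
    ρ * δ ≤ wordRatio r I := by
  rcases List.eq_nil_or_concat I with rfl | ⟨J, i, rfl⟩
  · simpa using mul_le_one₀ hρ1 hδ0.le hδ1
  · have hJ : ρ < wordRatio r J := hI.2 J (by simp) (by simp)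
    rw [wordRatio_concat]
    exact mul_le_mul hJ.le (hδ i) hδ0.le (hρ0.le.trans hJ.le)

theorem IsSimilitudeIFS.exists_range_map_mem_cutWords {X : Type*} [MetricSpace X] [Finite ι]
    {S : ι → X → X} (hS : IsSimilitudeIFS S r) (hρ : 0 < ρ) (ω : ℕ → ι) :
    ∃ n, (List.range n).map ω ∈ cutWords r ρ := by
  classical
  obtain ⟨c, -, hc1, hc⟩ := hS.exists_uniform_ratio
  have hex : ∃ n, wordRatio r ((List.range n).map ω) ≤ ρ := by
    obtain ⟨n, hn⟩ := exists_pow_lt_of_lt_one hρ hc1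
    exact ⟨n, (hS.wordRatio_le_pow hc _).trans (by simpa using hn.le)⟩
  refine ⟨Nat.find hex, Nat.find_spec hex, fun J hJ hne => ?_⟩
  have hlen : J.length < Nat.find hex := by
    simpa using hJ.length_le.lt_of_ne fun h => hne (hJ.eq_of_length h)
  have hJeq : J = (List.range J.length).map ω := by
    conv_lhs => rw [List.prefix_iff_eq_take.1 hJ]
    rw [← List.map_take, List.take_range, min_eq_left hlen.le]
  rw [hJeq]
  exact not_le.1 (Nat.find_min hex hlen)

end CutWords

theorem exists_finset_coe_eq_of_forall_card_le {α : Type*} {T : Set α} {q : ℝ}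
    (h : ∀ F : Finset α, ↑F ⊆ T → (F.card : ℝ) ≤ q) :
    ∃ F : Finset α, ↑F = T ∧ (F.card : ℝ) ≤ q := by
  have hT : T.Finite := by
    by_contra hinf
    obtain ⟨n, hn⟩ := exists_nat_gt q
    obtain ⟨F, hF, rfl⟩ := (show T.Infinite from hinf).exists_subset_card_eq n
    exact hn.not_ge (h F hF)
  exact ⟨hT.toFinset, hT.coe_toFinset, h _ hT.coe_toFinset.subset⟩

section Packing

variable {E : Type*} [NormedAddCommGroup E] [NormedSpace ℝ E] [FiniteDimensional ℝ E]

theorem card_mul_pow_le_of_pairwiseDisjoint_closedBall {α : Type*} {F : Finset α} {c : α → E}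
    {R : α → ℝ} {a b : ℝ} {z : E} (ha : 0 ≤ a) (hb : 0 ≤ b) (hR : ∀ i ∈ F, a ≤ R i)
    (hdisj : (F : Set α).PairwiseDisjoint fun i => Metric.closedBall (c i) (R i))
    (hsub : ∀ i ∈ F, Metric.closedBall (c i) (R i) ⊆ Metric.closedBall z b) :
    F.card * a ^ Module.finrank ℝ E ≤ b ^ Module.finrank ℝ E := by
  borelize E
  set n := Module.finrank ℝ E
  let μ : Measure E := μH[(n : ℝ)]
  have hball : μ (Metric.ball 0 1) ≠ 0 := (Metric.measure_ball_pos μ _ one_pos).ne'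
  have hvol : ∑ _ ∈ F, ENNReal.ofReal (a ^ n) * μ (Metric.ball 0 1) ≤
      ENNReal.ofReal (b ^ n) * μ (Metric.ball 0 1) :=
    calc ∑ _ ∈ F, ENNReal.ofReal (a ^ n) * μ (Metric.ball 0 1)
        ≤ ∑ i ∈ F, μ (Metric.closedBall (c i) (R i)) := by
          refine Finset.sum_le_sum fun i hi => ?_
          rw [Measure.addHaar_closedBall μ _ (ha.trans (hR i hi))]
          gcongr
          exact hR i hi
      _ = μ (⋃ i ∈ F, Metric.closedBall (c i) (R i)) :=
          (measure_biUnion_finset hdisj fun i _ => Metric.isClosed_closedBall.measurableSet).symm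
      _ ≤ μ (Metric.closedBall z b) := measure_mono (iUnion₂_subset hsub)
      _ = ENNReal.ofReal (b ^ n) * μ (Metric.ball 0 1) := Measure.addHaar_closedBall μ z hb
  rwa [Finset.sum_const, nsmul_eq_mul, ← mul_assoc,
    ENNReal.mul_le_mul_iff_left hball measure_ball_lt_top.ne, ← ENNReal.ofReal_natCast,
    ← ENNReal.ofReal_mul (Nat.cast_nonneg _), ENNReal.ofReal_le_ofReal_iff (by positivity)] at hvol

end Packing

theorem IsSimilitudeIFS.closedBall_wordMap_subset_closedBall {X ι : Type*} [MetricSpace X]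
    {S : ι → X → X} {r : ι → ℝ} (hS : IsSimilitudeIFS S r) {I : List ι}
    {ρ a R : ℝ} (hI : wordRatio r I ≤ ρ) (ha : 0 ≤ a) {K B : Set X} {x₀ z : X}
    (hK : K ⊆ Metric.closedBall x₀ R) (hB : ∀ x ∈ B, ∀ y ∈ B, dist x y ≤ ρ)
    (hKB : (wordMap S I '' K ∩ B).Nonempty) (hz : z ∈ B) :
    Metric.closedBall (wordMap S I x₀) (wordRatio r I * a) ⊆
      Metric.closedBall z (ρ * (1 + R + a)) := by
  obtain ⟨_, ⟨k, hk, rfl⟩, hkB⟩ := hKB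
  have hx₀k : dist x₀ k ≤ R := Metric.mem_closedBall'.1 (hK hk)
  refine Metric.closedBall_subset_closedBall' ?_
  calc wordRatio r I * a + dist (wordMap S I x₀) z
      ≤ wordRatio r I * a + (dist (wordMap S I x₀) (wordMap S I k) + dist (wordMap S I k) z) := by
        gcongr; exact dist_triangle _ _ _
    _ ≤ ρ * a + (ρ * R + ρ) := by
        rw [(hS.isSimilitude_wordMap I).dist_map]
        exact add_le_add (mul_le_mul_of_nonneg_right hI ha) (add_le_add
          (mul_le_mul hI hx₀k dist_nonneg ((hS.wordRatio_pos I).le.trans hI)) (hB _ hkB _ hz))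
    _ = ρ * (1 + R + a) := by ring

section Lower

variable {E : Type} [NormedAddCommGroup E] [NormedSpace ℝ E] [FiniteDimensional ℝ E] {N : ℕ}
  {S : Fin N → E → E} {r : Fin N → ℝ}

/-- The pieces of size `ρ` carry disjoint balls of radius comparable to `ρ`, so only boundedly many
of them meet a set of diameter at most `ρ`. -/
theorem IsSimilitudeIFS.exists_card_cutWords_le (hS : IsSimilitudeIFS S r)
    (hOSC : IFSOpenSetCondition S) {K : Set E} (hK : Bornology.IsBounded K) :
    ∃ q : ℝ, 0 < q ∧ ∀ ρ : ℝ, 0 < ρ → ρ ≤ 1 → ∀ B : Set E, (∀ x ∈ B, ∀ y ∈ B, dist x y ≤ ρ) →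
      ∀ F : Finset (List (Fin N)),
      ↑F ⊆ {I | I ∈ cutWords r ρ ∧ (wordMap S I '' K ∩ B).Nonempty} → (F.card : ℝ) ≤ q := by
  obtain ⟨U, hUo, ⟨x₀, hx₀⟩, hUsub, hUdisj⟩ := hOSC
  obtain ⟨a, ha0, haU⟩ := Metric.nhds_basis_closedBall.mem_iff.1 (hUo.mem_nhds hx₀)
  obtain ⟨δ', hδ'0, hδ'⟩ := exists_pos_forall_le_of_finite hS.ratio_pos
  set δ := min δ' 1
  have hδ0 : 0 < δ := lt_min hδ'0 one_pos
  obtain ⟨R, hR0, hR⟩ := hK.subset_closedBall_lt 0 x₀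
  set L := 1 + R + a
  set n := Module.finrank ℝ E
  refine ⟨(L / (δ * a)) ^ n, by positivity, fun ρ hρ0 hρ1 B hB F hF => ?_⟩
  rcases F.eq_empty_or_nonempty with rfl | ⟨I₀, hI₀⟩
  · simp only [Finset.card_empty, Nat.cast_zero]
    positivity
  obtain ⟨-, z, -, hz⟩ := hF hI₀
  have hdisj : (F : Set (List (Fin N))).PairwiseDisjoint
      fun I => Metric.closedBall (wordMap S I x₀) (wordRatio r I * a) := by
    simp only [← (hS.isSimilitude_wordMap _).image_closedBall]
    exact ((pairwiseDisjoint_cutWords hS.injective hUsub hUdisj).subset fun I hI => (hF hI).1).mono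
      fun I => image_mono haU
  have hpack : F.card * (ρ * (δ * a)) ^ n ≤ (ρ * L) ^ n :=
    card_mul_pow_le_of_pairwiseDisjoint_closedBall (by positivity) (by positivity)
      (fun I hI => by
        rw [← mul_assoc]
        gcongr
        exact mul_le_wordRatio_of_mem_cutWords hρ0 hρ1 hδ0 (min_le_right _ _)
          (fun i => (min_le_left _ _).trans (hδ' i)) (hF hI).1) hdisj
      fun I hI => hS.closedBall_wordMap_subset_closedBall (hF hI).1.1 ha0.le hR hB (hF hI).2 hz
  rw [div_pow, le_div_iff₀ (by positivity)]
  refine le_of_mul_le_mul_left ?_ (pow_pos hρ0 n)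
  calc ρ ^ n * (F.card * (δ * a) ^ n) = F.card * (ρ * (δ * a)) ^ n := by ring
    _ ≤ ρ ^ n * L ^ n := by rwa [← mul_pow]

end Lower

theorem setOf_range_map_eq_pi {ι : Type*} (I : List ι) :
    {ω : ℕ → ι | (List.range I.length).map ω = I} =
      (↑(Finset.range I.length) : Set ℕ).pi fun k => {i | I[k]? = some i} := by
  ext ω
  rw [mem_ofPred_eq, List.ext_getElem?_iff, Set.mem_pi]
  refine forall_congr' fun k => ?_
  by_cases hk : k < I.length
  · simp [hk, eq_comm]
  · simp [hk]

theorem IsSimilitudeIFS.prod_measure_setOf_getElem? {X ι : Type*} [MetricSpace X]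
    [MeasurableSpace ι] {S : ι → X → X} {r : ι → ℝ} (hS : IsSimilitudeIFS S r) {D : ℝ}
    {p : Measure ι} (hp : ∀ i, p {i} = ENNReal.ofReal (r i ^ D)) (I : List ι) :
    ∏ k ∈ Finset.range I.length, p {i | I[k]? = some i} = ENNReal.ofReal (wordRatio r I ^ D) := by
  induction I with
  | nil => simp
  | cons i I ih =>
    have h0 : {j | (i :: I)[0]? = some j} = {i} := by ext j; simp [eq_comm]
    simp only [List.length_cons, Finset.prod_range_succ', List.getElem?_cons_succ]
    rw [ih, h0, hp, wordRatio_cons, Real.mul_rpow (hS.ratio_pos i).le (hS.wordRatio_pos I).le,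
      ENNReal.ofReal_mul (Real.rpow_nonneg (hS.ratio_pos i).le D), mul_comm]

theorem IsSimilitudeIFS.exists_bernoulliMeasure {X ι : Type*} [MetricSpace X] [Fintype ι]
    [MeasurableSpace ι] [DiscreteMeasurableSpace ι] {S : ι → X → X} {r : ι → ℝ}
    (hS : IsSimilitudeIFS S r) {D : ℝ} (hD : ∑ i, r i ^ D = 1) :
    ∃ μ : Measure (ℕ → ι), IsProbabilityMeasure μ ∧ ∀ I : List ι,
      μ {ω | (List.range I.length).map ω = I} = ENNReal.ofReal (wordRatio r I ^ D) := by
  let p : PMF ι := PMF.ofFintype (fun i => ENNReal.ofReal (r i ^ D)) (by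
    rw [← ENNReal.ofReal_sum_of_nonneg fun i _ => Real.rpow_nonneg (hS.ratio_pos i).le D, hD,
      ENNReal.ofReal_one])
  have hp (i : ι) : p.toMeasure {i} = ENNReal.ofReal (r i ^ D) :=
    PMF.toMeasure_apply_singleton _ _ (measurableSet_singleton i)
  refine ⟨Measure.infinitePi fun _ => p.toMeasure, inferInstance, fun I => ?_⟩
  rw [setOf_range_map_eq_pi, Measure.infinitePi_pi _ fun _ _ => MeasurableSet.of_discrete,
    hS.prod_measure_setOf_getElem? hp]

theorem inv_smul_le_hausdorffMeasure {X : Type*} [MetricSpace X] [MeasurableSpace X] [BorelSpace X]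
    {ν : Measure X} {D q : ℝ} (hD : 0 < D) (hq : 0 < q)
    (hν : ∀ ρ : ℝ, 0 < ρ → ρ ≤ 1 → ∀ B : Set X, Metric.ediam B ≤ ENNReal.ofReal ρ →
      ν B ≤ ENNReal.ofReal (q * ρ ^ D)) :
    (ENNReal.ofReal q)⁻¹ • ν ≤ μH[D] := by
  refine Measure.le_hausdorffMeasure D _ 1 one_pos fun B hB => ?_
  rw [Measure.smul_apply, smul_eq_mul,
    ENNReal.inv_mul_le_iff (ENNReal.ofReal_pos.2 hq).ne' ENNReal.ofReal_ne_top]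
  have htop : Metric.ediam B ≠ ∞ := (hB.trans_lt ENNReal.one_lt_top).ne
  rcases eq_or_ne (Metric.ediam B) 0 with h0 | h0
  · have hpow : Tendsto (fun ρ : ℝ => q * ρ ^ D) (𝓝[>] 0) (𝓝 0) := by
      have := ((Real.continuousAt_rpow_const 0 D (Or.inr hD.le)).tendsto.const_mul q).mono_left
        (nhdsWithin_le_nhds (s := Ioi (0 : ℝ)))
      rwa [Real.zero_rpow hD.ne', mul_zero] at this
    have hlim : Tendsto (fun ρ : ℝ => ENNReal.ofReal (q * ρ ^ D)) (𝓝[>] 0) (𝓝 0) := by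
      simpa using ENNReal.tendsto_ofReal hpow
    have hB0 : ν B ≤ 0 := ge_of_tendsto hlim <| by
      filter_upwards [Ioc_mem_nhdsGT one_pos] with ρ hρ
      exact hν ρ hρ.1 hρ.2 B (by simp [h0])
    exact hB0.trans zero_le
  · have hpos : 0 < (Metric.ediam B).toReal := ENNReal.toReal_pos h0 htop
    have h1 : (Metric.ediam B).toReal ≤ 1 := by
      simpa using ENNReal.toReal_mono ENNReal.one_ne_top hB
    have := hν _ hpos h1 B (by rw [ENNReal.ofReal_toReal htop])
    rwa [ENNReal.ofReal_mul hq.le, ← ENNReal.ofReal_rpow_of_pos hpos,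
      ENNReal.ofReal_toReal htop] at this

section Moran

variable {E : Type} [NormedAddCommGroup E] [NormedSpace ℝ E] [FiniteDimensional ℝ E]
  [MeasurableSpace E] [BorelSpace E] {N : ℕ} {S : Fin N → E → E} {r : Fin N → ℝ} {K : Set E}

theorem IsSimilitudeIFS.exists_map_le_of_isCodingMap (hS : IsSimilitudeIFS S r)
    (hOSC : IFSOpenSetCondition S) (hK : Bornology.IsBounded K) {π : (ℕ → Fin N) → E}
    (hπc : Continuous π) (hπ : IsCodingMap S π) (hπK : ∀ ω, π ω ∈ K) {D : ℝ} (hD : 0 < D)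
    {P : Measure (ℕ → Fin N)}
    (hP : ∀ I, P {ω | (List.range I.length).map ω = I} = ENNReal.ofReal (wordRatio r I ^ D)) :
    ∃ q : ℝ, 0 < q ∧ ∀ ρ : ℝ, 0 < ρ → ρ ≤ 1 → ∀ B : Set E, Metric.ediam B ≤ ENNReal.ofReal ρ →
      P.map π B ≤ ENNReal.ofReal (q * ρ ^ D) := by
  obtain ⟨q, hq0, hq⟩ := hS.exists_card_cutWords_le hOSC hK
  refine ⟨q, hq0, fun ρ hρ0 hρ1 B hB => ?_⟩
  have hdist : ∀ x ∈ closure B, ∀ y ∈ closure B, dist x y ≤ ρ := by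
    intro x hx y hy
    rw [← Metric.ediam_closure] at hB
    rw [← ENNReal.ofReal_le_ofReal_iff hρ0.le, ← edist_dist]
    exact (Metric.edist_le_ediam_of_mem hx hy).trans hB
  obtain ⟨F, hF, hFq⟩ := exists_finset_coe_eq_of_forall_card_le (hq ρ hρ0 hρ1 _ hdist)
  have hcover : π ⁻¹' closure B ⊆ ⋃ I ∈ F, {ω | (List.range I.length).map ω = I} := by
    intro ω hω
    obtain ⟨n, hn⟩ := hS.exists_range_map_mem_cutWords hρ0 ω
    have hmem : (List.range n).map ω ∈ (F : Set (List (Fin N))) := by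
      rw [hF]
      exact ⟨hn, π ω, ⟨_, hπK _, (hπ.eq_wordMap n ω).symm⟩, hω⟩
    exact mem_biUnion hmem (by simp)
  calc P.map π B ≤ P.map π (closure B) := measure_mono subset_closure
    _ = P (π ⁻¹' closure B) := Measure.map_apply hπc.measurable isClosed_closure.measurableSet
    _ ≤ ∑ I ∈ F, P {ω | (List.range I.length).map ω = I} :=
        (measure_mono hcover).trans (measure_biUnion_finset_le _ _)
    _ ≤ ∑ _I ∈ F, ENNReal.ofReal (ρ ^ D) := by
        refine Finset.sum_le_sum fun I hI => (hP I).trans_le (ENNReal.ofReal_le_ofReal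
          (Real.rpow_le_rpow (hS.wordRatio_pos I).le ?_ hD.le))
        exact (hF.subset hI).1.1
    _ = ENNReal.ofReal (F.card * ρ ^ D) := by
        rw [Finset.sum_const, nsmul_eq_mul, ← ENNReal.ofReal_natCast,
          ← ENNReal.ofReal_mul (Nat.cast_nonneg _)]
    _ ≤ ENNReal.ofReal (q * ρ ^ D) :=
        ENNReal.ofReal_le_ofReal (mul_le_mul_of_nonneg_right hFq (Real.rpow_nonneg hρ0.le D))

theorem IsInvariantSet.hausdorffMeasure_pos (hS : IsSimilitudeIFS S r)
    (hOSC : IFSOpenSetCondition S) (hK : IsInvariantSet S K) {D : ℝ} (hD0 : 0 < D)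
    (hD : ∑ i, r i ^ D = 1) : 0 < μH[D] K := by
  have := FiniteDimensional.complete ℝ E
  obtain ⟨π, hπc, hπ⟩ := hS.exists_isCodingMap
  have hπK := IsCodingMap.mem hS hπc hπ hK.2.1.isClosed hK.1 hK.image_subset
  obtain ⟨P, hP, hPcyl⟩ := hS.exists_bernoulliMeasure hD
  obtain ⟨q, hq0, hq⟩ :=
    hS.exists_map_le_of_isCodingMap hOSC hK.2.1.isBounded hπc hπ hπK hD0 hPcyl
  have hPK : P.map π K = 1 := by
    rw [Measure.map_apply hπc.measurable hK.2.1.measurableSet,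
      show π ⁻¹' K = univ from eq_univ_of_forall hπK, measure_univ]
  calc (0 : ℝ≥0∞) < (ENNReal.ofReal q)⁻¹ := ENNReal.inv_pos.2 ENNReal.ofReal_ne_top
    _ = ((ENNReal.ofReal q)⁻¹ • P.map π) K := by
        rw [Measure.smul_apply, hPK, smul_eq_mul, mul_one]
    _ ≤ μH[D] K := inv_smul_le_hausdorffMeasure hD0 hq0 hq K

theorem IsInvariantSet.moran (hN : 2 ≤ N) (hS : IsSimilitudeIFS S r) (hOSC : IFSOpenSetCondition S)
    (hK : IsInvariantSet S K) {s : ℝ≥0} (hs : dimH K = (s : ℝ≥0∞)) :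
    0 < s ∧ ∑ i, r i ^ (s : ℝ) = 1 ∧ 0 < μH[(s : ℝ)] K ∧ μH[(s : ℝ)] K < ∞ := by
  have := Fin.nontrivial_iff_two_le.2 hN
  obtain ⟨D, hD0, hD⟩ := exists_sum_rpow_eq_one hS.ratio_pos hS.ratio_lt_one
  have hpos := hK.hausdorffMeasure_pos hS hOSC hD0 hD
  have hfin := hK.hausdorffMeasure_lt_top hS hD0 hD
  lift D to ℝ≥0 using hD0.le
  have hdim := dimH_of_hausdorffMeasure_ne_zero_ne_top hpos.ne' hfin.ne
  rw [hs, ENNReal.coe_inj] at hdim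
  subst hdim
  exact ⟨hD0, hD, hpos, hfin⟩

end Moran

/-! ### Curves of controlled measure -/

section MeasureImage

variable {X : Type*} [MeasurableSpace X] {ν : Measure X} {ψ : ℝ → X}

theorem measure_image_eq_mul_volume_of_le (hfin : ν (ψ '' Icc 0 1) ≠ ∞)
    (hle : ∀ F ⊆ Icc 0 1, ν (ψ '' F) ≤ ν (ψ '' Icc 0 1) * volume F) {F : Set ℝ}
    (hF : F ⊆ Icc 0 1) (hFm : MeasurableSet F) :
    ν (ψ '' F) = ν (ψ '' Icc 0 1) * volume F := by
  set c := ν (ψ '' Icc 0 1)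
  have hvol : volume F + volume (Icc (0 : ℝ) 1 \ F) = 1 := by
    rw [measure_add_sdiff hFm.nullMeasurableSet, union_eq_self_of_subset_left hF, Real.volume_Icc,
      sub_zero, ENNReal.ofReal_one]
  have hrest : volume (Icc (0 : ℝ) 1 \ F) ≠ ∞ := ((measure_mono sdiff_subset).trans_lt (by simp)).ne
  refine le_antisymm (hle F hF) (ENNReal.le_of_add_le_add_right (ENNReal.mul_ne_top hfin hrest) ?_)
  calc c * volume F + c * volume (Icc (0 : ℝ) 1 \ F) = c := by rw [← mul_add, hvol, mul_one]
    _ = ν (ψ '' F ∪ ψ '' (Icc 0 1 \ F)) := by rw [← image_union, union_sdiff_cancel hF]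
    _ ≤ ν (ψ '' F) + c * volume (Icc (0 : ℝ) 1 \ F) :=
        (measure_union_le _ _).trans (add_le_add_right (hle _ sdiff_subset) _)

variable [TopologicalSpace X] [BorelSpace X]

theorem volume_inter_preimage_eq (hψ : ContinuousOn ψ (Icc 0 1))
    (hpos : ν (ψ '' Icc 0 1) ≠ 0) (hfin : ν (ψ '' Icc 0 1) ≠ ∞)
    (hle : ∀ F ⊆ Icc 0 1, ν (ψ '' F) ≤ ν (ψ '' Icc 0 1) * volume F) {B : Set X}
    (hB : B ⊆ ψ '' Icc 0 1) (hBm : MeasurableSet B) :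
    volume (Icc 0 1 ∩ ψ ⁻¹' B) = (ν (ψ '' Icc 0 1))⁻¹ * ν B := by
  have hm : MeasurableSet (Icc 0 1 ∩ ψ ⁻¹' B) := by
    rw [← Subtype.image_preimage_coe]
    exact measurableSet_Icc.subtype_image (hψ.domRestrict.measurable hBm)
  have himage : ψ '' (Icc 0 1 ∩ ψ ⁻¹' B) = B := by
    rw [image_inter_preimage, inter_eq_self_of_subset_right hB]
  rw [← congrArg ν himage, measure_image_eq_mul_volume_of_le hfin hle inter_subset_left hm,
    ← mul_assoc, ENNReal.inv_mul_cancel hpos hfin, one_mul]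

variable [T2Space X]

theorem measure_image_inter_image_eq_zero (hψ : ContinuousOn ψ (Icc 0 1))
    (hfin : ν (ψ '' Icc 0 1) ≠ ∞)
    (hle : ∀ F ⊆ Icc 0 1, ν (ψ '' F) ≤ ν (ψ '' Icc 0 1) * volume F) {t : ℝ} (ht : t ∈ Icc 0 1) :
    ν (ψ '' Icc 0 t ∩ ψ '' Icc t 1) = 0 := by
  have h0 : Icc 0 t ⊆ Icc 0 1 := Icc_subset_Icc_right ht.2
  have h1 : Icc t 1 ⊆ Icc 0 1 := Icc_subset_Icc_left ht.1
  have hunion : ψ '' Icc 0 t ∪ ψ '' Icc t 1 = ψ '' Icc 0 1 := by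
    rw [← image_union, Icc_union_Icc_eq_Icc ht.1 ht.2]
  have hadd := measure_union_add_inter (μ := ν) (ψ '' Icc 0 t)
    (isCompact_Icc.image_of_continuousOn (hψ.mono h1)).measurableSet
  rw [hunion, measure_image_eq_mul_volume_of_le hfin hle h0 measurableSet_Icc,
    measure_image_eq_mul_volume_of_le hfin hle h1 measurableSet_Icc, ← mul_add, Real.volume_Icc,
    Real.volume_Icc, ← ENNReal.ofReal_add (by linarith [ht.1]) (by linarith [ht.2])] at hadd
  rw [sub_zero, add_sub_cancel, ENNReal.ofReal_one, mul_one] at hadd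
  exact (ENNReal.add_right_inj hfin).1 (hadd.trans (add_zero _).symm)

theorem measure_setOf_multiplePoint_eq_zero (hψ : ContinuousOn ψ (Icc 0 1))
    (hfin : ν (ψ '' Icc 0 1) ≠ ∞)
    (hle : ∀ F ⊆ Icc 0 1, ν (ψ '' F) ≤ ν (ψ '' Icc 0 1) * volume F) :
    ν {p | ∃ x ∈ Icc (0 : ℝ) 1, ∃ y ∈ Icc (0 : ℝ) 1, x < y ∧ ψ x = p ∧ ψ y = p} = 0 := by
  refine measure_mono_null (t := ⋃ q : {q : ℚ // (q : ℝ) ∈ Icc (0 : ℝ) 1},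
    ψ '' Icc 0 (q : ℝ) ∩ ψ '' Icc (q : ℝ) 1) ?_
    (measure_iUnion_null fun q => measure_image_inter_image_eq_zero hψ hfin hle q.2)
  rintro p ⟨x, hx, y, hy, hxy, rfl, hyx⟩
  obtain ⟨q, hxq, hqy⟩ := exists_rat_btwn hxy
  exact mem_iUnion.2 ⟨⟨q, hx.1.trans hxq.le, hqy.le.trans hy.2⟩,
    ⟨x, ⟨hx.1, hxq.le⟩, rfl⟩, y, ⟨hqy.le, hy.2⟩, hyx⟩

theorem exists_bijOn_of_measure_image_le (hψ : ContinuousOn ψ (Icc 0 1))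
    (hpos : ν (ψ '' Icc 0 1) ≠ 0) (hfin : ν (ψ '' Icc 0 1) ≠ ∞)
    (hle : ∀ F ⊆ Icc 0 1, ν (ψ '' F) ≤ ν (ψ '' Icc 0 1) * volume F) :
    ∃ I' ⊆ Icc (0 : ℝ) 1, ∃ K' ⊆ ψ '' Icc 0 1,
      volume (Icc (0 : ℝ) 1 \ I') = 0 ∧ ν (ψ '' Icc 0 1 \ K') = 0 ∧ BijOn ψ I' K' := by
  set K := ψ '' Icc 0 1
  set M := {p | ∃ x ∈ Icc (0 : ℝ) 1, ∃ y ∈ Icc (0 : ℝ) 1, x < y ∧ ψ x = p ∧ ψ y = p}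
  have hM0 : ν M = 0 := measure_setOf_multiplePoint_eq_zero hψ hfin hle
  have hMK : M ⊆ K := by
    rintro _ ⟨x, hx, -, -, -, rfl, -⟩
    exact mem_image_of_mem ψ hx
  -- a measurable hull of the multiple points inside `K`, so that its preimage is measurable
  set Z := toMeasurable ν M ∩ K
  have hMZ : M ⊆ Z := subset_inter (subset_toMeasurable ν M) hMK
  have hZm : MeasurableSet Z := (measurableSet_toMeasurable ν M).inter
    (isCompact_Icc.image_of_continuousOn hψ).measurableSet
  have hZ0 : ν Z = 0 := measure_mono_null inter_subset_left ((measure_toMeasurable M).trans hM0)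
  refine ⟨Icc 0 1 \ ψ ⁻¹' Z, sdiff_subset, K \ Z, sdiff_subset, ?_, ?_, ?_, ?_, ?_⟩
  · rw [sdiff_sdiff_right_self,
      volume_inter_preimage_eq hψ hpos hfin hle inter_subset_right hZm, hZ0, mul_zero]
  · exact measure_mono_null (by simp) hZ0
  · exact fun x hx => ⟨mem_image_of_mem ψ hx.1, hx.2⟩
  · intro x hx y hy hxy
    by_contra hne
    rcases lt_or_gt_of_ne hne with h | h
    · exact hx.2 (hMZ ⟨x, hx.1, y, hy.1, h, rfl, hxy.symm⟩)
    · exact hx.2 (hMZ ⟨y, hy.1, x, hx.1, h, hxy.symm, rfl⟩)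
  · rintro _ ⟨⟨x, hx, rfl⟩, hxZ⟩
    exact ⟨x, ⟨hx, hxZ⟩, rfl⟩

end MeasureImage

theorem isOptimalParameterization_of_measure_image_le {X : Type} [MetricSpace X]
    [MeasurableSpace X] [BorelSpace X] {s C : ℝ≥0} {ψ : ℝ → X} (hs : 0 < s)
    (hψ : HolderOnWith C (1 / s) ψ (Icc 0 1))
    (hpos : 0 < μH[(s : ℝ)] (ψ '' Icc 0 1)) (hfin : μH[(s : ℝ)] (ψ '' Icc 0 1) < ∞)
    (hle : ∀ F ⊆ Icc 0 1, μH[(s : ℝ)] (ψ '' F) ≤ μH[(s : ℝ)] (ψ '' Icc 0 1) * volume F) :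
    IsOptimalParameterization s (ψ '' Icc 0 1) ψ := by
  have hψc : ContinuousOn ψ (Icc 0 1) := hψ.continuousOn (one_div_pos.2 hs)
  exact ⟨hs, hpos, hfin, rfl, exists_bijOn_of_measure_image_le hψc hpos.ne' hfin.ne hle,
    fun F => measure_image_eq_mul_volume_of_le hfin.ne hle,
    fun B => volume_inter_preimage_eq hψc hpos.ne' hfin.ne hle, C, hψ⟩

/-! ### Ordered subdivisions -/

/-- A system of intervals `[0, len w]`, one for each state `w`, each cut from left to right into
`cnt w` copies of intervals of the system, together with a similitude of `X` for each copy. The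
`k`-th copy in `[0, len w]` has state `nxt w k` and is scaled by `ratio (lab w k) ^ s`. The values
of `lab` and `nxt` at indices `k ≥ cnt w` are irrelevant. The points
`src w` and `tgt w` are the end points of the curve in `X` parameterized by `[0, len w]`. -/
structure OrderedSubdivision (X ι W : Type*) [MetricSpace X] where
  map : ι → X → X
  ratio : ι → ℝ
  isSimilitudeIFS : IsSimilitudeIFS map ratio
  s : ℝ≥0
  s_pos : 0 < s
  cnt : W → ℕ
  lab : W → ℕ → ι
  nxt : W → ℕ → W
  len : W → ℝ
  len_pos : ∀ w, 0 < len w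
  len_eq : ∀ w, len w = ∑ k ∈ Finset.range (cnt w), ratio (lab w k) ^ (s : ℝ) * len (nxt w k)
  src : W → X
  tgt : W → X
  src_eq : ∀ w, src w = map (lab w 0) (src (nxt w 0))
  tgt_eq : ∀ w, tgt w = map (lab w (cnt w - 1)) (tgt (nxt w (cnt w - 1)))
  link : ∀ w k, k + 1 < cnt w →
    map (lab w k) (tgt (nxt w k)) = map (lab w (k + 1)) (src (nxt w (k + 1)))

namespace OrderedSubdivision

variable {X ι W : Type*} [MetricSpace X] (G : OrderedSubdivision X ι W)

/-- The factor by which the `k`-th child interval is scaled. -/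
noncomputable def scale (w : W) (k : ℕ) : ℝ := G.ratio (G.lab w k) ^ (G.s : ℝ)

/-- The left end point of the `k`-th child interval. -/
noncomputable def breakpoint (w : W) (k : ℕ) : ℝ :=
  ∑ i ∈ Finset.range k, G.scale w i * G.len (G.nxt w i)

/-- The affine map from the interval of the state `nxt w k` onto the `k`-th child interval. -/
noncomputable def childMap (w : W) (k : ℕ) (x : ℝ) : ℝ := G.breakpoint w k + G.scale w k * x

/-- The index of the child interval containing `t`; a common end point of two child intervals
belongs to the right one. -/
noncomputable def digit (w : W) (t : ℝ) : ℕ :=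
  open Classical in Nat.findGreatest (fun k => G.breakpoint w k ≤ t) (G.cnt w - 1)

/-- The coordinate of `t` in its child interval. -/
noncomputable def rescale (w : W) (t : ℝ) : ℝ :=
  (t - G.breakpoint w (G.digit w t)) / G.scale w (G.digit w t)

theorem scale_pos (w : W) (k : ℕ) : 0 < G.scale w k :=
  Real.rpow_pos_of_pos (G.isSimilitudeIFS.ratio_pos _) _

theorem exists_scale_le [Finite ι] : ∃ σ : ℝ, 0 < σ ∧ σ < 1 ∧ ∀ w k, G.scale w k ≤ σ := by
  obtain ⟨ρ, hρ0, hρ1, hρ⟩ := G.isSimilitudeIFS.exists_uniform_ratio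
  have hs : (0 : ℝ) < G.s := NNReal.coe_pos.2 G.s_pos
  exact ⟨ρ ^ (G.s : ℝ), Real.rpow_pos_of_pos hρ0 _, Real.rpow_lt_one hρ0.le hρ1 hs, fun w k =>
    Real.rpow_le_rpow (G.isSimilitudeIFS.ratio_pos _).le (hρ _) hs.le⟩

theorem breakpoint_zero (w : W) : G.breakpoint w 0 = 0 := by simp [breakpoint]

theorem breakpoint_succ (w : W) (k : ℕ) :
    G.breakpoint w (k + 1) = G.breakpoint w k + G.scale w k * G.len (G.nxt w k) := by
  simp [breakpoint, Finset.sum_range_succ]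

theorem breakpoint_cnt (w : W) : G.breakpoint w (G.cnt w) = G.len w := (G.len_eq w).symm

theorem breakpoint_strictMono (w : W) : StrictMono (G.breakpoint w) :=
  strictMono_nat_of_lt_succ fun k => by
    rw [breakpoint_succ]
    exact lt_add_of_pos_right _ (mul_pos (G.scale_pos w k) (G.len_pos _))

theorem breakpoint_nonneg (w : W) (k : ℕ) : 0 ≤ G.breakpoint w k :=
  (G.breakpoint_zero w).ge.trans ((G.breakpoint_strictMono w).monotone k.zero_le)

theorem breakpoint_le_len {w : W} {k : ℕ} (hk : k ≤ G.cnt w) : G.breakpoint w k ≤ G.len w :=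
  ((G.breakpoint_strictMono w).monotone hk).trans (G.breakpoint_cnt w).le

theorem cnt_pos (w : W) : 0 < G.cnt w := by
  rw [Nat.pos_iff_ne_zero]
  intro h
  have := G.len_pos w
  rw [← breakpoint_cnt, h, breakpoint_zero] at this
  exact this.false

theorem childMap_zero (w : W) (k : ℕ) : G.childMap w k 0 = G.breakpoint w k := by simp [childMap]

theorem childMap_len (w : W) (k : ℕ) :
    G.childMap w k (G.len (G.nxt w k)) = G.breakpoint w (k + 1) := (G.breakpoint_succ w k).symm

theorem childMap_last (w : W) :
    G.childMap w (G.cnt w - 1) (G.len (G.nxt w (G.cnt w - 1))) = G.len w := by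
  rw [childMap_len, Nat.sub_add_cancel (G.cnt_pos w), breakpoint_cnt]

theorem childMap_sub_childMap (w : W) (k : ℕ) (x y : ℝ) :
    G.childMap w k y - G.childMap w k x = G.scale w k * (y - x) := by
  rw [childMap, childMap]
  ring

theorem childMap_strictMono (w : W) (k : ℕ) : StrictMono (G.childMap w k) := fun x y h => by
  have := mul_pos (G.scale_pos w k) (sub_pos.2 h)
  rwa [← childMap_sub_childMap, sub_pos] at this

theorem childMap_mem_Icc {w : W} {k : ℕ} (hk : k < G.cnt w) {x : ℝ}
    (hx : x ∈ Icc 0 (G.len (G.nxt w k))) : G.childMap w k x ∈ Icc 0 (G.len w) := by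
  have hmono := (G.childMap_strictMono w k).monotone
  exact ⟨(G.breakpoint_nonneg w k).trans ((G.childMap_zero w k).ge.trans (hmono hx.1)),
    (hmono hx.2).trans ((G.childMap_len w k).le.trans (G.breakpoint_le_len hk))⟩

theorem digit_lt (w : W) (t : ℝ) : G.digit w t < G.cnt w :=
  lt_of_le_of_lt (Nat.findGreatest_le _) (Nat.sub_lt (G.cnt_pos w) one_pos)

theorem breakpoint_digit_le (w : W) {t : ℝ} (ht : 0 ≤ t) : G.breakpoint w (G.digit w t) ≤ t := by
  classical
  exact Nat.findGreatest_spec (P := fun k => G.breakpoint w k ≤ t) (Nat.zero_le (G.cnt w - 1))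
    ((G.breakpoint_zero w).trans_le ht)

theorem le_breakpoint_digit_succ (w : W) {t : ℝ} (ht : t ≤ G.len w) :
    t ≤ G.breakpoint w (G.digit w t + 1) := by
  classical
  by_contra! h
  rcases (Nat.succ_le_of_lt (G.digit_lt w t)).lt_or_eq with h1 | h1
  · exact Nat.findGreatest_is_greatest (P := fun k => G.breakpoint w k ≤ t)
      (Nat.lt_succ_self (G.digit w t)) (Nat.le_sub_one_of_lt h1) h.le
  · rw [Nat.succ_eq_add_one] at h1
    rw [h1, breakpoint_cnt] at h
    exact absurd ht (not_le.2 h)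

theorem digit_mono (w : W) {x y : ℝ} (h : x ≤ y) : G.digit w x ≤ G.digit w y := by
  classical
  exact Nat.findGreatest_mono_left (fun k hk => le_trans hk h) _

theorem digit_childMap {w : W} {k : ℕ} (hk : k < G.cnt w) {x : ℝ} (h0 : 0 ≤ x)
    (h1 : x < G.len (G.nxt w k)) : G.digit w (G.childMap w k x) = k := by
  classical
  refine Nat.findGreatest_eq_iff.2 ⟨Nat.le_sub_one_of_lt hk, fun _ => ?_, fun n hn _ => ?_⟩
  · exact (G.childMap_zero w k).ge.trans ((G.childMap_strictMono w k).monotone h0)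
  · refine not_le.2 (((G.childMap_strictMono w k) h1).trans_le ?_)
    rw [childMap_len]
    exact (G.breakpoint_strictMono w).monotone hn

theorem digit_len (w : W) : G.digit w (G.len w) = G.cnt w - 1 := by
  classical
  exact Nat.findGreatest_eq_iff.2 ⟨le_rfl, fun _ => G.breakpoint_le_len (Nat.sub_le _ _),
    fun n hn h => absurd h (not_le.2 hn)⟩

theorem childMap_rescale (w : W) (t : ℝ) :
    G.childMap w (G.digit w t) (G.rescale w t) = t := by
  rw [childMap, rescale, mul_div_cancel₀ _ (G.scale_pos w _).ne', add_sub_cancel]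

theorem rescale_mem (w : W) {t : ℝ} (ht : t ∈ Icc 0 (G.len w)) :
    G.rescale w t ∈ Icc 0 (G.len (G.nxt w (G.digit w t))) := by
  have hmono := G.childMap_strictMono w (G.digit w t)
  rw [mem_Icc, ← hmono.le_iff_le, ← hmono.le_iff_le (b := G.len _), childMap_rescale,
    childMap_zero, childMap_len]
  exact ⟨G.breakpoint_digit_le w ht.1, G.le_breakpoint_digit_succ w ht.2⟩

theorem exists_len_le [Finite W] : ∃ M : ℝ, ∀ w, G.len w ≤ M := by
  obtain ⟨M, hM⟩ := (Set.finite_range G.len).bddAbove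
  exact ⟨M, fun w => hM (mem_range_self w)⟩

/-- Passing to the child interval containing both points expands `y - x` by a definite factor, so
after finitely many steps the two points lie in different child intervals. -/
theorem induction_on_interval [Finite ι] [Finite W] {p : W → ℝ → ℝ → Prop}
    (hchild : ∀ w k x y, k < G.cnt w → 0 ≤ x → x < y → y ≤ G.len (G.nxt w k) →
      p (G.nxt w k) x y → p w (G.childMap w k x) (G.childMap w k y))
    (hsplit : ∀ w x y, 0 ≤ x → x < y → y ≤ G.len w → G.digit w x < G.digit w y → p w x y)
    (w : W) {x y : ℝ} (hx : 0 ≤ x) (hxy : x < y) (hy : y ≤ G.len w) : p w x y := by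
  obtain ⟨σ, hσ0, hσ1, hσ⟩ := G.exists_scale_le
  obtain ⟨M, hM⟩ := G.exists_len_le
  have hM0 : 0 < M := (G.len_pos w).trans_le (hM w)
  obtain ⟨n, hn⟩ := exists_pow_lt_of_lt_one (div_pos (sub_pos.2 hxy) hM0) hσ1
  rw [lt_div_iff₀ hM0] at hn
  induction n generalizing w x y with
  | zero => linarith [hM w]
  | succ n ih =>
    rcases (G.digit_mono w hxy.le).lt_or_eq with hd | hd
    · exact hsplit w x y hx hxy hy hd
    have hx' := G.rescale_mem w ⟨hx, hxy.le.trans hy⟩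
    have hy' := G.rescale_mem w ⟨hx.trans hxy.le, hy⟩
    have hyc := G.childMap_rescale w y
    rw [← hd] at hy' hyc
    have hxy' : G.rescale w x < G.rescale w y := by
      rwa [← (G.childMap_strictMono w (G.digit w x)).lt_iff_lt, childMap_rescale, hyc]
    have hsub := G.childMap_sub_childMap w (G.digit w x) (G.rescale w x) (G.rescale w y)
    rw [childMap_rescale, hyc] at hsub
    have hexpand : σ ^ n * M < G.rescale w y - G.rescale w x := by
      have := mul_le_mul_of_nonneg_right (hσ w (G.digit w x)) (sub_pos.2 hxy').le
      refine lt_of_mul_lt_mul_left ?_ hσ0.le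
      calc σ * (σ ^ n * M) = σ ^ (n + 1) * M := by ring
        _ < _ := hn.trans_le (hsub.trans_le this)
    have := hchild w (G.digit w x) _ _ (G.digit_lt w x) hx'.1 hxy' hy'.2
      (ih _ hx'.1 hxy' hy'.2 hexpand)
    rwa [childMap_rescale, hyc] at this

/-- A bounded family of maps satisfying the functional equations given by the subdivision. -/
structure IsCurve (φ : W → ℝ → X) : Prop where
  bounded : ∃ D : ℝ, 0 ≤ D ∧ ∀ v x w y, dist (φ v x) (φ w y) ≤ D
  eq_map : ∀ w t, φ w t = G.map (G.lab w (G.digit w t)) (φ (G.nxt w (G.digit w t)) (G.rescale w t))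

/-- The image of the curve of state `w`. -/
def trace (φ : W → ℝ → X) (w : W) : Set X := φ w '' Icc 0 (G.len w)

/-- The address of `t` under iterated subdivision, read through the coding map. -/
theorem exists_isCurve [Finite ι] [CompleteSpace X] [Nonempty X] : ∃ φ, G.IsCurve φ := by
  let : TopologicalSpace ι := ⊥
  have : DiscreteTopology ι := ⟨rfl⟩
  obtain ⟨π, hπc, hπ⟩ := G.isSimilitudeIFS.exists_isCodingMap
  let T : W × ℝ → W × ℝ := fun z => (G.nxt z.1 (G.digit z.1 z.2), G.rescale z.1 z.2)
  refine ⟨fun w t => π fun n => G.lab (T^[n] (w, t)).1 (G.digit (T^[n] (w, t)).1 (T^[n] (w, t)).2),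
    ?_, fun w t => hπ _⟩
  obtain ⟨D, hD⟩ := Metric.isBounded_iff.1 (isCompact_range hπc).isBounded
  exact ⟨max D 0, le_max_right _ _, fun v x w y =>
    (hD (mem_range_self _) (mem_range_self _)).trans (le_max_left _ _)⟩

end OrderedSubdivision

theorem IsSimilitudeIFS.eq_of_eq_map {X ι V : Type*} [MetricSpace X] [Finite ι] [Finite V]
    {S : ι → X → X} {r : ι → ℝ} (hS : IsSimilitudeIFS S r) {i : V → ι} {n : V → V} {f g : V → X}
    (hf : ∀ v, f v = S (i v) (f (n v))) (hg : ∀ v, g v = S (i v) (g (n v))) : f = g := by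
  funext v
  refine hS.subset_of_subinvariant (rule := fun v => {(i v, n v)}) (E := fun v => {f v})
    (F := fun v => {g v}) (fun v => ?_) (fun _ => Bornology.isBounded_singleton) (fun v e he => ?_)
    (fun _ => isClosed_singleton) (fun _ => singleton_nonempty _) v rfl
  · simpa using hf v
  · rw [mem_singleton_iff.1 he, image_singleton, ← hg]

namespace OrderedSubdivision

variable {X ι W : Type*} [MetricSpace X] {G : OrderedSubdivision X ι W} {φ : W → ℝ → X}

namespace IsCurve

theorem apply_childMap_of_lt (hφ : G.IsCurve φ) {w : W} {k : ℕ} (hk : k < G.cnt w) {x : ℝ}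
    (hx0 : 0 ≤ x) (hx1 : x < G.len (G.nxt w k)) :
    φ w (G.childMap w k x) = G.map (G.lab w k) (φ (G.nxt w k) x) := by
  have hd := G.digit_childMap hk hx0 hx1
  have hr := G.childMap_rescale w (G.childMap w k x)
  rw [hd] at hr
  rw [hφ.eq_map, hd, (G.childMap_strictMono w k).injective hr]

theorem exists_dist_le_of_child_le [Finite ι] [Finite W] (hφ : G.IsCurve φ) : ∃ C : ℝ, 0 ≤ C ∧
    ∀ v k t, G.scale v k * G.len (G.nxt v k) ≤ t →
      ∀ u x w y, dist (φ u x) (φ w y) ≤ C * t ^ (1 / G.s : ℝ) := by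
  obtain ⟨D, hD0, hD⟩ := hφ.bounded
  obtain ⟨δ, hδ0, hδ⟩ := exists_pos_forall_le_of_finite
    (f := fun p : ι × W => G.ratio p.1 ^ (G.s : ℝ) * G.len p.2) fun p =>
      mul_pos (Real.rpow_pos_of_pos (G.isSimilitudeIFS.ratio_pos _) _) (G.len_pos _)
  have hδs : 0 < δ ^ (1 / G.s : ℝ) := Real.rpow_pos_of_pos hδ0 _
  refine ⟨D / δ ^ (1 / G.s : ℝ), div_nonneg hD0 hδs.le, fun v k t ht u x w y => ?_⟩
  rw [div_mul_eq_mul_div, le_div_iff₀ hδs]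
  have hδt : δ ≤ t := (hδ (G.lab v k, G.nxt v k)).trans ht
  exact mul_le_mul (hD u x w y) (Real.rpow_le_rpow hδ0.le hδt (by positivity)) hδs.le hD0

section Finite

variable [Finite ι] [Finite W]

theorem apply_zero (hφ : G.IsCurve φ) (w : W) : φ w 0 = G.src w := by
  refine congrFun (G.isSimilitudeIFS.eq_of_eq_map (f := fun w => φ w 0) (fun w => ?_) G.src_eq) w
  have := hφ.apply_childMap_of_lt (G.cnt_pos w) le_rfl (G.len_pos _)
  rwa [G.childMap_zero, G.breakpoint_zero] at this

theorem apply_len (hφ : G.IsCurve φ) (w : W) : φ w (G.len w) = G.tgt w := by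
  refine congrFun (G.isSimilitudeIFS.eq_of_eq_map (f := fun w => φ w (G.len w)) (fun w => ?_)
    G.tgt_eq) w
  have hr := (G.childMap_rescale w (G.len w)).trans (G.childMap_last w).symm
  rw [G.digit_len] at hr
  have h := hφ.eq_map w (G.len w)
  rwa [G.digit_len, (G.childMap_strictMono w _).injective hr] at h

/-- At the right end point of the child interval the functional equation belongs to the next child,
and the two agree by `link`. -/
theorem apply_childMap (hφ : G.IsCurve φ) {w : W} {k : ℕ} (hk : k < G.cnt w) {x : ℝ}
    (hx : x ∈ Icc 0 (G.len (G.nxt w k))) :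
    φ w (G.childMap w k x) = G.map (G.lab w k) (φ (G.nxt w k) x) := by
  rcases hx.2.lt_or_eq with h | rfl
  · exact hφ.apply_childMap_of_lt hk hx.1 h
  rw [hφ.apply_len]
  rcases (Nat.succ_le_of_lt hk).lt_or_eq with hnext | hlast
  · have h := hφ.apply_childMap_of_lt hnext le_rfl (G.len_pos _)
    rwa [G.childMap_zero, hφ.apply_zero, ← G.link w k hnext, ← G.childMap_len] at h
  · obtain rfl : k = G.cnt w - 1 := Nat.eq_sub_of_add_eq hlast
    rw [G.childMap_last, hφ.apply_len, G.tgt_eq]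

theorem trace_eq (hφ : G.IsCurve φ) (w : W) : G.trace φ w =
    ⋃ k ∈ Finset.range (G.cnt w), G.map (G.lab w k) '' G.trace φ (G.nxt w k) := by
  refine Subset.antisymm ?_ (iUnion₂_subset fun k hk => ?_)
  · rintro _ ⟨t, ht, rfl⟩
    rw [hφ.eq_map]
    exact mem_biUnion (Finset.mem_range.2 (G.digit_lt w t)) ⟨_, ⟨_, G.rescale_mem w ht, rfl⟩, rfl⟩
  · rintro _ ⟨_, ⟨x, hx, rfl⟩, rfl⟩
    have hk := Finset.mem_range.1 hk
    exact ⟨_, G.childMap_mem_Icc hk hx, hφ.apply_childMap hk hx⟩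

theorem dist_childMap_le (hφ : G.IsCurve φ) {C : ℝ} {w : W} {k : ℕ} (hk : k < G.cnt w) {x y : ℝ}
    (hx : 0 ≤ x) (hxy : x ≤ y) (hy : y ≤ G.len (G.nxt w k))
    (h : dist (φ (G.nxt w k) x) (φ (G.nxt w k) y) ≤ C * (y - x) ^ (1 / G.s : ℝ)) :
    dist (φ w (G.childMap w k x)) (φ w (G.childMap w k y)) ≤
      C * (G.childMap w k y - G.childMap w k x) ^ (1 / G.s : ℝ) := by
  have hr := G.isSimilitudeIFS.ratio_pos (G.lab w k)
  have hs : (G.s : ℝ) ≠ 0 := NNReal.coe_ne_zero.2 G.s_pos.ne'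
  rw [hφ.apply_childMap hk ⟨hx, hxy.trans hy⟩, hφ.apply_childMap hk ⟨hx.trans hxy, hy⟩,
    (G.isSimilitudeIFS.isSimilitude _).dist_map, G.childMap_sub_childMap, scale,
    Real.mul_rpow (Real.rpow_nonneg hr.le _) (sub_nonneg.2 hxy), ← Real.rpow_mul hr.le,
    mul_one_div_cancel hs, Real.rpow_one, mul_left_comm]
  exact mul_le_mul_of_nonneg_left h hr.le

theorem dist_endpoint_le (hφ : G.IsCurve φ) {C : ℝ}
    (hfar : ∀ v k t, G.scale v k * G.len (G.nxt v k) ≤ t →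
      ∀ u x w y, dist (φ u x) (φ w y) ≤ C * t ^ (1 / G.s : ℝ)) (w : W) {x y : ℝ}
    (hx : 0 ≤ x) (hxy : x ≤ y) (hy : y ≤ G.len w) (hend : x = 0 ∨ y = G.len w) :
    dist (φ w x) (φ w y) ≤ C * (y - x) ^ (1 / G.s : ℝ) := by
  have hs : (1 / G.s : ℝ) ≠ 0 := one_div_ne_zero (NNReal.coe_ne_zero.2 G.s_pos.ne')
  rcases hxy.eq_or_lt with rfl | hxy
  · rw [dist_self, sub_self, Real.zero_rpow hs, mul_zero]
  refine G.induction_on_interval (p := fun w x y => x = 0 ∨ y = G.len w →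
    dist (φ w x) (φ w y) ≤ C * (y - x) ^ (1 / G.s : ℝ)) ?_ ?_ w hx hxy hy hend
  · intro w k x y hk hx hxy hy ih hend
    refine hφ.dist_childMap_le hk hx hxy.le hy (ih (hend.imp (fun h => ?_) fun h => ?_))
    · refine hx.antisymm' ((G.childMap_strictMono w k).le_iff_le.1 ?_)
      rw [h, G.childMap_zero]
      exact G.breakpoint_nonneg w k
    · refine hy.antisymm ((G.childMap_strictMono w k).le_iff_le.1 ?_)
      rw [h, G.childMap_len]
      exact G.breakpoint_le_len hk
  · intro w x y hx hxy hy hd hend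
    have hsucc := fun k => G.breakpoint_succ w k
    rcases hend with rfl | rfl
    · refine hfar w 0 _ ?_ _ _ _ _
      have := (G.breakpoint_strictMono w).monotone (Nat.one_le_of_lt hd)
      linarith [hsucc 0, G.breakpoint_zero w, G.breakpoint_digit_le w hxy.le]
    · refine hfar w (G.digit w (G.len w)) _ ?_ _ _ _ _
      have := (G.breakpoint_strictMono w).monotone (Nat.succ_le_of_lt hd)
      linarith [hsucc (G.digit w (G.len w)), G.le_breakpoint_digit_succ w (hxy.le.trans hy),
        G.breakpoint_le_len (G.digit_lt w (G.len w))]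

/-- Two points in different child intervals are joined through the last break point after the first
one and the first break point before the second one. -/
theorem dist_le_of_digit_lt (hφ : G.IsCurve φ) {C : ℝ} (hC : 0 ≤ C)
    (hfar : ∀ v k t, G.scale v k * G.len (G.nxt v k) ≤ t →
      ∀ u x w y, dist (φ u x) (φ w y) ≤ C * t ^ (1 / G.s : ℝ)) {w : W} {x y : ℝ}
    (hx : 0 ≤ x) (hxy : x ≤ y) (hy : y ≤ G.len w) (hd : G.digit w x < G.digit w y) :
    dist (φ w x) (φ w y) ≤ 3 * C * (y - x) ^ (1 / G.s : ℝ) := by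
  set b := G.breakpoint w (G.digit w x + 1)
  set c := G.breakpoint w (G.digit w y)
  have hxb : x ≤ b := G.le_breakpoint_digit_succ w (hxy.trans hy)
  have hbc : b ≤ c := (G.breakpoint_strictMono w).monotone (Nat.succ_le_of_lt hd)
  have hcy : c ≤ y := G.breakpoint_digit_le w (hx.trans hxy)
  have hx' := G.rescale_mem w ⟨hx, hxy.trans hy⟩
  have hy' := G.rescale_mem w ⟨hx.trans hxy, hy⟩
  have hfirst : dist (φ w x) (φ w b) ≤ C * (b - x) ^ (1 / G.s : ℝ) := by
    have := hφ.dist_childMap_le (G.digit_lt w x) hx'.1 hx'.2 le_rfl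
      (hφ.dist_endpoint_le hfar _ hx'.1 hx'.2 le_rfl (Or.inr rfl))
    rwa [G.childMap_rescale, G.childMap_len] at this
  have hlast : dist (φ w c) (φ w y) ≤ C * (y - c) ^ (1 / G.s : ℝ) := by
    have := hφ.dist_childMap_le (G.digit_lt w y) le_rfl hy'.1 hy'.2
      (hφ.dist_endpoint_le hfar _ le_rfl hy'.1 hy'.2 (Or.inl rfl))
    rwa [G.childMap_rescale, G.childMap_zero] at this
  have hmid : dist (φ w b) (φ w c) ≤ C * (c - b) ^ (1 / G.s : ℝ) := by
    rcases (Nat.succ_le_of_lt hd).eq_or_lt with h | h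
    · have : b = c := congrArg (G.breakpoint w) h
      rw [this, dist_self, sub_self]
      positivity
    · refine hfar w (G.digit w x + 1) _ ?_ _ _ _ _
      have := (G.breakpoint_strictMono w).monotone (Nat.succ_le_of_lt h)
      linarith [G.breakpoint_succ w (G.digit w x + 1)]
  have hmono : ∀ {t : ℝ}, 0 ≤ t → t ≤ y - x →
      C * t ^ (1 / G.s : ℝ) ≤ C * (y - x) ^ (1 / G.s : ℝ) := fun h0 h =>
    mul_le_mul_of_nonneg_left (Real.rpow_le_rpow h0 h (by positivity)) hC
  have htriangle := dist_triangle4 (φ w x) (φ w b) (φ w c) (φ w y)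
  linarith [hmono (t := b - x) (by linarith) (by linarith),
    hmono (t := c - b) (by linarith) (by linarith), hmono (t := y - c) (by linarith) (by linarith)]

theorem exists_dist_le (hφ : G.IsCurve φ) : ∃ C : ℝ, 0 ≤ C ∧ ∀ w x y, 0 ≤ x → x < y →
    y ≤ G.len w → dist (φ w x) (φ w y) ≤ C * (y - x) ^ (1 / G.s : ℝ) := by
  obtain ⟨C, hC, hfar⟩ := hφ.exists_dist_le_of_child_le
  exact ⟨3 * C, by positivity, fun w x y => G.induction_on_interval
    (p := fun w x y => dist (φ w x) (φ w y) ≤ 3 * C * (y - x) ^ (1 / G.s : ℝ))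
    (fun w k x y hk hx hxy hy => hφ.dist_childMap_le hk hx hxy.le hy)
    (fun w x y hx hxy hy => hφ.dist_le_of_digit_lt hC hfar hx hxy.le hy) w⟩

theorem exists_holderOnWith (hφ : G.IsCurve φ) :
    ∃ C : ℝ≥0, ∀ w, HolderOnWith C (1 / G.s) (φ w) (Icc 0 (G.len w)) := by
  obtain ⟨C, hC, hdist⟩ := hφ.exists_dist_le
  lift C to ℝ≥0 using hC
  refine ⟨C, fun w => ?_⟩
  have hlt : ∀ x ∈ Icc 0 (G.len w), ∀ y ∈ Icc 0 (G.len w), x < y →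
      edist (φ w x) (φ w y) ≤ C * edist x y ^ ((1 / G.s : ℝ≥0) : ℝ) := by
    intro x hx y hy hxy
    rw [edist_dist, edist_comm x, edist_dist, Real.dist_eq, abs_of_pos (sub_pos.2 hxy),
      ENNReal.ofReal_rpow_of_nonneg (sub_pos.2 hxy).le (by positivity),
      ← ENNReal.ofReal_coe_nnreal, ← ENNReal.ofReal_mul C.coe_nonneg]
    exact ENNReal.ofReal_le_ofReal (by simpa using hdist w x y hx.1 hxy hy.2)
  intro x hx y hy
  rcases lt_trichotomy x y with h | rfl | h
  · exact hlt x hx y hy h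
  · simp
  · rw [edist_comm, edist_comm x]
    exact hlt y hy x hx h

end Finite

end IsCurve

end OrderedSubdivision

theorem volume_eq_mul_preimage {b c : ℝ} (hc : 0 < c) (T : Set ℝ) :
    volume T = ENNReal.ofReal c * volume ((fun x => b + c * x) ⁻¹' T) := by
  have hcomp : (fun x => b + c * x) ⁻¹' T = (fun x => c * x) ⁻¹' ((fun x => b + x) ⁻¹' T) := rfl
  rw [hcomp, Real.volume_preimage_mul_left hc.ne', measure_preimage_add, ← mul_assoc,
    ← ENNReal.ofReal_mul hc.le, abs_of_pos (inv_pos.2 hc), mul_inv_cancel₀ hc.ne',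
    ENNReal.ofReal_one, one_mul]

theorem sum_measure_Ioc_of_monotone {α : Type*} [LinearOrder α] [TopologicalSpace α]
    [OrderClosedTopology α] [MeasurableSpace α] [OpensMeasurableSpace α] (μ : Measure α)
    {f : ℕ → α} (hf : Monotone f) (n : ℕ) :
    ∑ k ∈ Finset.range n, μ (Ioc (f k) (f (k + 1))) = μ (Ioc (f 0) (f n)) := by
  induction n with
  | zero => simp
  | succ n ih =>
    rw [Finset.sum_range_succ, ih, ← Ioc_union_Ioc_eq_Ioc (hf n.zero_le) (hf n.le_succ),
      measure_union (Ioc_disjoint_Ioc_of_le le_rfl) measurableSet_Ioc]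

namespace OrderedSubdivision

variable {X ι W : Type*} [MetricSpace X] {G : OrderedSubdivision X ι W} {φ : W → ℝ → X}

theorem childMap_preimage_Ioc (w : W) (k : ℕ) :
    G.childMap w k ⁻¹' Ioc (G.breakpoint w k) (G.breakpoint w (k + 1)) =
      Ioc 0 (G.len (G.nxt w k)) := by
  ext x
  rw [mem_preimage, ← G.childMap_zero w k, ← G.childMap_len w k, mem_Ioc, mem_Ioc,
    (G.childMap_strictMono w k).lt_iff_lt, (G.childMap_strictMono w k).le_iff_le]

theorem sum_scale_mul_volume (w : W) (U : Set ℝ) :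
    ∑ k ∈ Finset.range (G.cnt w), ENNReal.ofReal (G.scale w k) *
      volume (G.childMap w k ⁻¹' U ∩ Ioc 0 (G.len (G.nxt w k))) =
    volume (U ∩ Ioc 0 (G.len w)) := by
  have hsum := sum_measure_Ioc_of_monotone (volume.restrict U) (G.breakpoint_strictMono w).monotone
    (G.cnt w)
  simp only [Measure.restrict_apply measurableSet_Ioc, G.breakpoint_cnt, G.breakpoint_zero,
    inter_comm _ U] at hsum
  rw [← hsum]
  refine Finset.sum_congr rfl fun k _ => ?_
  rw [volume_eq_mul_preimage (b := G.breakpoint w k) (G.scale_pos w k)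
    (U ∩ Ioc (G.breakpoint w k) (G.breakpoint w (k + 1))), ← G.childMap_preimage_Ioc w k]
  rfl

namespace IsCurve

theorem image_subset (hφ : G.IsCurve φ) {w : W} {F : Set ℝ} (hF : F ⊆ Icc 0 (G.len w)) :
    φ w '' F ⊆ ⋃ k ∈ Finset.range (G.cnt w), G.map (G.lab w k) ''
      (φ (G.nxt w k) '' (G.childMap w k ⁻¹' F ∩ Icc 0 (G.len (G.nxt w k)))) := by
  rintro _ ⟨t, ht, rfl⟩
  rw [hφ.eq_map]
  refine mem_biUnion (Finset.mem_range.2 (G.digit_lt w t)) ⟨_, ⟨_, ⟨?_, G.rescale_mem w (hF ht)⟩,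
    rfl⟩, rfl⟩
  rwa [mem_preimage, G.childMap_rescale]

variable [MeasurableSpace X] [BorelSpace X]

/-- The `n`-th generation intervals meeting `F` lie in `U`, and each of them is mapped onto a set
whose measure is at most its length. -/
theorem hausdorffMeasure_image_le_of_thickening (hφ : G.IsCurve φ)
    (htrace : ∀ w, μH[(G.s : ℝ)] (G.trace φ w) ≤ ENNReal.ofReal (G.len w)) {σ M : ℝ}
    (hσ : ∀ w k, G.scale w k ≤ σ) (hM : ∀ w, G.len w ≤ M) (n : ℕ) (w : W) {F U : Set ℝ}
    (hF : F ⊆ Icc 0 (G.len w))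
    (hU : ∀ x ∈ F, ∀ y ∈ Icc 0 (G.len w), |y - x| ≤ σ ^ n * M → y ∈ U) :
    μH[(G.s : ℝ)] (φ w '' F) ≤ volume (U ∩ Ioc 0 (G.len w)) := by
  induction n generalizing w F U with
  | zero =>
    rcases F.eq_empty_or_nonempty with rfl | ⟨x, hx⟩
    · simp
    have hIU : Ioc 0 (G.len w) ⊆ U := fun y hy => by
      refine hU x hx y ⟨hy.1.le, hy.2⟩ (abs_sub_le_iff.2 ?_)
      constructor <;> linarith [hy.1, hy.2, (hF hx).1, (hF hx).2, hM w]
    rw [inter_eq_self_of_subset_right hIU, Real.volume_Ioc, sub_zero]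
    exact (measure_mono (image_mono hF)).trans (htrace w)
  | succ n ih =>
    rw [← G.sum_scale_mul_volume]
    refine (measure_mono (hφ.image_subset hF)).trans
      ((measure_biUnion_finset_le _ _).trans (Finset.sum_le_sum fun k hk => ?_))
    rw [(G.isSimilitudeIFS.isSimilitude _).hausdorffMeasure_image G.s.coe_nonneg]
    refine mul_le_mul_right (ih _ inter_subset_right fun x hx y hy hxy => ?_) _
    refine hU _ hx.1 _ (G.childMap_mem_Icc (Finset.mem_range.1 hk) hy) ?_
    rw [G.childMap_sub_childMap, abs_mul, abs_of_pos (G.scale_pos w k), pow_succ', mul_assoc]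
    exact mul_le_mul (hσ w k) hxy (abs_nonneg _) ((G.scale_pos w k).le.trans (hσ w k))

variable [Finite ι] [Finite W]

theorem hausdorffMeasure_image_le_of_isOpen (hφ : G.IsCurve φ)
    (htrace : ∀ w, μH[(G.s : ℝ)] (G.trace φ w) ≤ ENNReal.ofReal (G.len w)) (w : W) {U : Set ℝ}
    (hU : IsOpen U) : μH[(G.s : ℝ)] (φ w '' (U ∩ Icc 0 (G.len w))) ≤ volume U := by
  obtain ⟨σ, hσ0, hσ1, hσ⟩ := G.exists_scale_le
  obtain ⟨M, hM⟩ := G.exists_len_le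
  have hM0 : 0 < M := (G.len_pos w).trans_le (hM w)
  let F : ℕ → Set ℝ := fun n =>
    {x ∈ Icc 0 (G.len w) | ∀ y ∈ Icc 0 (G.len w), |y - x| ≤ σ ^ n * M → y ∈ U}
  have hFmono : Monotone F := fun n m hnm x hx => ⟨hx.1, fun y hy hyx => hx.2 y hy (hyx.trans
    (mul_le_mul_of_nonneg_right (pow_le_pow_of_le_one hσ0.le hσ1.le hnm) hM0.le))⟩
  have hFU : U ∩ Icc 0 (G.len w) ⊆ ⋃ n, F n := by
    rintro x ⟨hxU, hx⟩
    obtain ⟨ε, hε, hball⟩ := Metric.isOpen_iff.1 hU x hxU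
    obtain ⟨n, hn⟩ := exists_pow_lt_of_lt_one (div_pos hε hM0) hσ1
    rw [lt_div_iff₀ hM0] at hn
    exact mem_iUnion.2 ⟨n, hx, fun y _ hyx => hball (hyx.trans_lt hn)⟩
  calc μH[(G.s : ℝ)] (φ w '' (U ∩ Icc 0 (G.len w)))
      ≤ μH[(G.s : ℝ)] (⋃ n, φ w '' F n) := by
        rw [← image_iUnion]
        exact measure_mono (image_mono hFU)
    _ = ⨆ n, μH[(G.s : ℝ)] (φ w '' F n) :=
        Monotone.measure_iUnion fun n m hnm => image_mono (hFmono hnm)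
    _ ≤ volume U := iSup_le fun n => (hφ.hausdorffMeasure_image_le_of_thickening htrace hσ hM n w
        (fun x hx => hx.1) fun x hx => hx.2).trans (measure_mono inter_subset_left)

theorem hausdorffMeasure_image_le (hφ : G.IsCurve φ)
    (htrace : ∀ w, μH[(G.s : ℝ)] (G.trace φ w) ≤ ENNReal.ofReal (G.len w)) (w : W) {F : Set ℝ}
    (hF : F ⊆ Icc 0 (G.len w)) : μH[(G.s : ℝ)] (φ w '' F) ≤ volume F := by
  rw [F.measure_eq_iInf_isOpen volume]
  exact le_iInf₂ fun U hFU => le_iInf fun hU =>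
    (measure_mono (image_mono (subset_inter hFU hF))).trans
      (hφ.hausdorffMeasure_image_le_of_isOpen htrace w hU)

end IsCurve

theorem IsCurve.isOptimalParameterization {X : Type} {ι W : Type*} [MetricSpace X] [Finite ι]
    [Finite W] [MeasurableSpace X] [BorelSpace X] {G : OrderedSubdivision X ι W} {φ : W → ℝ → X}
    (hφ : G.IsCurve φ) (htrace : ∀ w, μH[(G.s : ℝ)] (G.trace φ w) = ENNReal.ofReal (G.len w))
    (w : W) : IsOptimalParameterization G.s (G.trace φ w) fun t => φ w (G.len w * t) := by
  have hL := G.len_pos w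
  have himage : ∀ F : Set ℝ, (fun t => φ w (G.len w * t)) '' F = φ w '' ((G.len w * ·) '' F) :=
    fun F => (image_image _ _ _).symm
  have hIcc : (G.len w * ·) '' Icc 0 1 = Icc 0 (G.len w) := by
    simp [image_mul_left_Icc hL.le]
  have htr : (fun t => φ w (G.len w * t)) '' Icc 0 1 = G.trace φ w := by rw [himage, hIcc, trace]
  obtain ⟨C, hC⟩ := hφ.exists_holderOnWith
  have hholder := (hC w).comp
    ((lipschitzWith_smul (G.len w)).holderWith.holderOnWith (Icc (0 : ℝ) 1))
    (hIcc ▸ mapsTo_image _ _)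
  rw [mul_one] at hholder
  rw [← htr]
  refine isOptimalParameterization_of_measure_image_le G.s_pos hholder ?_ ?_ fun F hF => ?_
  · rw [htr, htrace]
    exact ENNReal.ofReal_pos.2 hL
  · rw [htr, htrace]
    exact ENNReal.ofReal_lt_top
  · rw [himage F, htr, htrace]
    refine (hφ.hausdorffMeasure_image_le (fun w => (htrace w).le) w
      ((image_mono hF).trans hIcc.le)).trans_eq ?_
    have hvol := Measure.addHaar_smul volume (G.len w) F
    rwa [Module.finrank_self, pow_one, abs_of_pos hL] at hvol

end OrderedSubdivision

/-! ### Paths and substitutions -/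

section Walks

variable {ε V : Type} {src tgt : ε → V}

theorem IsWalk.append {x y z : V} {p q : List ε} (hp : IsWalk src tgt x p y)
    (hq : IsWalk src tgt y q z) : IsWalk src tgt x (p ++ q) z := by
  induction p generalizing x with
  | nil => obtain rfl : x = y := hp; exact hq
  | cons e p ih => exact ⟨hp.1, ih hp.2⟩

theorem IsWalk.reverse_map {rev : ε → ε} (hsrc : ∀ e, src (rev e) = tgt e)
    (htgt : ∀ e, tgt (rev e) = src e) {x y : V} {p : List ε} (hp : IsWalk src tgt x p y) :
    IsWalk src tgt y (p.reverse.map rev) x := by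
  induction p generalizing x with
  | nil => obtain rfl : x = y := hp; rfl
  | cons e p ih =>
    rw [List.reverse_cons, List.map_append]
    exact (ih hp.2).append ⟨hsrc e, (htgt e).trans hp.1⟩

theorem IsWalk.map {δ : Type} {src' tgt' : δ → V} (f : ε → δ) (hsrc : ∀ e, src' (f e) = src e)
    (htgt : ∀ e, tgt' (f e) = tgt e) {x y : V} {p : List ε} (hp : IsWalk src tgt x p y) :
    IsWalk src' tgt' x (p.map f) y := by
  induction p generalizing x with
  | nil => exact hp
  | cons e p ih => exact ⟨(hsrc e).trans hp.1, by rw [htgt]; exact ih hp.2⟩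

theorem IsWalk.link {x y : V} {p : List ε} (hp : IsWalk src tgt x p y) (d : ε) {k : ℕ}
    (hk : k + 1 < p.length) : tgt (p.getD k d) = src (p.getD (k + 1) d) := by
  induction p generalizing x k with
  | nil => simp at hk
  | cons e p ih =>
    cases p with
    | nil => simp at hk
    | cons f p =>
      cases k with
      | zero => exact hp.2.1.symm
      | succ k => exact ih hp.2 (by simpa using hk)

theorem IsWalk.src_head {x y : V} {p : List ε} (hp : IsWalk src tgt x p y) (d : ε) (h : p ≠ []) :
    src (p.getD 0 d) = x := by
  cases p with
  | nil => exact absurd rfl h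
  | cons e p => exact hp.1

theorem IsWalk.tgt_last {x y : V} {p : List ε} (hp : IsWalk src tgt x p y) (d : ε) (h : p ≠ []) :
    tgt (p.getD (p.length - 1) d) = y := by
  induction p generalizing x with
  | nil => exact absurd rfl h
  | cons e p ih =>
    cases p with
    | nil => exact hp.2
    | cons f p => exact ih hp.2 (List.cons_ne_nil f p)

end Walks

theorem sum_map_eq_sum_range_getD {α M : Type*} [AddCommMonoid M] (g : α → M) (l : List α)
    (d : α) : (l.map g).sum = ∑ k ∈ Finset.range l.length, g (l.getD k d) := by
  induction l with
  | nil => simp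
  | cons a l ih =>
    rw [List.map_cons, List.sum_cons, ih, List.length_cons, Finset.sum_range_succ', add_comm]
    simp

theorem mem_iff_exists_getD {α : Type*} {l : List α} {d x : α} :
    x ∈ l ↔ ∃ k < l.length, l.getD k d = x := by
  rw [List.mem_iff_getElem]
  exact exists_congr fun k =>
    ⟨fun ⟨hk, h⟩ => ⟨hk, (List.getD_eq_getElem _ _ hk).trans h⟩,
      fun ⟨hk, h⟩ => ⟨hk, (List.getD_eq_getElem _ _ hk).symm.trans h⟩⟩

theorem OrderedSubdivision.IsCurve.isRuleInvariant {X ι W : Type*} [MetricSpace X] [Finite ι]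
    [Finite W] {G : OrderedSubdivision X ι W} {φ : W → ℝ → X} (hφ : G.IsCurve φ) :
    IsRuleInvariant G.map (fun w => {e : ι × W | ∃ k < G.cnt w, (G.lab w k, G.nxt w k) = e})
      (G.trace φ) where
  nonempty w := ⟨_, mem_image_of_mem _ (left_mem_Icc.2 (G.len_pos w).le)⟩
  isCompact w := by
    obtain ⟨C, hC⟩ := hφ.exists_holderOnWith
    exact isCompact_Icc.image_of_continuousOn ((hC w).continuousOn (by have := G.s_pos; positivity))
  eq_iUnion w := by
    rw [hφ.trace_eq]
    ext x
    simp

/-- The `k`-th piece of `E w` is traversed in a time proportional to its measure. -/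
theorem IsRuleInvariant.exists_isOptimalParameterization {X ι W : Type} [MetricSpace X]
    [CompleteSpace X] [MeasurableSpace X] [BorelSpace X] [Finite ι] [Finite W] {S : ι → X → X}
    {r : ι → ℝ} {s : ℝ≥0} {rule : W → List (ι × W)} {E : W → Set X}
    (hE : IsRuleInvariant S (fun w => {e | e ∈ rule w}) E) (hS : IsSimilitudeIFS S r) (hs : 0 < s)
    {src tgt : W → X} (hwalk : ∀ w, IsWalk (fun e : ι × W => S e.1 (src e.2))
      (fun e => S e.1 (tgt e.2)) (src w) (rule w) (tgt w))
    (hpos : ∀ w, 0 < μH[(s : ℝ)] (E w)) (hfin : ∀ w, μH[(s : ℝ)] (E w) < ∞)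
    (hsum : ∀ w, μH[(s : ℝ)] (E w) =
      ((rule w).map fun e => ENNReal.ofReal (r e.1 ^ (s : ℝ)) * μH[(s : ℝ)] (E e.2)).sum) (w : W) :
    ∃ φ : ℝ → X, IsOptimalParameterization s (E w) φ := by
  have hne : ∀ w, rule w ≠ [] := fun w h => (hpos w).ne' (by rw [hsum, h]; rfl)
  let child : W → ℕ → ι × W := fun w k => (rule w).getD k ((rule w).head (hne w))
  have : Nonempty X := ⟨(hE.nonempty w).some⟩
  let G : OrderedSubdivision X ι W :=
    { map := S
      ratio := r
      isSimilitudeIFS := hS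
      s := s
      s_pos := hs
      cnt := fun w => (rule w).length
      lab := fun w k => (child w k).1
      nxt := fun w k => (child w k).2
      len := fun w => (μH[(s : ℝ)] (E w)).toReal
      len_pos := fun w => ENNReal.toReal_pos (hpos w).ne' (hfin w).ne
      len_eq := fun w => by
        rw [hsum, sum_map_eq_sum_range_getD _ _ ((rule w).head (hne w)),
          ENNReal.toReal_sum fun k _ => ENNReal.mul_ne_top ENNReal.ofReal_ne_top (hfin _).ne]
        refine Finset.sum_congr rfl fun k _ => ?_
        rw [ENNReal.toReal_mul, ENNReal.toReal_ofReal (Real.rpow_nonneg (hS.ratio_pos _).le _)]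
      src := src
      tgt := tgt
      src_eq := fun w => ((hwalk w).src_head _ (hne w)).symm
      tgt_eq := fun w => ((hwalk w).tgt_last _ (hne w)).symm
      link := fun w k h => (hwalk w).link _ h }
  obtain ⟨φ, hφ⟩ := G.exists_isCurve
  have hrule : (fun w => {e : ι × W | ∃ k < G.cnt w, (G.lab w k, G.nxt w k) = e}) =
      fun w => {e | e ∈ rule w} := by
    funext w
    ext e
    exact mem_iff_exists_getD.symm
  have htrace : G.trace φ = E := (hrule ▸ hφ.isRuleInvariant).unique hE hS
  rw [← htrace]
  refine ⟨_, hφ.isOptimalParameterization (fun w => ?_) w⟩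
  rw [htrace]
  exact (ENNReal.ofReal_toReal (hfin w).ne).symm

section Substitution

variable {N m : ℕ} {Q : Fin m → List (CopyEdge N m)}

@[simp] theorem OEdge.rev_rev (v : OEdge m) : v.rev.rev = v := by simp [OEdge.rev]

theorem mem_fineRule {v : OEdge m} {e : CopyEdge N m} :
    e ∈ fineRule Q v ↔ (e.1, (e.2.1, e.2.2 * v.2)) ∈ Q v.1 := by
  obtain ⟨j, ε⟩ := v
  obtain ⟨i, l, η⟩ := e
  rcases Int.units_eq_one_or ε with rfl | rfl
  · simp [fineRule]
  · have h1 : (-1 : ℤˣ) ≠ 1 := by decide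
    simp only [fineRule, h1, if_false, List.mem_map, List.mem_reverse, mul_neg, mul_one]
    constructor
    · rintro ⟨⟨i', l', η'⟩, h, heq⟩
      simp only [OEdge.rev, Prod.mk.injEq] at heq
      obtain ⟨rfl, rfl, rfl⟩ := heq
      simpa using h
    · intro h
      exact ⟨_, h, by simp [OEdge.rev]⟩

theorem mem_fineRule_rev {v : OEdge m} {e : CopyEdge N m} :
    e ∈ fineRule Q v.rev ↔ (e.1, e.2.rev) ∈ fineRule Q v := by
  rw [mem_fineRule, mem_fineRule]
  simp [OEdge.rev]

theorem nodup_fineRule (hQ : ∀ j, (Q j).Nodup) (v : OEdge m) : (fineRule Q v).Nodup := by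
  unfold fineRule
  split_ifs
  · exact hQ _
  · refine (List.nodup_reverse.2 (hQ _)).map fun e f h => ?_
    obtain ⟨h1, h2⟩ := Prod.ext_iff.1 h
    refine Prod.ext h1 ?_
    simpa using congrArg OEdge.rev h2

theorem length_fineRule (v : OEdge m) : (fineRule Q v).length = (Q v.1).length := by
  unfold fineRule
  split_ifs <;> simp

theorem mem_fineIter_succ {u : OEdge m} {n : ℕ} {w : List (Fin N) × OEdge m} :
    w ∈ fineIter Q u (n + 1) ↔
      ∃ w' ∈ fineIter Q u n, ∃ e ∈ fineRule Q w'.2, w = (w'.1 ++ [e.1], e.2) := by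
  simp only [fineIter, List.mem_flatMap, List.mem_map, eq_comm]

/-- Every edge `S_i(v_l^{β_i})` lies on exactly one of the paths `Q_j`, and exactly once. -/
structure IsEdgePartition (β : Fin N → ℤˣ) (Q : Fin m → List (CopyEdge N m)) : Prop where
  orientation : ∀ j, ∀ e ∈ Q j, e.2.2 = β e.1
  cover : ∀ i l, ∃ j, (i, (l, β i)) ∈ Q j
  disjoint : ∀ j j', j ≠ j' → List.Disjoint (Q j) (Q j')
  nodup : ∀ j, (Q j).Nodup

theorem IsEdgePartition.fst_ne {β : Fin N → ℤˣ} (hQ : IsEdgePartition β Q) {v v' : OEdge m}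
    (hne : v.1 ≠ v'.1) {i : Fin N} {x x' : OEdge m} (hx : (i, x) ∈ fineRule Q v)
    (hx' : (i, x') ∈ fineRule Q v') : x.1 ≠ x'.1 := by
  intro h
  rw [mem_fineRule] at hx hx'
  have h1 := hQ.orientation _ _ hx
  have h2 := hQ.orientation _ _ hx'
  simp only at h1 h2
  rw [h1] at hx
  rw [h2, ← h] at hx'
  exact hQ.disjoint _ _ hne hx hx'

theorem IsEdgePartition.fst_ne_of_ne {β : Fin N → ℤˣ} (hQ : IsEdgePartition β Q) {v : OEdge m}
    {i : Fin N} {x x' : OEdge m} (hx : (i, x) ∈ fineRule Q v) (hx' : (i, x') ∈ fineRule Q v)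
    (hne : x ≠ x') : x.1 ≠ x'.1 := by
  intro h
  rw [mem_fineRule] at hx hx'
  have h1 := hQ.orientation _ _ hx
  have h2 := hQ.orientation _ _ hx'
  simp only at h1 h2
  exact hne (Prod.ext h (mul_right_cancel (h1.trans h2.symm)))

theorem exists_of_mem_coarseRule_iterate {p : Fin m → Prop} (h : ∀ j, ∀ e ∈ Q j, p e.2.1 → p j)
    {n : ℕ} {w : List (Fin m)} {u : Fin m}
    (hu : u ∈ (fun w : List (Fin m) => w.flatMap (coarseRule Q))^[n] w) (hp : p u) :
    ∃ v ∈ w, p v := by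
  induction n generalizing w with
  | zero => exact ⟨u, hu, hp⟩
  | succ n ih =>
    rw [Function.iterate_succ_apply] at hu
    obtain ⟨v, hv, hpv⟩ := ih hu
    obtain ⟨j, hj, hvj⟩ := List.mem_flatMap.1 hv
    obtain ⟨e, he, rfl⟩ := List.mem_map.1 hvj
    exact ⟨j, hj, h j e he hpv⟩

theorem IsPrimitivePartition.ne_nil (hQ : IsPrimitivePartition Q) (j : Fin m) : Q j ≠ [] := by
  obtain ⟨n, hn, h⟩ := hQ
  intro hj
  obtain ⟨k, rfl⟩ := Nat.exists_eq_add_of_le' hn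
  have hmem := h j j
  rw [Function.iterate_succ_apply] at hmem
  obtain ⟨v, hv, -⟩ := exists_of_mem_coarseRule_iterate (p := fun _ => True)
    (fun _ _ _ _ => trivial) hmem trivial
  simp [coarseRule, hj] at hv

theorem fineRule_ne_nil (hQ : ∀ j, Q j ≠ []) (v : OEdge m) : fineRule Q v ≠ [] := by
  rw [← List.length_pos_iff, length_fineRule]
  exact List.length_pos_iff.2 (hQ _)

variable [NeZero m]

@[simp] theorem OEdge.src_rev {X : Type} (a : Fin m → X) (v : OEdge m) :
    OEdge.src a v.rev = OEdge.tgt a v := by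
  obtain ⟨j, ε⟩ := v
  rcases Int.units_eq_one_or ε with rfl | rfl <;> simp [OEdge.src, OEdge.tgt, OEdge.rev]

@[simp] theorem OEdge.tgt_rev {X : Type} (a : Fin m → X) (v : OEdge m) :
    OEdge.tgt a v.rev = OEdge.src a v := by
  rw [← OEdge.src_rev, OEdge.rev_rev]

theorem isWalk_fineRule {X : Type} {S : Fin N → X → X} {a : Fin m → X}
    (hcons : IsConsistent S a Q) (v : OEdge m) :
    IsWalk (CopyEdge.src S a) (CopyEdge.tgt S a) (OEdge.src a v) (fineRule Q v)
      (OEdge.tgt a v) := by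
  obtain ⟨j, ε⟩ := v
  rcases Int.units_eq_one_or ε with rfl | rfl
  · simpa [fineRule, OEdge.src, OEdge.tgt] using hcons j
  · have h1 : (-1 : ℤˣ) ≠ 1 := by decide
    have := (hcons j).reverse_map (rev := fun e => (e.1, e.2.rev))
      (fun _ => by simp [CopyEdge.src, CopyEdge.tgt]) fun _ => by simp [CopyEdge.src, CopyEdge.tgt]
    simpa [fineRule, OEdge.src, OEdge.tgt, h1] using this

theorem IsUnicursal.isEdgePartition {X : Type} {S : Fin N → X → X} {a : Fin m → X}
    {β : Fin N → ℤˣ} {P : List (CopyEdge N m)} (hP : IsUnicursal S a β P)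
    (hQ : IsPathPartition P Q) : IsEdgePartition β Q := by
  have hmem : ∀ e, e ∈ P ↔ ∃ j, e ∈ Q j := by
    intro e
    rw [hQ.1]
    simp [List.mem_flatten, List.mem_ofFn']
  refine ⟨fun j e he => (hP.2.2 e).1 ((hmem e).2 ⟨j, he⟩), fun i l => ?_, hQ.2, fun j => ?_⟩
  · exact (hmem _).1 ((hP.2.2 _).2 rfl)
  · have := hP.2.1
    rw [hQ.1, List.nodup_flatten] at this
    exact this.1 _ (by simp [List.mem_ofFn'])

end Substitution

/-! ### The induced graph-directed system -/

namespace OrderedGIFS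

variable {X : Type} [MetricSpace X] {V : Type} {G : OrderedGIFS X V}

theorem init_eq_of_lt {e f : G.Bridge} (h : G.order.lt e f) : G.init e = G.init f :=
  G.init_eq_of_le e f (@le_of_lt _ G.order.toPreorder _ _ h)

theorem mem_paths_zero {u : V} {p : List G.Bridge} : p ∈ G.paths u 0 ↔ p = [] :=
  ⟨fun hp => List.length_eq_zero_iff.1 hp.1, fun hp => ⟨by rw [hp]; rfl, u, by rw [hp]; rfl⟩⟩

theorem cons_mem_paths_iff {u : V} {k : ℕ} {e : G.Bridge} {p : List G.Bridge} :
    e :: p ∈ G.paths u (k + 1) ↔ G.init e = u ∧ p ∈ G.paths (G.term e) k := by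
  constructor
  · rintro ⟨hl, v, hi, hv⟩
    exact ⟨hi, by simpa using hl, v, hv⟩
  · rintro ⟨hi, hl, v, hv⟩
    exact ⟨by simp [hl], v, hi, hv⟩

theorem exists_cons_of_mem_paths {u : V} {k : ℕ} {p : List G.Bridge} (hp : p ∈ G.paths u (k + 1)) :
    ∃ e q, p = e :: q ∧ G.init e = u ∧ q ∈ G.paths (G.term e) k := by
  cases p with
  | nil => exact absurd hp.1 (by simp)
  | cons e q => exact ⟨e, q, rfl, cons_mem_paths_iff.1 hp⟩

theorem exists_cons_mem_paths (hne : ∀ u, ∃ e, G.init e = u) (e : G.Bridge) (k : ℕ) :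
    ∃ p, e :: p ∈ G.paths (G.init e) (k + 1) := by
  induction k generalizing e with
  | zero => exact ⟨[], cons_mem_paths_iff.2 ⟨rfl, mem_paths_zero.2 rfl⟩⟩
  | succ k ih =>
    obtain ⟨f, hf⟩ := hne (G.term e)
    obtain ⟨p, hp⟩ := ih f
    exact ⟨f :: p, cons_mem_paths_iff.2 ⟨rfl, hf ▸ hp⟩⟩

theorem dictLT_cons_iff {e f : G.Bridge} {p q : List G.Bridge} :
    G.dictLT (e :: p) (f :: q) ↔ G.order.lt e f ∨ e = f ∧ G.dictLT p q := by
  constructor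
  · intro h
    cases h with
    | cons h => exact Or.inr ⟨rfl, h⟩
    | rel h => exact Or.inl h
  · rintro (h | ⟨rfl, h⟩)
    · exact List.Lex.rel h
    · exact List.Lex.cons h

variable {E : V → Set X} {src tgt : V → X}

theorem src_mem_cylinder_of_minimal (hne : ∀ u, ∃ e, G.init e = u) (hmem : ∀ u, src u ∈ E u)
    (hsrc : ∀ e, (∀ f, ¬ G.order.lt f e) → G.map e (src (G.term e)) = src (G.init e)) {k : ℕ}
    {u : V} {p : List G.Bridge} (hp : p ∈ G.paths u k)
    (hmin : ∀ q ∈ G.paths u k, ¬ G.dictLT q p) : src u ∈ G.cylinder E u p := by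
  induction k generalizing u p with
  | zero =>
    obtain rfl := mem_paths_zero.1 hp
    exact hmem u
  | succ k ih =>
    obtain ⟨e, p, rfl, rfl, hp'⟩ := exists_cons_of_mem_paths hp
    refine ⟨_, ih hp' fun q hq h => ?_, hsrc e fun f h => ?_⟩
    · exact hmin _ (cons_mem_paths_iff.2 ⟨rfl, hq⟩) (dictLT_cons_iff.2 (Or.inr ⟨rfl, h⟩))
    · obtain ⟨q, hq⟩ := exists_cons_mem_paths hne f k
      exact hmin _ (init_eq_of_lt h ▸ hq) (dictLT_cons_iff.2 (Or.inl h))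

theorem tgt_mem_cylinder_of_maximal (hne : ∀ u, ∃ e, G.init e = u) (hmem : ∀ u, tgt u ∈ E u)
    (htgt : ∀ e, (∀ f, ¬ G.order.lt e f) → G.map e (tgt (G.term e)) = tgt (G.init e)) {k : ℕ}
    {u : V} {p : List G.Bridge} (hp : p ∈ G.paths u k)
    (hmax : ∀ q ∈ G.paths u k, ¬ G.dictLT p q) : tgt u ∈ G.cylinder E u p := by
  induction k generalizing u p with
  | zero =>
    obtain rfl := mem_paths_zero.1 hp
    exact hmem u
  | succ k ih =>
    obtain ⟨e, p, rfl, rfl, hp'⟩ := exists_cons_of_mem_paths hp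
    refine ⟨_, ih hp' fun q hq h => ?_, htgt e fun f h => ?_⟩
    · exact hmax _ (cons_mem_paths_iff.2 ⟨rfl, hq⟩) (dictLT_cons_iff.2 (Or.inr ⟨rfl, h⟩))
    · obtain ⟨q, hq⟩ := exists_cons_mem_paths hne f k
      exact hmax _ ((init_eq_of_lt h).symm ▸ hq) (dictLT_cons_iff.2 (Or.inl h))

/-- Where two adjacent paths part, the first goes on maximally and the second minimally, so that
their cylinders share the point at which the two bridges are linked. -/
theorem cylinder_inter_nonempty_of_adjacent (hne : ∀ u, ∃ e, G.init e = u)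
    (hsrcE : ∀ u, src u ∈ E u) (htgtE : ∀ u, tgt u ∈ E u)
    (hsrc : ∀ e, (∀ f, ¬ G.order.lt f e) → G.map e (src (G.term e)) = src (G.init e))
    (htgt : ∀ e, (∀ f, ¬ G.order.lt e f) → G.map e (tgt (G.term e)) = tgt (G.init e))
    (hlink : ∀ e f, G.order.lt e f → (∀ g, ¬ (G.order.lt e g ∧ G.order.lt g f)) →
      G.map e (tgt (G.term e)) = G.map f (src (G.term f)))
    {u : V} {k : ℕ} {p q : List G.Bridge} (hpq : G.Adjacent u k p q) :
    (G.cylinder E u p ∩ G.cylinder E u q).Nonempty := by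
  induction k generalizing u p q with
  | zero =>
    obtain ⟨hp, hq, hlt, -⟩ := hpq
    obtain rfl := mem_paths_zero.1 hp
    obtain rfl := mem_paths_zero.1 hq
    cases hlt
  | succ k ih =>
    obtain ⟨hp, hq, hlt, hadj⟩ := hpq
    obtain ⟨e, p, rfl, rfl, hp'⟩ := exists_cons_of_mem_paths hp
    obtain ⟨f, q, rfl, hf, hq'⟩ := exists_cons_of_mem_paths hq
    rcases dictLT_cons_iff.1 hlt with h | ⟨rfl, hlex⟩
    · have htgt_mem := tgt_mem_cylinder_of_maximal hne htgtE htgt hp' fun c hc hlt' =>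
        hadj _ (cons_mem_paths_iff.2 ⟨rfl, hc⟩)
          ⟨dictLT_cons_iff.2 (Or.inr ⟨rfl, hlt'⟩), dictLT_cons_iff.2 (Or.inl h)⟩
      have hsrc_mem := src_mem_cylinder_of_minimal hne hsrcE hsrc hq' fun c hc hlt' =>
        hadj _ (cons_mem_paths_iff.2 ⟨hf, hc⟩)
          ⟨dictLT_cons_iff.2 (Or.inl h), dictLT_cons_iff.2 (Or.inr ⟨rfl, hlt'⟩)⟩
      refine ⟨_, ⟨_, htgt_mem, hlink e f h fun g hg => ?_⟩, ⟨_, hsrc_mem, rfl⟩⟩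
      obtain ⟨c, hc⟩ := exists_cons_mem_paths hne g k
      exact hadj _ ((init_eq_of_lt hg.1).symm ▸ hc)
        ⟨dictLT_cons_iff.2 (Or.inl hg.1), dictLT_cons_iff.2 (Or.inl hg.2)⟩
    · obtain ⟨z, hz1, hz2⟩ := ih ⟨hp', hq', hlex, fun c hc h =>
        hadj _ (cons_mem_paths_iff.2 ⟨rfl, hc⟩)
          ⟨dictLT_cons_iff.2 (Or.inr ⟨rfl, h.1⟩), dictLT_cons_iff.2 (Or.inr ⟨rfl, h.2⟩)⟩⟩
      exact ⟨_, ⟨z, hz1, rfl⟩, z, hz2, rfl⟩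

end OrderedGIFS

theorem IsInvariantSet.subset_of_image_subset {X : Type} [MetricSpace X] {N : ℕ}
    {S : Fin N → X → X} {r : Fin N → ℝ} {K F : Set X} (hK : IsInvariantSet S K)
    (hS : IsSimilitudeIFS S r) (hSF : ∀ i, S i '' F ⊆ F) (hFc : IsClosed F) (hFn : F.Nonempty) :
    K ⊆ F := by
  refine hS.subset_of_subinvariant (V := Unit) (rule := fun _ => univ) (E := fun _ => K)
    (F := fun _ => F) (fun _ => ?_) (fun _ => hK.2.1.isBounded) (fun _ e _ => hSF e.1)
    (fun _ => hFc) (fun _ => hFn) ()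
  rw [biUnion_univ]
  exact hK.2.2.subset.trans (iUnion_subset fun i => subset_iUnion_of_subset (i, ()) subset_rfl)

theorem IsInvariantSet.subset_closure {X : Type} [MetricSpace X] {N : ℕ} {S : Fin N → X → X}
    {r : Fin N → ℝ} {K U : Set X} (hK : IsInvariantSet S K) (hS : IsSimilitudeIFS S r)
    (hU : U.Nonempty) (hSU : ∀ i, S i '' U ⊆ U) : K ⊆ closure U :=
  hK.subset_of_image_subset hS
    (fun i => (image_closure_subset_closure_image (hS.continuous i)).trans (closure_mono (hSU i)))
    isClosed_closure hU.closure

/-- The sets `E u` are the invariant sets of the GIFS induced by the partition `Q`; see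
`isInvariantFamily_inducedGIFS_iff`. -/
abbrev IsSubstitutionFamily {X : Type} [MetricSpace X] {N m : ℕ} (S : Fin N → X → X)
    (Q : Fin m → List (CopyEdge N m)) (E : OEdge m → Set X) : Prop :=
  IsRuleInvariant S (fun u => {e | e ∈ fineRule Q u}) E

section Induced

variable {X : Type} [MetricSpace X] {N m : ℕ} {S : Fin N → X → X}
  {Q : Fin m → List (CopyEdge N m)}

theorem isInvariantFamily_inducedGIFS_iff (hS : ∀ i, IsContractingSimilitude (S i))
    {E : OEdge m → Set X} :
    (inducedGIFS S hS Q).IsInvariantFamily E ↔ IsSubstitutionFamily S Q E := by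
  have hunion : ∀ u, (⋃ e : {e : (inducedGIFS S hS Q).Bridge // (inducedGIFS S hS Q).init e = u},
      (inducedGIFS S hS Q).map e '' E ((inducedGIFS S hS Q).term e)) =
      ⋃ e ∈ {e | e ∈ fineRule Q u}, S e.1 '' E e.2 := by
    intro u
    refine Subset.antisymm (iUnion_subset ?_) (iUnion₂_subset fun e he => ?_)
    · rintro ⟨⟨v, k⟩, rfl⟩
      exact subset_biUnion_of_mem (u := fun e : CopyEdge N m => S e.1 '' E e.2)
        ((fineRule Q v).get_mem k)
    · obtain ⟨k, rfl⟩ := List.get_of_mem he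
      exact subset_iUnion (fun e : {e : (inducedGIFS S hS Q).Bridge //
        (inducedGIFS S hS Q).init e = u} => (inducedGIFS S hS Q).map e ''
          E ((inducedGIFS S hS Q).term e)) ⟨⟨u, k⟩, rfl⟩
  constructor
  · rintro ⟨hE, heq⟩
    exact ⟨fun u => (hE u).1, fun u => (hE u).2, fun u => (heq u).trans (hunion u)⟩
  · rintro ⟨hn, hc, heq⟩
    exact ⟨fun u => ⟨hn u, hc u⟩, fun u => (heq u).trans (hunion u).symm⟩

namespace IsSubstitutionFamily

variable {r : Fin N → ℝ} {E : OEdge m → Set X}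

theorem rev_eq (hE : IsSubstitutionFamily S Q E) (hS : IsSimilitudeIFS S r) (u : OEdge m) :
    E u.rev = E u := by
  have hrev : IsSubstitutionFamily S Q fun u => E u.rev := by
    refine ⟨fun u => hE.nonempty _, fun u => hE.isCompact _, fun u => ?_⟩
    ext x
    rw [hE.mem_iff]
    simp only [mem_iUnion₂, mem_image, exists_prop, mem_ofPred_eq]
    constructor
    · rintro ⟨e, he, y, hy, rfl⟩
      exact ⟨(e.1, e.2.rev), mem_fineRule_rev.1 he, y, by simpa using hy, rfl⟩
    · rintro ⟨e, he, y, hy, rfl⟩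
      exact ⟨(e.1, e.2.rev), mem_fineRule_rev.2 (by simpa using he), y, hy, rfl⟩
  exact congrFun (hrev.unique hE hS) u

theorem eq_pos (hE : IsSubstitutionFamily S Q E) (hS : IsSimilitudeIFS S r) (u : OEdge m) :
    E u = E (u.1, 1) := by
  obtain ⟨j, ε⟩ := u
  rcases Int.units_eq_one_or ε with rfl | rfl
  · rfl
  · exact rev_eq hE hS (j, 1)

theorem image_subset_iUnion (hE : IsSubstitutionFamily S Q E) (hS : IsSimilitudeIFS S r)
    {β : Fin N → ℤˣ} (hQ : IsEdgePartition β Q) (i : Fin N) :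
    S i '' ⋃ l, E (l, 1) ⊆ ⋃ j, E (j, 1) := by
  rw [image_iUnion]
  refine iUnion_subset fun l => ?_
  obtain ⟨j, hj⟩ := hQ.cover i l
  rw [← eq_pos hE hS (l, β i)]
  exact (hE.image_subset (j, 1) (e := (i, (l, β i))) (mem_fineRule.2 (by simpa using hj))).trans
    (subset_iUnion (fun j => E (j, 1)) j)

theorem subset_invariantSet (hE : IsSubstitutionFamily S Q E) (hS : IsSimilitudeIFS S r)
    {K : Set X} (hK : IsInvariantSet S K) (u : OEdge m) : E u ⊆ K :=
  hS.subset_of_subinvariant (F := fun _ => K) hE.subset_iUnion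
    (fun u => (hE.isCompact u).isBounded) (fun _ e _ => hK.image_subset e.1)
    (fun _ => hK.2.1.isClosed) (fun _ => hK.1) u

theorem eq_iUnion_pos [NeZero m] (hE : IsSubstitutionFamily S Q E) (hS : IsSimilitudeIFS S r)
    {K : Set X} (hK : IsInvariantSet S K) {β : Fin N → ℤˣ} (hQ : IsEdgePartition β Q) :
    K = ⋃ j : Fin m, E (j, 1) := by
  refine Subset.antisymm ?_ (iUnion_subset fun j => subset_invariantSet hE hS hK _)
  exact hK.subset_of_image_subset hS (image_subset_iUnion hE hS hQ)
    (isCompact_iUnion fun j => hE.isCompact _).isClosed (nonempty_iUnion.2 ⟨0, hE.nonempty _⟩)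

variable [NeZero m] {a : Fin m → X}

theorem src_mem (hE : IsSubstitutionFamily S Q E) (hS : IsSimilitudeIFS S r)
    (hcons : IsConsistent S a Q) (hne : ∀ j, Q j ≠ []) (u : OEdge m) : OEdge.src a u ∈ E u := by
  refine hE.subset_of_subinvariant hS (E := fun u => {OEdge.src a u}) (fun u => ?_)
    (fun _ => Bornology.isBounded_singleton) u rfl
  have h := fineRule_ne_nil hne u
  rw [singleton_subset_iff, ← (isWalk_fineRule hcons u).src_head ((fineRule Q u).head h) h]
  exact mem_biUnion (mem_iff_exists_getD.2 ⟨0, List.length_pos_iff.2 h, rfl⟩)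
    (mem_image_of_mem _ rfl)

theorem tgt_mem (hE : IsSubstitutionFamily S Q E) (hS : IsSimilitudeIFS S r)
    (hcons : IsConsistent S a Q) (hne : ∀ j, Q j ≠ []) (u : OEdge m) : OEdge.tgt a u ∈ E u := by
  rw [← OEdge.src_rev, ← rev_eq hE hS]
  exact src_mem hE hS hcons hne _

end IsSubstitutionFamily

theorem inducedGIFS_lt_iff (hS : ∀ i, IsContractingSimilitude (S i)) {u : OEdge m}
    {i j : Fin (fineRule Q u).length} :
    (inducedGIFS S hS Q).order.lt ⟨u, i⟩ ⟨u, j⟩ ↔ i < j := Sigma.mk_lt_mk_iff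

theorem inducedGIFS_isLinear {r : Fin N → ℝ} [NeZero m] {a : Fin m → X}
    (hS : ∀ i, IsContractingSimilitude (S i)) (hSr : IsSimilitudeIFS S r)
    (hcons : IsConsistent S a Q) (hne : ∀ j, Q j ≠ []) : (inducedGIFS S hS Q).IsLinear := by
  intro E hE u k _ p q hpq
  rw [isInvariantFamily_inducedGIFS_iff] at hE
  have hpos : ∀ u, 0 < (fineRule Q u).length := fun u =>
    List.length_pos_iff.2 (fineRule_ne_nil hne u)
  have hget : ∀ (e : (inducedGIFS S hS Q).Bridge),
      (fineRule Q e.1).getD e.2 ((fineRule Q e.1).get e.2) = (fineRule Q e.1).get e.2 :=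
    fun e => List.getD_eq_getElem _ _ e.2.2
  refine OrderedGIFS.cylinder_inter_nonempty_of_adjacent (src := OEdge.src a) (tgt := OEdge.tgt a)
    (fun u => ⟨(⟨u, ⟨0, hpos u⟩⟩ : Σ u, Fin (fineRule Q u).length), rfl⟩)
    (IsSubstitutionFamily.src_mem hE hSr hcons hne) (IsSubstitutionFamily.tgt_mem hE hSr hcons hne)
    (fun e he => ?_) (fun e he => ?_) (fun e f hef hcov => ?_) hpq
  · have hfirst : (e.2 : ℕ) = 0 := Nat.eq_zero_of_not_pos fun h =>
      he ⟨e.1, ⟨0, hpos e.1⟩⟩ ((inducedGIFS_lt_iff hS).2 h)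
    have h := (isWalk_fineRule hcons e.1).src_head ((fineRule Q e.1).get e.2)
      (fineRule_ne_nil hne e.1)
    rwa [← hfirst, hget] at h
  · have hlast : (e.2 : ℕ) = (fineRule Q e.1).length - 1 := by
      by_contra hlt
      have hi : (e.2 : ℕ) + 1 < (fineRule Q e.1).length := by have := e.2.2; omega
      exact he ⟨e.1, ⟨e.2 + 1, hi⟩⟩ ((inducedGIFS_lt_iff hS).2 (Nat.lt_succ_self _))
    have h := (isWalk_fineRule hcons e.1).tgt_last ((fineRule Q e.1).get e.2)
      (fineRule_ne_nil hne e.1)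
    rwa [← hlast, hget] at h
  · obtain ⟨u, i⟩ := e
    obtain ⟨v, j⟩ := f
    have huv := OrderedGIFS.init_eq_of_lt (G := inducedGIFS S hS Q) hef
    obtain rfl : u = v := huv
    have hij : i < j := (inducedGIFS_lt_iff hS).1 hef
    have hsucc : (i : ℕ) + 1 = j := by
      by_contra hlt
      have hi : (i : ℕ) + 1 < j := lt_of_le_of_ne hij hlt
      exact hcov ⟨u, ⟨i + 1, hi.trans j.2⟩⟩ ⟨(inducedGIFS_lt_iff hS).2 (Nat.lt_succ_self _),
        (inducedGIFS_lt_iff hS).2 hi⟩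
    have h := (isWalk_fineRule hcons u).link ((fineRule Q u).get i) (hsucc.trans_lt j.2)
    rwa [hget ⟨u, i⟩, hsucc, List.getD_eq_getElem _ _ j.2] at h

end Induced

/-! ### Measures of the invariant sets -/

theorem eq_of_sum_le_sum {ι : Type*} [Fintype ι] {f g : ι → ℝ≥0∞} (hle : ∀ i, f i ≤ g i)
    (hf : ∀ i, f i ≠ ∞) (hsum : ∑ i, g i ≤ ∑ i, f i) (i : ι) : f i = g i := by
  classical
  refine le_antisymm (hle i) ?_
  have hrest : ∑ j ∈ Finset.univ.erase i, f j ≠ ∞ := ENNReal.sum_ne_top.2 fun j _ => hf j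
  refine (ENNReal.add_le_add_iff_right hrest).1 ?_
  calc g i + ∑ j ∈ Finset.univ.erase i, f j ≤ g i + ∑ j ∈ Finset.univ.erase i, g j := by
        gcongr with j
        exact hle j
    _ = ∑ j, g j := Finset.add_sum_erase _ _ (Finset.mem_univ i)
    _ ≤ ∑ j, f j := hsum
    _ = f i + ∑ j ∈ Finset.univ.erase i, f j := (Finset.add_sum_erase _ _ (Finset.mem_univ i)).symm

theorem measure_biUnion_list_le {X ι : Type*} [MeasurableSpace X] (μ : Measure X) (A : ι → Set X)
    (l : List ι) : μ (⋃ i ∈ {i | i ∈ l}, A i) ≤ (l.map fun i => μ (A i)).sum := by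
  induction l with
  | nil => simp
  | cons i l ih =>
    have hunion : ⋃ j ∈ {j | j ∈ i :: l}, A j = A i ∪ ⋃ j ∈ {j | j ∈ l}, A j := by
      simp only [List.mem_cons, mem_ofPred_eq, iUnion_or, iUnion_union_distrib,
        iUnion_iUnion_eq_left]
    rw [hunion, List.map_cons, List.sum_cons]
    exact (measure_union_le _ _).trans (by gcongr)

theorem measure_inter_eq_zero_of_sum_le {X ι : Type*} [MeasurableSpace X] {μ : Measure X}
    {A : ι → Set X} {l : List ι} (hA : ∀ i, MeasurableSet (A i))
    (hfin : ∀ i, μ (A i) ≠ ∞) (hsum : (l.map fun i => μ (A i)).sum ≤ μ (⋃ i ∈ {i | i ∈ l}, A i))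
    {i j : ι} (hi : i ∈ l) (hj : j ∈ l) (hij : i ≠ j) : μ (A i ∩ A j) = 0 := by
  classical
  set R := (l.erase i).erase j
  have hperm : l.Perm (i :: j :: R) := (List.perm_cons_erase hi).trans
    ((List.perm_cons_erase ((List.mem_erase_of_ne hij.symm).2 hj)).cons i)
  have hR : (R.map fun k => μ (A k)).sum ≠ ∞ := by
    refine List.sum_induction (· ≠ ∞) (fun _ _ hx hy => ENNReal.add_ne_top.2 ⟨hx, hy⟩)
      ENNReal.zero_ne_top fun x hx => ?_
    obtain ⟨k, -, rfl⟩ := List.mem_map.1 hx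
    exact hfin k
  have hunion : μ (⋃ k ∈ {k | k ∈ l}, A k) ≤ μ (A i ∪ A j) + (R.map fun k => μ (A k)).sum := by
    have h : ⋃ k ∈ {k | k ∈ l}, A k = (A i ∪ A j) ∪ ⋃ k ∈ {k | k ∈ R}, A k := by
      simp only [hperm.mem_iff, List.mem_cons, mem_ofPred_eq, iUnion_or, iUnion_union_distrib,
        iUnion_iUnion_eq_left, union_assoc]
    rw [h]
    exact (measure_union_le _ _).trans (by gcongr; exact measure_biUnion_list_le μ A R)
  have hle : μ (A i) + μ (A j) ≤ μ (A i ∪ A j) := by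
    refine (ENNReal.add_le_add_iff_right hR).1 (le_trans (le_of_eq ?_) (hsum.trans hunion))
    rw [(hperm.map _).sum_eq, List.map_cons, List.sum_cons, List.map_cons, List.sum_cons, add_assoc]
  rw [← measure_union_add_inter (A i) (hA j)] at hle
  have hunion_fin : μ (A i ∪ A j) ≠ ∞ :=
    ((measure_union_le _ _).trans_lt (ENNReal.add_lt_top.2 ⟨(hfin i).lt_top, (hfin j).lt_top⟩)).ne
  refine le_zero_iff.1 ((ENNReal.add_le_add_iff_left hunion_fin).1 ?_)
  rwa [add_zero]

section EdgeSums

variable {N m : ℕ} {Q : Fin m → List (CopyEdge N m)} {β : Fin N → ℤˣ} {M : Type*} [AddCommMonoid M]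

theorem sum_map_of_mem_iff_orientation {L : List (CopyEdge N m)} (hL : L.Nodup)
    (hmem : ∀ e, e ∈ L ↔ e ∈ orientedGraph m β) (f : CopyEdge N m → M) :
    (L.map f).sum = ∑ i, ∑ l, f (i, (l, β i)) := by
  rw [← List.sum_toFinset f hL, ← Fintype.sum_prod_type' fun i l => f (i, (l, β i))]
  have hβ : ∀ e ∈ L.toFinset, (e.1, (e.2.1, β e.1)) = e := fun e he => by
    rw [← show e.2.2 = β e.1 from (hmem e).1 (List.mem_toFinset.1 he)]
  exact Finset.sum_nbij' (fun e => (e.1, e.2.1)) (fun x => (x.1, (x.2, β x.1)))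
    (fun _ _ => Finset.mem_univ _) (fun x _ => List.mem_toFinset.2 ((hmem _).2 rfl))
    hβ (fun _ _ => rfl) fun e he => by rw [hβ e he]

theorem IsEdgePartition.sum_map (hQ : IsEdgePartition β Q) (f : CopyEdge N m → M) :
    ∑ j, ((Q j).map f).sum = ∑ i, ∑ l, f (i, (l, β i)) := by
  have hnodup : (List.ofFn Q).flatten.Nodup := List.nodup_flatten.2
    ⟨by simpa [List.mem_ofFn'] using hQ.nodup,
      List.pairwise_ofFn.2 fun i j hij => hQ.disjoint i j hij.ne⟩
  rw [← sum_map_of_mem_iff_orientation hnodup (fun e => ?_) f]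
  · rw [List.map_flatten, List.sum_flatten, List.map_ofFn, List.map_ofFn, List.sum_ofFn]
    rfl
  · simp only [List.mem_flatten, List.mem_ofFn', exists_range_iff]
    refine ⟨fun ⟨j, hj⟩ => hQ.orientation j e hj, fun he => ?_⟩
    obtain ⟨j, hj⟩ := hQ.cover e.1 e.2.1
    exact ⟨j, by rwa [← show e.2.2 = β e.1 from he] at hj⟩

theorem sum_map_fineRule {f : CopyEdge N m → M} (hf : ∀ e, f (e.1, e.2.rev) = f e) (u : OEdge m) :
    ((fineRule Q u).map f).sum = ((Q u.1).map f).sum := by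
  unfold fineRule
  split_ifs
  · rfl
  · rw [List.map_map, (List.reverse_perm _).map _ |>.sum_eq]
    exact congrArg List.sum (List.map_congr_left fun e _ => hf e)

theorem sum_ofReal_rpow_mul {r : Fin N → ℝ} (hr : ∀ i, 0 < r i) {s : ℝ} (hsum : ∑ i, r i ^ s = 1)
    (h : Fin m → ℝ≥0∞) : ∑ i, ∑ l, ENNReal.ofReal (r i ^ s) * h l = ∑ l, h l := by
  simp only [← Finset.mul_sum]
  rw [← Finset.sum_mul, ← ENNReal.ofReal_sum_of_nonneg fun i _ => Real.rpow_nonneg (hr i).le s,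
    hsum, ENNReal.ofReal_one, one_mul]

end EdgeSums

section NullOverlaps

variable {X ι V : Type*} [MetricSpace X] [MeasurableSpace X] [BorelSpace X] {S : ι → X → X}
  {r : ι → ℝ} {s : ℝ} {rule : V → List (ι × V)} {E : V → Set X}

theorem IsRuleInvariant.hausdorffMeasure_inter_eq_zero
    (hE : IsRuleInvariant S (fun u => {e | e ∈ rule u}) E) (hS : IsSimilitudeIFS S r) (hs : 0 ≤ s)
    (hfin : ∀ u, μH[s] (E u) < ∞)
    (hsum : ∀ u, μH[s] (E u) =
      ((rule u).map fun e => ENNReal.ofReal (r e.1 ^ s) * μH[s] (E e.2)).sum)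
    {u : V} {e f : ι × V} (he : e ∈ rule u) (hf : f ∈ rule u) (hne : e ≠ f) :
    μH[s] (S e.1 '' E e.2 ∩ S f.1 '' E f.2) = 0 := by
  have himage : ∀ e : ι × V,
      μH[s] (S e.1 '' E e.2) = ENNReal.ofReal (r e.1 ^ s) * μH[s] (E e.2) :=
    fun e => (hS.isSimilitude e.1).hausdorffMeasure_image hs _
  refine measure_inter_eq_zero_of_sum_le (A := fun e : ι × V => S e.1 '' E e.2)
    (fun e => ((hE.isCompact _).image (hS.continuous _)).measurableSet) (fun e => ?_) ?_ he hf hne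
  · rw [himage]
    exact ENNReal.mul_ne_top ENNReal.ofReal_ne_top (hfin _).ne
  · rw [← hE.eq_iUnion u, hsum]
    exact (congrArg List.sum (List.map_congr_left fun e _ => himage e)).le

end NullOverlaps

namespace IsSubstitutionFamily

variable {X : Type} [MetricSpace X] [MeasurableSpace X] [BorelSpace X] {N m : ℕ}
  {S : Fin N → X → X} {Q : Fin m → List (CopyEdge N m)} {r : Fin N → ℝ} {s : ℝ}
  {E : OEdge m → Set X} {K : Set X} {β : Fin N → ℤˣ}

theorem hausdorffMeasure_lt_top (hE : IsSubstitutionFamily S Q E) (hS : IsSimilitudeIFS S r)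
    (hK : IsInvariantSet S K) (hKfin : μH[s] K < ∞) (u : OEdge m) : μH[s] (E u) < ∞ :=
  (measure_mono (subset_invariantSet hE hS hK u)).trans_lt hKfin

/-- The two sides are compared termwise by subadditivity, and they have the same sum over all
letters because the edges `S_i(v_l^{β_i})` are used exactly once and `∑ i, r i ^ s = 1`. -/
theorem hausdorffMeasure_eq_sum (hE : IsSubstitutionFamily S Q E) (hS : IsSimilitudeIFS S r)
    (hs : 0 ≤ s) (hsum : ∑ i, r i ^ s = 1) (hfin : ∀ u, μH[s] (E u) < ∞)
    (hQ : IsEdgePartition β Q) (u : OEdge m) :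
    μH[s] (E u) =
      ((fineRule Q u).map fun e => ENNReal.ofReal (r e.1 ^ s) * μH[s] (E e.2)).sum := by
  have hle : ∀ j, μH[s] (E (j, 1)) ≤
      ((Q j).map fun e => ENNReal.ofReal (r e.1 ^ s) * μH[s] (E e.2)).sum := by
    intro j
    have hrule : fineRule Q (j, 1) = Q j := if_pos rfl
    rw [hE.eq_iUnion (j, 1), hrule]
    refine (measure_biUnion_list_le _ (fun e : CopyEdge N m => S e.1 '' E e.2) _).trans_eq ?_
    exact congrArg List.sum (List.map_congr_left fun e _ =>
      (hS.isSimilitude e.1).hausdorffMeasure_image hs _)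
  have htotal : ∑ j, ((Q j).map fun e => ENNReal.ofReal (r e.1 ^ s) * μH[s] (E e.2)).sum ≤
      ∑ j, μH[s] (E (j, 1)) := by
    rw [hQ.sum_map]
    simp only [eq_pos hE hS (_, β _)]
    exact (sum_ofReal_rpow_mul hS.ratio_pos hsum fun l => μH[s] (E (l, 1))).le
  rw [eq_pos hE hS u, eq_of_sum_le_sum hle (fun j => (hfin _).ne) htotal u.1,
    sum_map_fineRule fun e => by rw [rev_eq hE hS]]

theorem hausdorffMeasure_inter_eq_zero_of_mem_fineIter (hE : IsSubstitutionFamily S Q E)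
    (hS : IsSimilitudeIFS S r) (hs : 0 ≤ s) (hsum : ∑ i, r i ^ s = 1)
    (hfin : ∀ u, μH[s] (E u) < ∞) (hQ : IsEdgePartition β Q) {u : OEdge m} {n : ℕ}
    {w w' : List (Fin N) × OEdge m} (hw : w ∈ fineIter Q u n) (hw' : w' ∈ fineIter Q u n)
    (hne : w ≠ w') : μH[s] (wordMap S w.1 '' E w.2 ∩ wordMap S w'.1 '' E w'.2) = 0 := by
  induction n generalizing w w' with
  | zero =>
    simp only [fineIter, List.mem_singleton] at hw hw'
    exact absurd (hw.trans hw'.symm) hne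
  | succ n ih =>
    obtain ⟨v, hv, e, he, rfl⟩ := mem_fineIter_succ.1 hw
    obtain ⟨v', hv', e', he', rfl⟩ := mem_fineIter_succ.1 hw'
    have himage : ∀ (I : List (Fin N)) (e : CopyEdge N m),
        wordMap S (I ++ [e.1]) '' E e.2 = wordMap S I '' (S e.1 '' E e.2) := fun I e => by
      rw [image_image]
      exact image_congr fun x _ => wordMap_append S I [e.1] x
    simp only [himage]
    rcases eq_or_ne v v' with rfl | hvv
    · have hee : e ≠ e' := by
        rintro rfl
        exact hne rfl
      have hsim := hS.isSimilitude_wordMap v.1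
      rw [← image_inter hsim.injective, hsim.hausdorffMeasure_image hs,
        hE.hausdorffMeasure_inter_eq_zero hS hs hfin
          (hausdorffMeasure_eq_sum hE hS hs hsum hfin hQ) he he' hee, mul_zero]
    · exact measure_mono_null (inter_subset_inter (image_mono (hE.image_subset _ he))
        (image_mono (hE.image_subset _ he'))) (ih hv hv' hvv)

/-- The sets `E (j, 1)` have disjoint copies, up to null sets, in the pure cell. -/
theorem hausdorffMeasure_inter_eq_zero (hE : IsSubstitutionFamily S Q E)
    (hS : IsSimilitudeIFS S r) (hs : 0 ≤ s) (hsum : ∑ i, r i ^ s = 1)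
    (hfin : ∀ u, μH[s] (E u) < ∞) (hQ : IsEdgePartition β Q) (hpure : HasPureCell Q)
    {j j' : Fin m} (hne : j ≠ j') : μH[s] (E (j, 1) ∩ E (j', 1)) = 0 := by
  obtain ⟨I, ε, u, hI⟩ := hpure
  have hsim := hS.isSimilitude_wordMap I
  have hnull := hausdorffMeasure_inter_eq_zero_of_mem_fineIter hE hS hs hsum hfin hQ (hI j) (hI j')
    (fun h => hne (congrArg (fun w => w.2.1) h))
  rw [← image_inter hsim.injective, hsim.hausdorffMeasure_image hs, eq_pos hE hS (j, ε),
    eq_pos hE hS (j', ε), mul_eq_zero] at hnull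
  exact hnull.resolve_left (ENNReal.ofReal_pos.2 (Real.rpow_pos_of_pos hsim.ratio_pos s)).ne'

theorem hausdorffMeasure_pos [NeZero m] (hE : IsSubstitutionFamily S Q E)
    (hS : IsSimilitudeIFS S r) (hs : 0 ≤ s) (hK : IsInvariantSet S K) (hKpos : 0 < μH[s] K)
    (hQ : IsEdgePartition β Q) (hprim : IsPrimitivePartition Q) (u : OEdge m) :
    0 < μH[s] (E u) := by
  obtain ⟨l, hl⟩ : ∃ l : Fin m, 0 < μH[s] (E (l, 1)) := by
    by_contra! hcon
    refine hKpos.ne' ?_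
    rw [eq_iUnion_pos hE hS hK hQ, measure_iUnion_null_iff]
    exact fun j => le_zero_iff.1 (hcon j)
  have hstep : ∀ j, ∀ e ∈ Q j, 0 < μH[s] (E (e.2.1, 1)) → 0 < μH[s] (E (j, 1)) := by
    intro j e he hpos
    refine lt_of_lt_of_le ?_ (measure_mono (hE.image_subset (j, 1) (e := e)
      (mem_fineRule.2 (by simpa using he))))
    rw [(hS.isSimilitude e.1).hausdorffMeasure_image hs, eq_pos hE hS e.2]
    exact ENNReal.mul_pos (ENNReal.ofReal_pos.2 (Real.rpow_pos_of_pos (hS.ratio_pos _) s)).ne'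
      hpos.ne'
  obtain ⟨n, -, hn⟩ := hprim
  obtain ⟨v, hv, hpos⟩ := exists_of_mem_coarseRule_iterate
    (p := fun j => 0 < μH[s] (E (j, 1))) hstep (hn l u.1) hl
  rw [List.mem_singleton] at hv
  rwa [eq_pos hE hS, ← hv]

theorem hausdorffMeasure_eq_sum_of_isUnicursal [NeZero m] (hE : IsSubstitutionFamily S Q E)
    (hS : IsSimilitudeIFS S r) (hsum : ∑ i, r i ^ s = 1) (hK : IsInvariantSet S K)
    (hQ : IsEdgePartition β Q) (hnull : ∀ i j : Fin m, i ≠ j → μH[s] (E (i, 1) ∩ E (j, 1)) = 0)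
    {P : List (CopyEdge N m)} (hnodup : P.Nodup) (hmem : ∀ e, e ∈ P ↔ e ∈ orientedGraph m β) :
    μH[s] K = (P.map fun e => ENNReal.ofReal (r e.1 ^ s) * μH[s] (E e.2)).sum := by
  rw [sum_map_of_mem_iff_orientation hnodup hmem]
  simp only [eq_pos hE hS (_, β _)]
  rw [sum_ofReal_rpow_mul hS.ratio_pos hsum fun l => μH[s] (E (l, 1))]
  conv_lhs => rw [eq_iUnion_pos hE hS hK hQ]
  rw [measure_iUnion₀ (fun i j hij => hnull i j hij)
    fun j => (hE.isCompact _).measurableSet.nullMeasurableSet, tsum_fintype]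

end IsSubstitutionFamily

/-! ### The open set condition -/

/-- The smallest family of sets which contains the sets `O u` and which is mapped into itself by
the rule: the points `S_I(x)` with `x ∈ O v`, for all the pieces `S_I(v)` that arise from `u`. -/
inductive RuleHull {X ι V : Type*} (S : ι → X → X) (rule : V → Set (ι × V)) (O : V → Set X) :
    V → X → Prop
  | base {u : V} {x : X} : x ∈ O u → RuleHull S rule O u x
  | step {u : V} {e : ι × V} {x : X} :
    e ∈ rule u → RuleHull S rule O e.2 x → RuleHull S rule O u (S e.1 x)

namespace RuleHull

variable {X ι V : Type*} {S : ι → X → X} {rule : V → Set (ι × V)} {O F : V → Set X}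

theorem mem_of_image_subset (hO : ∀ u, O u ⊆ F u)
    (hF : ∀ u, ∀ e ∈ rule u, S e.1 '' F e.2 ⊆ F u) {u : V} {x : X}
    (hx : RuleHull S rule O u x) : x ∈ F u := by
  induction hx with
  | base hx => exact hO _ hx
  | step he _ ih => exact hF _ _ he (mem_image_of_mem _ ih)

theorem isOpen [TopologicalSpace X] (hS : ∀ i, IsOpenMap (S i)) (hO : ∀ u, IsOpen (O u)) (u : V) :
    IsOpen {x | RuleHull S rule O u x} := by
  rw [isOpen_iff_mem_nhds]
  intro x hx
  induction hx with
  | base hx => exact mem_of_superset ((hO _).mem_nhds hx) fun _ => base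
  | step he _ ih =>
    refine mem_of_superset ((hS _).image_mem_nhds ih) ?_
    rintro _ ⟨y, hy, rfl⟩
    exact step he hy

/-- Two pieces with a common point are followed inwards as long as their labels agree, and
different labels are excluded by the open set condition for `U`. -/
theorem disjoint {U : Set X} (hinj : ∀ i, Function.Injective (S i))
    (hdisj : ∀ i j, i ≠ j → Disjoint (S i '' U) (S j '' U))
    {R : V → V → Prop} (hRsymm : ∀ u v, R u v → R v u)
    (hRrule : ∀ u v, R u v → ∀ i x y, (i, x) ∈ rule u → (i, y) ∈ rule v → R x y)
    (hU : ∀ u x, RuleHull S rule O u x → x ∈ U)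
    (hsep : ∀ u v, R u v → ∀ x ∈ O u, ¬ RuleHull S rule O v x) {u v : V} (huv : R u v) :
    Disjoint {x | RuleHull S rule O u x} {x | RuleHull S rule O v x} := by
  rw [Set.disjoint_left]
  intro x hx hy
  induction hx generalizing v with
  | base hx => exact hsep _ _ huv _ hx hy
  | @step u e x he hx ih =>
    generalize hz : S e.1 x = z at hy
    cases hy with
    | base hz' => exact hsep _ _ (hRsymm _ _ huv) _ hz' (hz ▸ step he hx)
    | @step _ f y hf hy =>
      obtain ⟨i, u'⟩ := e
      obtain ⟨i', v'⟩ := f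
      rcases eq_or_ne i i' with rfl | hii
      · exact ih (hRrule _ _ huv i _ _ he hf) (hinj i hz ▸ hy)
      · exact Set.disjoint_left.1 (hdisj i i' hii) ⟨x, hU _ _ hx, rfl⟩ ⟨y, hU _ _ hy, hz.symm⟩

end RuleHull

theorem exists_disjoint_ball_thickening {X ι : Type*} [PseudoMetricSpace X] [Finite ι]
    {A : ι → Set X} (hA : ∀ i, IsClosed (A i)) (hsep : ∀ i, (A i \ ⋃ j ≠ i, A j).Nonempty) :
    ∃ x : ι → X, (∀ i, x i ∈ A i) ∧ ∃ ρ > 0, ∀ i j, i ≠ j →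
      Disjoint (Metric.ball (x i) ρ) (Metric.thickening ρ (A j)) := by
  choose x hx using hsep
  have hδ : ∀ i, ∃ δ > 0, Metric.ball (x i) δ ⊆ (⋃ j ≠ i, A j)ᶜ := fun i =>
    Metric.isOpen_iff.1 ((Set.toFinite _).isClosed_biUnion fun j _ => hA j).isOpen_compl _ (hx i).2
  choose δ hδ0 hδ using hδ
  obtain ⟨η, hη0, hη⟩ := exists_pos_forall_le_of_finite hδ0
  refine ⟨x, fun i => (hx i).1, η / 2, half_pos hη0, fun i j hij => ?_⟩
  rw [Set.disjoint_left]
  intro z hz hz'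
  obtain ⟨y, hy, hzy⟩ := Metric.mem_thickening_iff.1 hz'
  refine hδ i (Metric.mem_ball'.2 ?_) (mem_biUnion hij.symm hy)
  calc dist (x i) y ≤ dist (x i) z + dist z y := dist_triangle _ _ _
    _ < η / 2 + η / 2 := add_lt_add (Metric.mem_ball'.1 hz) hzy
    _ ≤ δ i := (add_halves η).le.trans (hη i)

theorem nonempty_sdiff_iUnion_of_measure_inter_eq_zero {X ι : Type*} [MeasurableSpace X]
    [Countable ι] {μ : Measure X} {A : ι → Set X} (hnull : ∀ i j, i ≠ j → μ (A i ∩ A j) = 0)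
    {i : ι} (hi : μ (A i) ≠ 0) : (A i \ ⋃ j ≠ i, A j).Nonempty := by
  rw [nonempty_iff_ne_empty]
  intro h
  refine hi ?_
  rw [← inter_eq_left.2 (sdiff_eq_empty.1 h), inter_iUnion₂]
  exact measure_iUnion_null fun j => measure_iUnion_null fun hj => hnull i j hj.symm

theorem IsSimilitudeIFS.image_thickening_subset {X ι : Type*} [MetricSpace X] {S : ι → X → X}
    {r : ι → ℝ} (hS : IsSimilitudeIFS S r) (i : ι) {ρ : ℝ} {A B : Set X} (hAB : S i '' A ⊆ B) :
    S i '' Metric.thickening ρ A ⊆ Metric.thickening ρ B := by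
  rintro _ ⟨z, hz, rfl⟩
  obtain ⟨y, hy, hzy⟩ := Metric.mem_thickening_iff.1 hz
  refine Metric.mem_thickening_iff.2 ⟨S i y, hAB (mem_image_of_mem _ hy), ?_⟩
  rw [(hS.isSimilitude i).dist_map]
  exact (mul_le_of_le_one_left dist_nonneg (hS.ratio_lt_one i).le).trans_lt hzy

section Induced

variable {X : Type} [MetricSpace X] {N m : ℕ} {S : Fin N → X → X} {Q : Fin m → List (CopyEdge N m)}

theorem inducedGIFS_openSetCondition_of_forall_mem (hS : ∀ i, IsContractingSimilitude (S i))
    (hQ : ∀ j, (Q j).Nodup) {G : OEdge m → Set X} (hGo : ∀ u, IsOpen (G u))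
    (hGn : ∀ u, (G u).Nonempty) (hGS : ∀ u, ∀ e ∈ fineRule Q u, S e.1 '' G e.2 ⊆ G u)
    (hGd : ∀ u, ∀ e ∈ fineRule Q u, ∀ f ∈ fineRule Q u, e ≠ f →
      Disjoint (S e.1 '' G e.2) (S f.1 '' G f.2)) :
    (inducedGIFS S hS Q).OpenSetCondition := by
  refine ⟨G, fun u => ⟨hGo u, hGn u⟩, fun e => hGS e.1 _ (List.get_mem _ e.2), ?_⟩
  rintro ⟨u, k⟩ ⟨v, l⟩ hne huv
  obtain rfl : u = v := huv
  refine hGd u _ (List.get_mem _ k) _ (List.get_mem _ l) fun h => hne ?_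
  rw [(nodup_fineRule hQ u).injective_get h]

end Induced

/-- The open sets are the hulls of `U ∩ ball (x j) ρ`, where the points `x j` of `E (j, 1)` have
distance at least `2 * ρ` from the other sets `E (l, 1)`. -/
theorem inducedGIFS_openSetCondition {X : Type} [NormedAddCommGroup X] [NormedSpace ℝ X]
    [FiniteDimensional ℝ X] {N m : ℕ} {S : Fin N → X → X} {r : Fin N → ℝ}
    {Q : Fin m → List (CopyEdge N m)} (hSc : ∀ i, IsContractingSimilitude (S i))
    (hS : IsSimilitudeIFS S r) (hOSC : IFSOpenSetCondition S) {K : Set X}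
    (hK : IsInvariantSet S K) {β : Fin N → ℤˣ} (hQ : IsEdgePartition β Q)
    {E : OEdge m → Set X} (hE : IsSubstitutionFamily S Q E)
    (hsep : ∀ j, (E (j, 1) \ ⋃ l ≠ j, E (l, 1)).Nonempty) :
    (inducedGIFS S hSc Q).OpenSetCondition := by
  obtain ⟨U, hUo, hUn, hSU, hUd⟩ := hOSC
  obtain ⟨x, hxE, ρ, hρ, hball⟩ := exists_disjoint_ball_thickening
    (fun j => (hE.isCompact (j, 1)).isClosed) hsep
  let O : OEdge m → Set X := fun u => U ∩ Metric.ball (x u.1) ρ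
  let G : OEdge m → Set X := fun u => {z | RuleHull S (fun u => {e | e ∈ fineRule Q u}) O u z}
  have hOn : ∀ u, (O u).Nonempty := fun u => by
    have hx : x u.1 ∈ closure U :=
      hK.subset_closure hS hUn hSU (hE.subset_invariantSet hS hK _ (hxE u.1))
    obtain ⟨y, hy, hxy⟩ := Metric.mem_closure_iff.1 hx ρ hρ
    exact ⟨y, hy, Metric.mem_ball'.2 hxy⟩
  have hGU : ∀ u, G u ⊆ U := fun u z hz =>
    hz.mem_of_image_subset (F := fun _ => U) (fun _ => inter_subset_left) fun _ e _ => hSU e.1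
  have hGE : ∀ u, G u ⊆ Metric.thickening ρ (E u) := fun u z hz => by
    refine hz.mem_of_image_subset (F := fun u => Metric.thickening ρ (E u)) (fun u => ?_)
      fun u e he => hS.image_thickening_subset e.1 (hE.image_subset u he)
    rw [hE.eq_pos hS u]
    exact inter_subset_right.trans (Metric.ball_subset_thickening (hxE u.1) ρ)
  have hsepO : ∀ u v : OEdge m, u.1 ≠ v.1 → ∀ z ∈ O u, z ∉ G v := fun u v huv z hz hz' => by
    refine Set.disjoint_left.1 (hball _ _ huv) hz.2 ?_
    rw [← hE.eq_pos hS v]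
    exact hGE v hz'
  have hdisj : ∀ {u v : OEdge m}, u.1 ≠ v.1 → Disjoint (G u) (G v) :=
    RuleHull.disjoint (R := fun u v => u.1 ≠ v.1) (fun i => hS.injective i) hUd
      (fun _ _ => Ne.symm) (fun _ _ h _ _ _ => hQ.fst_ne h) hGU hsepO
  refine inducedGIFS_openSetCondition_of_forall_mem (G := G) hSc hQ.nodup
    (fun u => RuleHull.isOpen (fun i => (hS.isSimilitude i).isOpenMap)
      (fun u => hUo.inter Metric.isOpen_ball) u)
    (fun u => (hOn u).mono fun _ => RuleHull.base) ?_ ?_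
  · rintro u e he _ ⟨z, hz, rfl⟩
    exact RuleHull.step he hz
  · rintro u ⟨i, v⟩ he ⟨i', v'⟩ hf hne
    rcases eq_or_ne i i' with rfl | hii
    · refine (disjoint_image_iff (hS.injective i)).2 (hdisj ?_)
      exact hQ.fst_ne_of_ne he hf fun h => hne (congrArg _ h)
    · exact (hUd i i' hii).mono (image_mono (hGU v)) (image_mono (hGU v'))

/-! ### The optimal parameterization -/

/-- The substitution rule extended by a root `none`, which stands for the whole of `K` and is
replaced by the unicursal path `P`. -/
def rootRule {N m : ℕ} (P : List (CopyEdge N m)) (Q : Fin m → List (CopyEdge N m))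
    (w : Option (OEdge m)) : List (Fin N × Option (OEdge m)) :=
  (w.elim P (fineRule Q)).map fun e => (e.1, some e.2)

namespace IsSubstitutionFamily

variable {X : Type} [MetricSpace X] {N m : ℕ} [NeZero m] {S : Fin N → X → X}
  {Q : Fin m → List (CopyEdge N m)} {r : Fin N → ℝ} {E : OEdge m → Set X} {K : Set X}
  {a : Fin m → X} {β : Fin N → ℤˣ} {P : List (CopyEdge N m)}

theorem isRuleInvariant_rootRule (hE : IsSubstitutionFamily S Q E) (hS : IsSimilitudeIFS S r)
    (hK : IsInvariantSet S K) (hQ : IsEdgePartition β Q)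
    (hP : ∀ e, e ∈ P ↔ e ∈ orientedGraph m β) :
    IsRuleInvariant S (fun w => {e | e ∈ rootRule P Q w}) (fun w => w.elim K E) := by
  refine ⟨?_, ?_, ?_⟩
  · rintro (_ | u)
    exacts [hK.1, hE.nonempty u]
  · rintro (_ | u)
    exacts [hK.2.1, hE.isCompact u]
  · have hroot : K = ⋃ e ∈ {e | e ∈ P}, S e.1 '' E e.2 := by
      refine Subset.antisymm (fun x hx => ?_) (iUnion₂_subset fun e _ =>
        (image_mono (subset_invariantSet hE hS hK e.2)).trans (hK.image_subset e.1))
      rw [hK.2.2] at hx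
      obtain ⟨i, y, hy, rfl⟩ := mem_iUnion.1 hx
      rw [eq_iUnion_pos hE hS hK hQ] at hy
      obtain ⟨l, hl⟩ := mem_iUnion.1 hy
      rw [← eq_pos hE hS (l, β i)] at hl
      exact mem_biUnion (x := (i, (l, β i))) ((hP _).2 rfl) (mem_image_of_mem _ hl)
    rintro (_ | u)
    · refine hroot.trans ?_
      ext x
      simp [rootRule]
    · refine (hE.eq_iUnion u).trans ?_
      ext x
      simp [rootRule]

theorem exists_isOptimalParameterization [CompleteSpace X] [MeasurableSpace X] [BorelSpace X]
    {s : ℝ≥0} (hE : IsSubstitutionFamily S Q E) (hS : IsSimilitudeIFS S r) (hs : 0 < s)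
    (hsum : ∑ i, r i ^ (s : ℝ) = 1) (hK : IsInvariantSet S K) (hKpos : 0 < μH[(s : ℝ)] K)
    (hKfin : μH[(s : ℝ)] K < ∞) (hP : IsUnicursal S a β P) (hQ : IsEdgePartition β Q)
    (hcons : IsConsistent S a Q) (hpos : ∀ u, 0 < μH[(s : ℝ)] (E u))
    (hnull : ∀ i j : Fin m, i ≠ j → μH[(s : ℝ)] (E (i, 1) ∩ E (j, 1)) = 0) :
    ∃ φ : ℝ → X, IsOptimalParameterization s K φ := by
  obtain ⟨⟨x, y, hxy⟩, hPnodup, hPmem⟩ := hP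
  have hfin := hausdorffMeasure_lt_top hE hS hK hKfin
  refine (isRuleInvariant_rootRule hE hS hK hQ hPmem).exists_isOptimalParameterization hS hs
    (src := fun w => w.elim x (OEdge.src a)) (tgt := fun w => w.elim y (OEdge.tgt a)) ?_ ?_ ?_ ?_
    none
  · rintro (_ | u)
    exacts [hxy.map (fun e : CopyEdge N m => (e.1, some e.2)) (fun _ => rfl) fun _ => rfl,
      (isWalk_fineRule hcons u).map (fun e : CopyEdge N m => (e.1, some e.2)) (fun _ => rfl)
        fun _ => rfl]
  · rintro (_ | u)
    exacts [hKpos, hpos u]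
  · rintro (_ | u)
    exacts [hKfin, hfin u]
  · intro w
    rw [rootRule, List.map_map]
    cases w with
    | none => exact hausdorffMeasure_eq_sum_of_isUnicursal hE hS hsum hK hQ hnull hPnodup hPmem
    | some u => exact hausdorffMeasure_eq_sum hE hS s.2 hsum hfin hQ u

end IsSubstitutionFamily

theorem IsInvariantSet.exists_isSubstitutionFamily {X : Type} [MetricSpace X] {N m : ℕ}
    {S : Fin N → X → X} {r : Fin N → ℝ} {K : Set X} (hK : IsInvariantSet S K)
    (hS : IsSimilitudeIFS S r) {Q : Fin m → List (CopyEdge N m)} (hQ : ∀ j, Q j ≠ []) :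
    ∃ E, IsSubstitutionFamily S Q E :=
  exists_isRuleInvariant hS.continuous hS.injective hK.2.1 hK.1 hK.image_subset
    fun u => List.exists_mem_of_ne_nil _ (fineRule_ne_nil hQ u)

theorem theorem1p3_general {X : Type} [NormedAddCommGroup X] [NormedSpace ℝ X]
    [FiniteDimensional ℝ X] [MeasurableSpace X] [BorelSpace X] {N m : ℕ} [NeZero m] (hN : 2 ≤ N)
    (S : Fin N → X → X) (hS : ∀ i, IsContractingSimilitude (S i)) (hOSC : IFSOpenSetCondition S)
    (K : Set X) (hK : IsInvariantSet S K) (s : ℝ≥0) (hs : dimH K = (s : ℝ≥0∞))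
    (a : Fin m → X) (β : Fin N → ℤˣ)
    (P : List (CopyEdge N m)) (hP : IsUnicursal S a β P)
    (Q : Fin m → List (CopyEdge N m)) (hQ : IsPathPartition P Q)
    (hcons : IsConsistent S a Q) (hprim : IsPrimitivePartition Q) (hpure : HasPureCell Q) :
    ((inducedGIFS S hS Q).IsLinear ∧ (inducedGIFS S hS Q).OpenSetCondition) ∧
    (∃! E, (inducedGIFS S hS Q).IsInvariantFamily E) ∧
    (∀ E, (inducedGIFS S hS Q).IsInvariantFamily E →
      K = ⋃ j : Fin m, E (j, 1) ∧
      ∀ i j : Fin m, i ≠ j → μH[(s : ℝ)] (E (i, 1) ∩ E (j, 1)) = 0) ∧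
    ∃ φ : ℝ → X, IsOptimalParameterization s K φ := by
  have := FiniteDimensional.complete ℝ X
  obtain ⟨r, hr⟩ := exists_isSimilitudeIFS hS
  obtain ⟨hs0, hsum, hKpos, hKfin⟩ := hK.moran hN hr hOSC hs
  have hQβ := hP.isEdgePartition hQ
  obtain ⟨E, hE⟩ := hK.exists_isSubstitutionFamily hr hprim.ne_nil
  have huniq : ∀ F, (inducedGIFS S hS Q).IsInvariantFamily F → F = E := fun F hF =>
    ((isInvariantFamily_inducedGIFS_iff hS).1 hF).unique hE hr
  have hpos := hE.hausdorffMeasure_pos hr s.2 hK hKpos hQβ hprim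
  have hnull : ∀ i j : Fin m, i ≠ j → μH[(s : ℝ)] (E (i, 1) ∩ E (j, 1)) = 0 := fun i j =>
    hE.hausdorffMeasure_inter_eq_zero hr s.2 hsum (hE.hausdorffMeasure_lt_top hr hK hKfin) hQβ hpure
  refine ⟨⟨inducedGIFS_isLinear hS hr hcons hprim.ne_nil,
      inducedGIFS_openSetCondition hS hr hOSC hK hQβ hE fun j =>
        nonempty_sdiff_iUnion_of_measure_inter_eq_zero hnull (hpos (j, 1)).ne'⟩,
    ⟨E, (isInvariantFamily_inducedGIFS_iff hS).2 hE, huniq⟩, fun F hF => ?_,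
    hE.exists_isOptimalParameterization hr hs0 hsum hK hKpos hKfin hP hQβ hcons hpos hnull⟩
  rw [huniq F hF]
  exact ⟨hE.eq_iUnion_pos hr hK hQβ, hnull⟩

theorem theorem1p3 {d N m : ℕ} [NeZero m] (hN : 2 ≤ N)
    (S : Fin N → EuclideanSpace ℝ (Fin d) → EuclideanSpace ℝ (Fin d))
    (hS : ∀ i, IsContractingSimilitude (S i)) (hOSC : IFSOpenSetCondition S)
    (K : Set (EuclideanSpace ℝ (Fin d))) (hK : IsInvariantSet S K)
    (s : ℝ≥0) (hs : dimH K = (s : ℝ≥0∞))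
    (a : Fin m → EuclideanSpace ℝ (Fin d)) (ha : Function.Injective a)
    (hA : IsSkeleton S K (Set.range a))
    (β : Fin N → ℤˣ)
    (P : List (CopyEdge N m)) (hP : IsUnicursal S a β P)
    (Q : Fin m → List (CopyEdge N m)) (hQ : IsPathPartition P Q)
    (hcons : IsConsistent S a Q) (hprim : IsPrimitivePartition Q) (hpure : HasPureCell Q) :
    -- (i) the induced GIFS is a linear GIFS satisfying the open set condition
    ((inducedGIFS S hS Q).IsLinear ∧ (inducedGIFS S hS Q).OpenSetCondition) ∧
    -- (ii) its invariant sets exist, are unique, cover `K`, and have null overlaps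
    (∃! E, (inducedGIFS S hS Q).IsInvariantFamily E) ∧
    (∀ E, (inducedGIFS S hS Q).IsInvariantFamily E →
      K = ⋃ j : Fin m, E (j, 1) ∧
      ∀ i j : Fin m, i ≠ j → μH[(s : ℝ)] (E (i, 1) ∩ E (j, 1)) = 0) ∧
    -- (iii) `K` admits optimal parameterizations
    ∃ φ : ℝ → EuclideanSpace ℝ (Fin d), IsOptimalParameterization s K φ := by
  exact theorem1p3_general hN S hS hOSC K hK s hs a β P hP Q hQ hcons hprim hpure
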